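/- **Setting.** Let $N\ge 3$ be an integer, $\alpha\in(0,N)$, and let $p,q,r$ be real numbers with $$\frac{N+\alpha}{N}<p<\frac{N+\alpha}{N-2},\qquad 1<q<\frac{N+2}{N-2},\qquad q<p,\qquad \frac1r+\frac{q+1}{2^*}=1,\quad 2^*=\frac{2N}{N-2}.$$ Let $K\in L^r(\mathbb R^N)$ be real-valued with $K\ge 0$ a.e. Let $I_\alpha(x)=A_\alpha|x|^{-(N-\alpha)}$ with $A_\alpha=\Gamma(\frac{N-\alpha}{2})/\big(\Gamma(\frac{\alpha}{2})\pi^{N/2}2^\alpha\big)$ be the Riesz potential. Let $H^1(\mathbb R^N)$ be the space of real-valued functions $u\in L^2$ with weak gradient in $L^2$, with norm $\|u\|^2=\int_{\mathbb R^N}(|\nabla u|^2+|u|^2)$, and for $u\in H^1(\mathbb R^N)$ put $\phi_u=I_2*(K|u|^q)$. Consider the reduced equation $$-\Delta u+u+K\phi_u|u|^{q-2}u=(I_\alpha*|u|^p)|u|^{p-2}u\quad\text{in }\mathbb R^N \tag{R}$$ and the Choquard equation $$-\Delta u+u=(I_\alpha*|u|^p)|u|^{p-2}u\quad\text{in }\mathbb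 R^N, \tag{C}$$ whose solutions are understood in the weak sense, tested against all $v\in H^1(\mathbb R^N)$, and the functionals on $H^1(\mathbb R^N)$ $$\mathcal J(u)=\frac12\int(|\nabla u|^2+|u|^2)+\frac1{2q}\int K\phi_u|u|^q-\frac1{2p}\int(I_\alpha*|u|^p)|u|^p,$$ $$\mathcal E(u)=\frac12\int(|\nabla u|^2+|u|^2)-\frac1{2p}\int(I_\alpha*|u|^p)|u|^p .$$ Let $\mathcal N=\{u\in H^1(\mathbb R^N)\setminus\{0\}:\langle\mathcal J'(u),u\rangle=0\}$ be the Nehari manifold of $\mathcal J$. With $\mathcal G(u)=\langle\mathcal J'(u),u\rangle$, the derivative $(\mathcal J|_{\mathcal N})'(u)$ at $u\in\mathcal N$ is the restriction of $\mathcal J'(u)$ to the tangent space $\ker\mathcal G'(u)$. **Proposition 5.2.** Let $(u_n)\subset\mathcal N$ be a Palais–Smale sequence of $\mathcal J|_{\mathcal N}$, that is, $(\mathcal J(u_n))$ is bounded and $\|(\mathcal J|_{\mathcal N})'(u_n)\|\to0$ in the dual norm. Then there exists a (possibly trivial) weak solution $u\in H^1(\mathbb R^N)$ of (R) such that, after replacing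 $(u_n)$ by a subsequence, one of the following holds: 1. $u_n\to u$ strongly in $H^1(\mathbb R^N)$; or 2. $u_n\rightharpoonup u$ weakly but not strongly in $H^1(\mathbb R^N)$, and there exist an integer $k\ge1$, nontrivial weak solutions $u_1,\dots,u_k\in H^1(\mathbb R^N)$ of (C), and sequences of points $(y_{n,1}),\dots,(y_{n,k})\subset\mathbb R^N$ such that, as $n\to\infty$, - (i) $|y_{n,j}|\to\infty$ for every $j$, and $|y_{n,j}-y_{n,i}|\to\infty$ whenever $i\ne j$; - (ii) $u_n-\sum_{j=1}^k u_j(\cdot+y_{n,j})\to u$ strongly in $H^1(\mathbb R^N)$; - (iii) $\mathcal J(u_n)\to\mathcal J(u)+\sum_{j=1}^k\mathcal E(u_j)$. -/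

import Mathlib

open MeasureTheory Filter Topology
open scoped ContDiff RealInnerProductSpace

noncomputable section

namespace Choquard

/-- The space `ℝ^N` with its Euclidean norm. -/
abbrev RN (N : ℕ) : Type := EuclideanSpace ℝ (Fin N)

/-- The Hilbert space `L²(ℝ^N; ℝ) × L²(ℝ^N; ℝ^N)` in which pairs `(u, ∇u)` live. -/
abbrev L2Pair (N : ℕ) : Type :=
  WithLp 2 (Lp ℝ 2 (volume : Measure (RN N)) × Lp (RN N) 2 (volume : Measure (RN N)))

/-- `g` is the weak (distributional) gradient of `u`: for every test function `φ ∈ C_c^∞(ℝ^N)` and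
every direction `e`, one has `∫ u ∂_e φ = - ∫ (g · e) φ`. -/
def IsWeakGradient {N : ℕ} (u : RN N → ℝ) (g : RN N → RN N) : Prop :=
  ∀ φ : RN N → ℝ, ContDiff ℝ ∞ φ → HasCompactSupport φ → ∀ e : RN N,
    ∫ x, u x * fderiv ℝ φ x e = - ∫ x, ⟪g x, e⟫ * φ x

theorem memLp_test {N : ℕ} {φ : RN N → ℝ} (h : ContDiff ℝ ∞ φ) (hc : HasCompactSupport φ) :
    MemLp φ 2 (volume : Measure (RN N)) :=
  h.continuous.memLp_of_hasCompactSupport hc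

theorem memLp_test_fderiv {N : ℕ} {φ : RN N → ℝ} (h : ContDiff ℝ ∞ φ) (hc : HasCompactSupport φ)
    (e : RN N) : MemLp (fun x => fderiv ℝ φ x e) 2 (volume : Measure (RN N)) :=
  ((h.continuous_fderiv (by simp)).clm_apply continuous_const).memLp_of_hasCompactSupport
    (hc.fderiv_apply (𝕜 := ℝ) e)

theorem integrable_mul_test_fderiv {N : ℕ} {φ : RN N → ℝ} (h : ContDiff ℝ ∞ φ)
    (hc : HasCompactSupport φ) (e : RN N) (u : Lp ℝ 2 (volume : Measure (RN N))) :
    Integrable (fun x => u x * fderiv ℝ φ x e) :=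
  (Lp.memLp u).integrable_mul (memLp_test_fderiv h hc e)

theorem integrable_inner_mul_test {N : ℕ} {φ : RN N → ℝ} (h : ContDiff ℝ ∞ φ)
    (hc : HasCompactSupport φ) (e : RN N) (g : Lp (RN N) 2 (volume : Measure (RN N))) :
    Integrable (fun x => ⟪g x, e⟫ * φ x) :=
  ((Lp.memLp g).inner_const e).integrable_mul (memLp_test h hc)

/-- The Sobolev space `H¹(ℝ^N)` as the linear subspace of all pairs `(u, ∇u)` with `u ∈ L²` and
weak gradient `∇u ∈ L²`. -/
def sobolevSubspace (N : ℕ) : Submodule ℝ (L2Pair N) where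
  carrier := {w | IsWeakGradient (w.fst : RN N → ℝ) (w.snd : RN N → RN N)}
  zero_mem' := by
    intro φ _ _ e
    simp
  add_mem' := by
    intro a b ha hb φ hφ hc e
    have h1 : ∫ x, ((a + b).fst : RN N → ℝ) x * fderiv ℝ φ x e
        = ∫ x, (a.fst x * fderiv ℝ φ x e + b.fst x * fderiv ℝ φ x e) := by
      refine integral_congr_ae ?_
      filter_upwards [Lp.coeFn_add a.fst b.fst] with x hx
      simp only [WithLp.add_fst, hx, Pi.add_apply]
      ring
    have h2 : ∫ x, ⟪((a + b).snd : RN N → RN N) x, e⟫ * φ x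
        = ∫ x, (⟪a.snd x, e⟫ * φ x + ⟪b.snd x, e⟫ * φ x) := by
      refine integral_congr_ae ?_
      filter_upwards [Lp.coeFn_add a.snd b.snd] with x hx
      simp only [WithLp.add_snd, hx, Pi.add_apply, inner_add_left]
      ring
    rw [h1, h2, integral_add (integrable_mul_test_fderiv hφ hc e _)
      (integrable_mul_test_fderiv hφ hc e _), integral_add (integrable_inner_mul_test hφ hc e _)
      (integrable_inner_mul_test hφ hc e _), ha φ hφ hc e, hb φ hφ hc e]
    ring
  smul_mem' := by
    intro c a ha φ hφ hc e
    have h1 : ∫ x, ((c • a).fst : RN N → ℝ) x * fderiv ℝ φ x e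
        = ∫ x, c * (a.fst x * fderiv ℝ φ x e) := by
      refine integral_congr_ae ?_
      filter_upwards [Lp.coeFn_smul c a.fst] with x hx
      simp only [WithLp.smul_fst, hx, Pi.smul_apply, smul_eq_mul]
      ring
    have h2 : ∫ x, ⟪((c • a).snd : RN N → RN N) x, e⟫ * φ x
        = ∫ x, c * (⟪a.snd x, e⟫ * φ x) := by
      refine integral_congr_ae ?_
      filter_upwards [Lp.coeFn_smul c a.snd] with x hx
      simp only [WithLp.smul_snd, hx, Pi.smul_apply, real_inner_smul_left]
      ring
    rw [h1, h2, integral_const_mul, integral_const_mul, ha φ hφ hc e]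
    ring

/-- The Sobolev space `H¹(ℝ^N)`, with the norm `‖u‖² = ∫ |∇u|² + |u|²` inherited from `L2Pair`. -/
abbrev H1 (N : ℕ) : Type := sobolevSubspace N

/-- The function underlying an element of `H¹(ℝ^N)`. -/
def H1.fn {N : ℕ} (u : H1 N) : RN N → ℝ := (u : L2Pair N).fst

/-- The weak gradient of an element of `H¹(ℝ^N)`. -/
def H1.grad {N : ℕ} (u : H1 N) : RN N → RN N := (u : L2Pair N).snd

/-- The scalar product of `H¹(ℝ^N)` is the usual one. -/
theorem H1.inner_eq {N : ℕ} (u v : H1 N) :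
    ⟪u, v⟫ = ∫ x, (⟪u.grad x, v.grad x⟫ + u.fn x * v.fn x) := by
  have h : ⟪u, v⟫ = ⟪(u : L2Pair N).fst, (v : L2Pair N).fst⟫
      + ⟪(u : L2Pair N).snd, (v : L2Pair N).snd⟫ := rfl
  rw [h, L2.inner_def, L2.inner_def, add_comm,
    ← integral_add (L2.integrable_inner _ _) (L2.integrable_inner _ _)]
  refine integral_congr_ae (ae_of_all _ fun x => ?_)
  simp only [H1.fn, H1.grad, RCLike.inner_apply, conj_trivial]
  simp [mul_comm]

/-- The norm of `H¹(ℝ^N)` is the usual one. -/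
theorem H1.norm_sq_eq {N : ℕ} (u : H1 N) :
    ‖u‖ ^ 2 = ∫ x, (‖u.grad x‖ ^ 2 + |u.fn x| ^ 2) := by
  rw [← real_inner_self_eq_norm_sq, H1.inner_eq]
  refine integral_congr_ae (ae_of_all _ fun x => ?_)
  simp only [real_inner_self_eq_norm_sq, sq_abs]
  ring

theorem measurePreserving_shift {N : ℕ} (y : RN N) :
    MeasurePreserving (fun x : RN N => x + y) volume volume :=
  measurePreserving_add_right volume y

/-- The translate `u(· + y)` of `u ∈ H¹(ℝ^N)`, whose gradient is `(∇u)(· + y)`. -/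
def H1.translate {N : ℕ} (y : RN N) (u : H1 N) : H1 N :=
  ⟨WithLp.toLp 2
    (Lp.compMeasurePreserving (fun x => x + y) (measurePreserving_shift y) (u : L2Pair N).fst,
      Lp.compMeasurePreserving (fun x => x + y) (measurePreserving_shift y) (u : L2Pair N).snd), by
    intro φ hφ hc e
    have hφ' : ContDiff ℝ ∞ (fun x => φ (x + -y)) := hφ.comp (contDiff_id.add contDiff_const)
    have hc' : HasCompactSupport (fun x => φ (x + -y)) :=
      hc.comp_homeomorph (Homeomorph.addRight (-y))
    have key := u.2 _ hφ' hc' e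
    rw [← integral_add_right_eq_self (μ := (volume : Measure (RN N))) _ y,
      ← integral_add_right_eq_self (μ := (volume : Measure (RN N)))
        (fun x => ⟪(u : L2Pair N).snd x, e⟫ * φ (x + -y)) y] at key
    have h1 := Lp.coeFn_compMeasurePreserving (u : L2Pair N).fst (measurePreserving_shift y)
    have h2 := Lp.coeFn_compMeasurePreserving (u : L2Pair N).snd (measurePreserving_shift y)
    refine Eq.trans (integral_congr_ae ?_) (key.trans (congrArg Neg.neg (integral_congr_ae ?_)))
    · filter_upwards [h1] with x hx
      rw [fderiv_comp_add_right, add_neg_cancel_right]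
      exact congrArg (fun t : ℝ => t * fderiv ℝ φ x e) hx
    · filter_upwards [h2] with x hx
      rw [add_neg_cancel_right]
      exact congrArg (fun t : RN N => ⟪t, e⟫ * φ x) hx.symm⟩

theorem H1.translate_fn {N : ℕ} (y : RN N) (u : H1 N) :
    (u.translate y).fn =ᵐ[volume] fun x => u.fn (x + y) :=
  Lp.coeFn_compMeasurePreserving (u : L2Pair N).fst (measurePreserving_shift y)

theorem H1.translate_grad {N : ℕ} (y : RN N) (u : H1 N) :
    (u.translate y).grad =ᵐ[volume] fun x => u.grad (x + y) :=
  Lp.coeFn_compMeasurePreserving (u : L2Pair N).snd (measurePreserving_shift y)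

/-- Weak convergence of a sequence in `H¹(ℝ^N)`: convergence against every continuous linear
functional. -/
def WeakTendsto {N : ℕ} (u : ℕ → H1 N) (v : H1 N) : Prop :=
  ∀ f : H1 N →L[ℝ] ℝ, Tendsto (fun n => f (u n)) atTop (𝓝 (f v))

/-- The Riesz kernel `I_α(x) = A_α / |x|^(N-α)` on `ℝ^N`, with
`A_α = Γ((N-α)/2) / (Γ(α/2) π^(N/2) 2^α)`. -/
def rieszKernel {N : ℕ} (α : ℝ) (x : RN N) : ℝ :=
  (Real.Gamma (((N : ℝ) - α) / 2) / (Real.Gamma (α / 2) * Real.pi ^ ((N : ℝ) / 2) * 2 ^ α))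
    / ‖x‖ ^ ((N : ℝ) - α)

/-- The Riesz potential `I_α * f`. -/
def rieszPotential {N : ℕ} (α : ℝ) (f : RN N → ℝ) (x : RN N) : ℝ :=
  ∫ y, rieszKernel α (x - y) * f y

/-- The potential `φ_u = I_2 * (K |u|^q)`. -/
def phi {N : ℕ} (q : ℝ) (K : RN N → ℝ) (u : H1 N) : RN N → ℝ :=
  rieszPotential 2 (fun y => K y * |u.fn y| ^ q)

/-- The energy functional `E` of the Choquard equation `-Δu + u = (I_α * |u|^p) |u|^(p-2) u`. -/
def energyE {N : ℕ} (α p : ℝ) (u : H1 N) : ℝ :=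
  1 / 2 * (∫ x, (‖u.grad x‖ ^ 2 + |u.fn x| ^ 2))
    - 1 / (2 * p) * (∫ x, rieszPotential α (fun y => |u.fn y| ^ p) x * |u.fn x| ^ p)

/-- The energy functional `J` of the reduced equation
`-Δu + u + K φ_u |u|^(q-2) u = (I_α * |u|^p) |u|^(p-2) u`. -/
def energyJ {N : ℕ} (α p q : ℝ) (K : RN N → ℝ) (u : H1 N) : ℝ :=
  1 / 2 * (∫ x, (‖u.grad x‖ ^ 2 + |u.fn x| ^ 2))
    + 1 / (2 * q) * (∫ x, K x * phi q K u x * |u.fn x| ^ q)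
    - 1 / (2 * p) * (∫ x, rieszPotential α (fun y => |u.fn y| ^ p) x * |u.fn x| ^ p)

/-- `u ∈ H¹(ℝ^N)` is a weak solution of the Choquard equation
`-Δu + u = (I_α * |u|^p) |u|^(p-2) u`, tested against all of `H¹(ℝ^N)`; the nonlocal term
is required to be integrable against each test function. -/
def IsChoquardSolution {N : ℕ} (α p : ℝ) (u : H1 N) : Prop :=
  ∀ v : H1 N,
    Integrable (fun x =>
      rieszPotential α (fun y => |u.fn y| ^ p) x * (|u.fn x| ^ (p - 2) * u.fn x) * v.fn x) ∧
    ∫ x, (⟪u.grad x, v.grad x⟫ + u.fn x * v.fn x)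
      = ∫ x, rieszPotential α (fun y => |u.fn y| ^ p) x * (|u.fn x| ^ (p - 2) * u.fn x) * v.fn x

/-- `u ∈ H¹(ℝ^N)` is a weak solution of the reduced equation
`-Δu + u + K φ_u |u|^(q-2) u = (I_α * |u|^p) |u|^(p-2) u`, tested against all of `H¹(ℝ^N)`; the
nonlocal terms are required to be integrable against each test function. -/
def IsReducedSolution {N : ℕ} (α p q : ℝ) (K : RN N → ℝ) (u : H1 N) : Prop :=
  ∀ v : H1 N,
    Integrable (fun x => K x * phi q K u x * (|u.fn x| ^ (q - 2) * u.fn x) * v.fn x) ∧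
    Integrable (fun x =>
      rieszPotential α (fun y => |u.fn y| ^ p) x * (|u.fn x| ^ (p - 2) * u.fn x) * v.fn x) ∧
    (∫ x, (⟪u.grad x, v.grad x⟫ + u.fn x * v.fn x))
        + (∫ x, K x * phi q K u x * (|u.fn x| ^ (q - 2) * u.fn x) * v.fn x)
      = ∫ x, rieszPotential α (fun y => |u.fn y| ^ p) x * (|u.fn x| ^ (p - 2) * u.fn x) * v.fn x

/-- The function `G(u) = ⟨F'(u), u⟩` cutting out the Nehari manifold of a functional `F`. -/
def nehariFunctional {N : ℕ} (F : H1 N → ℝ) (u : H1 N) : ℝ := fderiv ℝ F u u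

/-- The Nehari manifold `{u ∈ H¹ \ {0} : ⟨F'(u), u⟩ = 0}` of a functional `F`. -/
def nehari {N : ℕ} (F : H1 N → ℝ) : Set (H1 N) := {u | u ≠ 0 ∧ nehariFunctional F u = 0}

/-- The derivative at `u` of the restriction of `F` to its Nehari manifold: the restriction of
`F'(u)` to the tangent space `ker G'(u)`, where `G(u) = ⟨F'(u), u⟩`. -/
def nehariDeriv {N : ℕ} (F : H1 N → ℝ) (u : H1 N) :
    (fderiv ℝ (nehariFunctional F) u).ker →L[ℝ] ℝ :=
  (fderiv ℝ F u).comp (fderiv ℝ (nehariFunctional F) u).ker.subtypeL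

/-- `(u_n)` is a Palais-Smale sequence of `F` restricted to its Nehari manifold. -/
def IsNehariPalaisSmale {N : ℕ} (F : H1 N → ℝ) (u : ℕ → H1 N) : Prop :=
  (∀ n, u n ∈ nehari F) ∧ (∃ C : ℝ, ∀ n, |F (u n)| ≤ C) ∧
    Tendsto (fun n => ‖nehariDeriv F (u n)‖) atTop (𝓝 0)

end Choquard

end

namespace Choquard

section RadialIntegrals

theorem exists_lintegral_ball_rpow_le {N : ℕ} (hN : 1 ≤ N) {α : ℝ} (hα : 0 < α) :
    ∃ C : ℝ, 0 ≤ C ∧ ∀ ρ : ℝ, 0 < ρ →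
      ∫⁻ z in Metric.ball (0 : RN N) ρ, ENNReal.ofReal (‖z‖ ^ (α - N))
        ≤ ENNReal.ofReal (C * ρ ^ α) := by
  have : Nonempty (Fin N) := ⟨⟨0, hN⟩⟩
  have : Nontrivial (RN N) := by
    apply Module.nontrivial_of_finrank_pos (R := ℝ)
    simp; omega
  set c : ℝ := N * (volume : Measure (RN N)).real (Metric.ball 0 1) with hc
  refine ⟨c / α, by positivity, fun ρ hρ => ?_⟩
  have hpow : ∀ y : ℝ, 0 < y → y ^ (N - 1) * y ^ (α - N) = y ^ (α - 1) := by
    intro y hy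
    rw [← Real.rpow_natCast, ← Real.rpow_add hy]
    congr 1
    push_cast [Nat.cast_sub hN]
    ring
  have hI : IntegrableOn (fun z : RN N => ‖z‖ ^ (α - N)) (Metric.ball 0 ρ) := by
    rw [integrableOn_fun_norm_addHaar volume (f := fun y : ℝ => y ^ (α - N))]
    have h1 : IntegrableOn (fun y : ℝ => y ^ (α - 1)) (Set.Ioo 0 ρ) := by
      rw [intervalIntegral.integrableOn_Ioo_rpow_iff hρ]
      linarith
    refine h1.congr_fun (fun y hy => ?_) measurableSet_Ioo
    simp only [finrank_euclideanSpace, Fintype.card_fin, smul_eq_mul]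
    exact (hpow y hy.1).symm
  have hval : ∫ z in Metric.ball (0 : RN N) ρ, ‖z‖ ^ (α - N) = c / α * ρ ^ α := by
    have h2 : ∫ z in Metric.ball (0 : RN N) ρ, ‖z‖ ^ (α - N)
        = ∫ z : RN N, (Set.Iio ρ).indicator (fun y : ℝ => y ^ (α - N)) ‖z‖ := by
      rw [← integral_indicator measurableSet_ball]
      refine integral_congr_ae (ae_of_all _ fun z => ?_)
      simp [Set.indicator]
    rw [h2, integral_fun_norm_addHaar]
    simp only [finrank_euclideanSpace, Fintype.card_fin, smul_eq_mul, nsmul_eq_mul]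
    have h3 : ∫ y in Set.Ioi (0 : ℝ), y ^ (N - 1) * (Set.Iio ρ).indicator
        (fun y : ℝ => y ^ (α - N)) y = ∫ y in (0 : ℝ)..ρ, y ^ (α - 1) := by
      rw [intervalIntegral.integral_of_le hρ.le, integral_Ioc_eq_integral_Ioo,
        ← integral_indicator measurableSet_Ioi, ← integral_indicator measurableSet_Ioo]
      refine integral_congr_ae (ae_of_all _ fun y => ?_)
      simp only [Set.indicator, Set.mem_Ioi, Set.mem_Iio, Set.mem_Ioo]
      by_cases h0 : 0 < y <;> by_cases h1 : y < ρ <;> simp [h0, h1, hpow]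
    rw [h3, integral_rpow (Or.inl (by linarith)), sub_add_cancel, Real.zero_rpow hα.ne', hc]
    ring
  rw [← hval, ofReal_integral_eq_lintegral_ofReal hI (ae_of_all _ fun z => by positivity)]

theorem exists_lintegral_compl_ball_rpow_le {N : ℕ} (hN : 1 ≤ N) {β : ℝ} (hβ : N < β) :
    ∃ C : ℝ, 0 ≤ C ∧ ∀ ρ : ℝ, 0 < ρ →
      ∫⁻ z in (Metric.ball (0 : RN N) ρ)ᶜ, ENNReal.ofReal (‖z‖ ^ (-β))
        ≤ ENNReal.ofReal (C * ρ ^ (N - β)) := by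
  have : Nonempty (Fin N) := ⟨⟨0, hN⟩⟩
  have : Nontrivial (RN N) := by
    apply Module.nontrivial_of_finrank_pos (R := ℝ)
    simp; omega
  set c : ℝ := N * (volume : Measure (RN N)).real (Metric.ball 0 1) with hc
  have hβN : 0 < β - N := by linarith
  refine ⟨c / (β - N), by positivity, fun ρ hρ => ?_⟩
  have hpow : ∀ y : ℝ, 0 < y → y ^ (N - 1) * y ^ (-β) = y ^ (N - 1 - β) := by
    intro y hy
    rw [← Real.rpow_natCast, ← Real.rpow_add hy]
    congr 1
    push_cast [Nat.cast_sub hN]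
    ring
  have h2 : (Metric.ball (0 : RN N) ρ)ᶜ.indicator (fun z : RN N => ‖z‖ ^ (-β))
      = fun z => (Set.Ici ρ).indicator (fun y : ℝ => y ^ (-β)) ‖z‖ := by
    ext z
    simp [Set.indicator]
  have hmem : ∀ y : ℝ, (Set.Ioi (0 : ℝ)).indicator (fun y => y ^ (N - 1) * (Set.Ici ρ).indicator
        (fun y : ℝ => y ^ (-β)) y) y
      = (Set.Ici ρ).indicator (fun y : ℝ => y ^ (N - 1 - β)) y := by
    intro y
    simp only [Set.indicator, Set.mem_Ioi, Set.mem_Ici]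
    by_cases h1 : ρ ≤ y
    · have h0 : 0 < y := lt_of_lt_of_le hρ h1
      simp [h0, h1, hpow]
    · simp [h1]
  have hI : IntegrableOn (fun z : RN N => ‖z‖ ^ (-β)) (Metric.ball 0 ρ)ᶜ := by
    rw [← integrable_indicator_iff measurableSet_ball.compl, h2,
      integrable_fun_norm_addHaar volume (f := (Set.Ici ρ).indicator (fun y : ℝ => y ^ (-β)))]
    simp only [finrank_euclideanSpace, Fintype.card_fin, smul_eq_mul]
    rw [← integrable_indicator_iff measurableSet_Ioi, funext hmem,
      integrable_indicator_iff measurableSet_Ici, integrableOn_Ici_iff_integrableOn_Ioi,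
      integrableOn_Ioi_rpow_iff hρ]
    linarith
  have hval : ∫ z in (Metric.ball (0 : RN N) ρ)ᶜ, ‖z‖ ^ (-β) = c / (β - N) * ρ ^ (N - β) := by
    rw [← integral_indicator measurableSet_ball.compl, h2, integral_fun_norm_addHaar]
    simp only [finrank_euclideanSpace, Fintype.card_fin, smul_eq_mul, nsmul_eq_mul]
    rw [← integral_indicator measurableSet_Ioi, funext hmem, integral_indicator measurableSet_Ici,
      integral_Ici_eq_integral_Ioi, integral_Ioi_rpow_of_lt (by linarith) hρ, hc,
      show (N : ℝ) - 1 - β + 1 = N - β by ring, show (N : ℝ) - β = -(β - N) by ring]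
    field_simp
  rw [← hval, ofReal_integral_eq_lintegral_ofReal hI (ae_of_all _ fun z => by positivity)]

end RadialIntegrals

/-- The kernel `|z|^(α-N)` with values in `[0, ∞]`. -/
noncomputable def powKernel {N : ℕ} (α : ℝ) (z : RN N) : ENNReal := ENNReal.ofReal (‖z‖ ^ (α - N))

theorem measurable_powKernel {N : ℕ} (α : ℝ) : Measurable (powKernel (N := N) α) := by
  unfold powKernel
  fun_prop

theorem powKernel_neg {N : ℕ} (α : ℝ) (z : RN N) : powKernel α (-z) = powKernel α z := by
  simp [powKernel]

theorem powKernel_sub_comm {N : ℕ} (α : ℝ) (x y : RN N) :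
    powKernel α (x - y) = powKernel α (y - x) := by
  rw [← powKernel_neg, neg_sub]

theorem lintegral_shell_le {N : ℕ} (S : Set (RN N)) (hS : MeasurableSet S) (x : RN N)
    (F : RN N → ENNReal) : ∫⁻ y in {y | x - y ∈ S}, F (x - y) = ∫⁻ z in S, F z := by
  have hS' : MeasurableSet {y | x - y ∈ S} := (measurable_const.sub measurable_id) hS
  rw [← lintegral_indicator hS, ← lintegral_indicator hS',
    ← lintegral_sub_left_eq_self (fun z => S.indicator F z) x]
  rfl

/-- Hölder's inequality for the part of the Riesz potential away from the diagonal. -/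
theorem exists_lintegral_far_le {N : ℕ} (hN : 1 ≤ N) {α : ℝ} (hα0 : 0 < α) (hαN : α < N) :
    ∃ C : ℝ, 0 ≤ C ∧ ∀ ρ : ℝ, 0 < ρ → ∀ f : RN N → ENNReal, Measurable f → ∀ x : RN N,
      ∫⁻ y in {y | x - y ∈ (Metric.ball (0 : RN N) ρ)ᶜ}, f y * powKernel α (x - y)
        ≤ ENNReal.ofReal (C * ρ ^ (-(N - α) / 2)) *
          (∫⁻ y, f y ^ (2 * N / (N + α))) ^ ((N + α) / (2 * N)) := by
  have hNpos : (0 : ℝ) < N := by exact_mod_cast hN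
  obtain ⟨C, hC, h⟩ := exists_lintegral_compl_ball_rpow_le hN (β := 2 * N) (by linarith)
  refine ⟨C ^ ((N - α) / (2 * N)), by positivity, fun ρ hρ f hf x => ?_⟩
  set S : Set (RN N) := {y | x - y ∈ (Metric.ball (0 : RN N) ρ)ᶜ}
  have hS : MeasurableSet S := (measurable_const.sub measurable_id) measurableSet_ball.compl
  have e1 : (N + α) / (2 * N) + (N - α) / (2 * N) = 1 := by field_simp; ring
  have p1 : 0 < (N + α) / (2 * N) := by positivity
  have p2 : 0 < (N - α) / (2 * N) := by
    have : 0 < N - α := by linarith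
    positivity
  have hne : (N : ℝ) + α ≠ 0 := by positivity
  have hne' : (N : ℝ) - α ≠ 0 := by linarith
  have hmp : Measurable fun y => powKernel α (x - y) :=
    (measurable_powKernel α).comp (measurable_const.sub measurable_id)
  have hker : ∫⁻ y in S, powKernel α (x - y) ^ (2 * N / (N - α))
      ≤ ENNReal.ofReal (C * ρ ^ (-N : ℝ)) := by
    refine le_of_eq_of_le ?_ ((h ρ hρ).trans_eq (by congr 3; ring))
    rw [← lintegral_shell_le _ measurableSet_ball.compl x]
    refine lintegral_congr fun y => ?_
    rw [powKernel, ENNReal.ofReal_rpow_of_nonneg (by positivity)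
      (div_nonneg (by positivity) (by linarith)), ← Real.rpow_mul (by positivity)]
    congr 2
    field_simp
    ring
  calc ∫⁻ y in S, f y * powKernel α (x - y)
      = ∫⁻ y in S, (f y ^ (2 * N / (N + α))) ^ ((N + α) / (2 * N)) *
          (powKernel α (x - y) ^ (2 * N / (N - α))) ^ ((N - α) / (2 * N)) := by
        refine lintegral_congr fun y => ?_
        rw [← ENNReal.rpow_mul, ← ENNReal.rpow_mul,
          show 2 * N / (N + α) * ((N + α) / (2 * N)) = 1 by field_simp,
          show 2 * N / (N - α) * ((N - α) / (2 * N)) = 1 by field_simp]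
        simp
    _ ≤ (∫⁻ y in S, f y ^ (2 * N / (N + α))) ^ ((N + α) / (2 * N)) *
          (∫⁻ y in S, powKernel α (x - y) ^ (2 * N / (N - α))) ^ ((N - α) / (2 * N)) :=
        ENNReal.lintegral_mul_norm_pow_le (hf.pow_const _).aemeasurable
          (hmp.pow_const _).aemeasurable p1.le p2.le e1
    _ ≤ (∫⁻ y, f y ^ (2 * N / (N + α))) ^ ((N + α) / (2 * N)) *
          (ENNReal.ofReal (C * ρ ^ (-N : ℝ))) ^ ((N - α) / (2 * N)) := by
        gcongr
        exact Measure.restrict_le_self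
    _ = _ := by
        rw [mul_comm, ENNReal.ofReal_rpow_of_nonneg (by positivity) p2.le,
          Real.mul_rpow hC (by positivity), ← Real.rpow_mul hρ.le]
        congr 4
        field_simp

theorem exists_lintegral_le_level {N : ℕ} (hN : 1 ≤ N) {α : ℝ} (hα0 : 0 < α) (hαN : α < N) :
    ∃ C : ℝ, 0 < C ∧ ∀ f : RN N → ENNReal, Measurable f →
      ∫⁻ y, f y ^ (2 * N / (N + α)) ≤ 1 → ∀ (x : RN N) (m : ENNReal),
      ∫⁻ y in {y | f y ≤ m}, f y * powKernel α (x - y)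
        ≤ ENNReal.ofReal C * m ^ ((N - α) / (N + α)) := by
  have hNpos : (0 : ℝ) < N := by exact_mod_cast hN
  obtain ⟨C₁, hC₁, h₁⟩ := exists_lintegral_ball_rpow_le hN hα0
  obtain ⟨C₂, hC₂, h₂⟩ := exists_lintegral_far_le hN hα0 hαN
  have hexp : 0 < (N - α) / (N + α) := by
    have : 0 < N - α := by linarith
    positivity
  refine ⟨C₁ + C₂ + 1, by positivity, fun f hf hf1 x m => ?_⟩
  rcases eq_or_ne m ⊤ with rfl | hmt
  · rw [ENNReal.top_rpow_of_pos hexp, ENNReal.mul_top]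
    · exact le_top
    · simp only [ne_eq, ENNReal.ofReal_eq_zero, not_le]
      positivity
  rcases eq_or_ne m 0 with rfl | hm0
  · have hms : MeasurableSet {y | f y ≤ 0} := measurableSet_le hf measurable_const
    rw [setLIntegral_congr_fun (g := fun _ => 0) hms]
    · simp
    · intro y hy
      have : f y = 0 := by simpa using hy
      simp [this]
  lift m to NNReal using hmt
  have hmpos : 0 < (m : ℝ) := by
    have : m ≠ 0 := by exact_mod_cast hm0
    positivity
  set ρ : ℝ := (m : ℝ) ^ (-2 / (N + α)) with hρdef
  have hρ : 0 < ρ := by positivity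
  have hmm : (m : ENNReal) = ENNReal.ofReal m := by simp
  set A : Set (RN N) := {y | x - y ∈ Metric.ball (0 : RN N) ρ}
  have hA : MeasurableSet A := (measurable_const.sub measurable_id) measurableSet_ball
  set L : Set (RN N) := {y | f y ≤ m}
  have hL : MeasurableSet L := measurableSet_le hf measurable_const
  have hne : (N : ℝ) + α ≠ 0 := by positivity
  have near : ∫⁻ y in L ∩ A, f y * powKernel α (x - y)
      ≤ ENNReal.ofReal (C₁ * (m : ℝ) ^ ((N - α) / (N + α))) := by
    calc ∫⁻ y in L ∩ A, f y * powKernel α (x - y)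
        ≤ ∫⁻ y in L ∩ A, m * powKernel α (x - y) := by
          refine setLIntegral_mono' (hL.inter hA) fun y hy => ?_
          gcongr
          exact hy.1
      _ ≤ ∫⁻ y in A, m * powKernel α (x - y) := lintegral_mono_set Set.inter_subset_right
      _ = m * ∫⁻ y in A, powKernel α (x - y) := by
          rw [lintegral_const_mul]
          exact (measurable_powKernel α).comp (measurable_const.sub measurable_id)
      _ ≤ m * ENNReal.ofReal (C₁ * ρ ^ α) := by
          gcongr
          refine le_of_eq_of_le ?_ (h₁ ρ hρ)
          exact lintegral_shell_le _ measurableSet_ball x _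
      _ = _ := by
          rw [hmm, ← ENNReal.ofReal_mul hmpos.le, hρdef, ← Real.rpow_mul hmpos.le]
          congr 1
          rw [mul_left_comm]
          congr 1
          nth_rewrite 1 [← Real.rpow_one (m : ℝ)]
          rw [← Real.rpow_add hmpos]
          congr 1
          field_simp
          ring
  have far : ∫⁻ y in L ∩ Aᶜ, f y * powKernel α (x - y)
      ≤ ENNReal.ofReal (C₂ * (m : ℝ) ^ ((N - α) / (N + α))) := by
    calc ∫⁻ y in L ∩ Aᶜ, f y * powKernel α (x - y)
        ≤ ∫⁻ y in Aᶜ, f y * powKernel α (x - y) := lintegral_mono_set Set.inter_subset_right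
      _ ≤ ENNReal.ofReal (C₂ * ρ ^ (-(N - α) / 2)) *
          (∫⁻ y, f y ^ (2 * N / (N + α))) ^ ((N + α) / (2 * N)) := h₂ ρ hρ f hf x
      _ ≤ ENNReal.ofReal (C₂ * ρ ^ (-(N - α) / 2)) * 1 ^ ((N + α) / (2 * N)) := by
          gcongr
      _ = _ := by
          rw [ENNReal.one_rpow, mul_one, hρdef, ← Real.rpow_mul hmpos.le]
          congr 3
          field_simp
  rw [← lintegral_inter_add_sdiff _ L hA, Set.sdiff_eq]
  refine (add_le_add near far).trans ?_
  rw [← ENNReal.ofReal_add (by positivity) (by positivity), hmm,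
    ENNReal.ofReal_rpow_of_pos hmpos, ← ENNReal.ofReal_mul (by positivity)]
  gcongr
  have : 0 ≤ (m : ℝ) ^ ((N - α) / (N + α)) := by positivity
  nlinarith

theorem exists_lintegral_lintegral_le_of_normalized {N : ℕ} (hN : 1 ≤ N) {α : ℝ} (hα0 : 0 < α)
    (hαN : α < N) :
    ∃ C : ℝ, 0 < C ∧ ∀ f g : RN N → ENNReal, Measurable f → Measurable g →
      ∫⁻ y, f y ^ (2 * N / (N + α)) ≤ 1 → ∫⁻ y, g y ^ (2 * N / (N + α)) ≤ 1 →
      ∫⁻ x, ∫⁻ y, g x * (f y * powKernel α (x - y)) ≤ ENNReal.ofReal C := by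
  have hNpos : (0 : ℝ) < N := by exact_mod_cast hN
  obtain ⟨C, hC, h⟩ := exists_lintegral_le_level hN hα0 hαN
  refine ⟨2 * C, by positivity, fun f g hf hg hf1 hg1 => ?_⟩
  have hk : Measurable fun z : RN N × RN N => powKernel α (z.1 - z.2) :=
    (measurable_powKernel α).comp (measurable_fst.sub measurable_snd)
  have hpw : ∀ m : ENNReal, m * (ENNReal.ofReal C * m ^ ((N - α) / (N + α)))
      = ENNReal.ofReal C * m ^ (2 * N / (N + α)) := by
    intro m
    rw [mul_left_comm]
    congr 1
    nth_rewrite 1 [← ENNReal.rpow_one m]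
    rw [← ENNReal.rpow_add_of_nonneg _ _ zero_le_one (div_nonneg (by linarith) (by linarith))]
    congr 1
    have hne : (N : ℝ) + α ≠ 0 := by positivity
    field_simp
    ring
  have key : ∀ f g : RN N → ENNReal, Measurable f → Measurable g →
      ∫⁻ y, f y ^ (2 * N / (N + α)) ≤ 1 → ∫⁻ y, g y ^ (2 * N / (N + α)) ≤ 1 →
      ∫⁻ x, ∫⁻ y, {y | f y ≤ g x}.indicator (fun y => g x * (f y * powKernel α (x - y))) y
        ≤ ENNReal.ofReal C := by
    intro f g hf hg hf1 hg1
    calc ∫⁻ x, ∫⁻ y, {y | f y ≤ g x}.indicator (fun y => g x * (f y * powKernel α (x - y))) y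
        ≤ ∫⁻ x, ENNReal.ofReal C * g x ^ (2 * N / (N + α)) := by
          refine lintegral_mono fun x => ?_
          rw [lintegral_indicator (measurableSet_le hf measurable_const), lintegral_const_mul]
          · rw [← hpw]
            gcongr
            exact h f hf hf1 x (g x)
          · exact hf.mul ((measurable_powKernel α).comp (measurable_const.sub measurable_id))
      _ = ENNReal.ofReal C * ∫⁻ x, g x ^ (2 * N / (N + α)) :=
          lintegral_const_mul _ (hg.pow_const _)
      _ ≤ ENNReal.ofReal C * 1 := by gcongr
      _ = _ := mul_one _
  have hm : ∀ f g : RN N → ENNReal, Measurable f → Measurable g → Measurable fun z : RN N × RN N =>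
      {y | f y ≤ g z.1}.indicator (fun y => g z.1 * (f y * powKernel α (z.1 - y))) z.2 := by
    intro f g hf hg
    have : (fun z : RN N × RN N =>
      {y | f y ≤ g z.1}.indicator (fun y => g z.1 * (f y * powKernel α (z.1 - y))) z.2)
      = {z : RN N × RN N | f z.2 ≤ g z.1}.indicator
        (fun z => g z.1 * (f z.2 * powKernel α (z.1 - z.2))) := rfl
    rw [this]
    refine Measurable.indicator ?_ (measurableSet_le (hf.comp measurable_snd)
      (hg.comp measurable_fst))
    exact (hg.comp measurable_fst).mul ((hf.comp measurable_snd).mul hk)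
  have hswap : ∫⁻ x, ∫⁻ y, {x | g x ≤ f y}.indicator
      (fun x => f y * (g x * powKernel α (y - x))) x ≤ ENNReal.ofReal C := by
    rw [lintegral_lintegral_swap]
    · exact key g f hg hf hg1 hf1
    · exact ((hm g f hg hf).comp measurable_swap).aemeasurable
  calc ∫⁻ x, ∫⁻ y, g x * (f y * powKernel α (x - y))
      ≤ ∫⁻ x, ∫⁻ y, ({y | f y ≤ g x}.indicator (fun y => g x * (f y * powKernel α (x - y))) y
        + {x | g x ≤ f y}.indicator (fun x => f y * (g x * powKernel α (y - x))) x) := by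
        refine lintegral_mono fun x => lintegral_mono fun y => ?_
        rcases le_total (f y) (g x) with hxy | hxy
        · simp [Set.indicator, hxy]
        · rw [mul_left_comm, powKernel_sub_comm]
          simp [Set.indicator, hxy]
    _ = (∫⁻ x, ∫⁻ y, {y | f y ≤ g x}.indicator (fun y => g x * (f y * powKernel α (x - y))) y)
        + ∫⁻ x, ∫⁻ y, {x | g x ≤ f y}.indicator (fun x => f y * (g x * powKernel α (y - x))) x := by
        rw [← lintegral_add_left (hm f g hf hg).lintegral_prod_right']
        refine lintegral_congr fun x => ?_
        rw [lintegral_add_left]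
        exact (hm f g hf hg).comp measurable_prodMk_left
    _ ≤ ENNReal.ofReal C + ENNReal.ofReal C := add_le_add (key f g hf hg hf1 hg1) hswap
    _ = _ := by rw [← ENNReal.ofReal_add hC.le hC.le]; congr 1; ring

/-- The Hardy–Littlewood–Sobolev inequality on the diagonal. -/
theorem exists_hardyLittlewoodSobolev {N : ℕ} (hN : 1 ≤ N) {α : ℝ} (hα0 : 0 < α) (hαN : α < N) :
    ∃ C : ℝ, 0 < C ∧ ∀ f g : RN N → ENNReal, Measurable f → Measurable g →
      ∫⁻ y, f y ^ (2 * N / (N + α)) ≠ ⊤ → ∫⁻ y, g y ^ (2 * N / (N + α)) ≠ ⊤ →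
      ∫⁻ x, ∫⁻ y, g x * (f y * powKernel α (x - y)) ≤ ENNReal.ofReal C *
        ((∫⁻ y, f y ^ (2 * N / (N + α))) ^ ((N + α) / (2 * N)) *
          (∫⁻ y, g y ^ (2 * N / (N + α))) ^ ((N + α) / (2 * N))) := by
  have hNpos : (0 : ℝ) < N := by exact_mod_cast hN
  obtain ⟨C, hC, h⟩ := exists_lintegral_lintegral_le_of_normalized hN hα0 hαN
  refine ⟨C, hC, fun f g hf hg hfT hgT => ?_⟩
  have hs : 0 < 2 * N / (N + α) := by positivity
  have hs' : 0 < (N + α) / (2 * N) := by positivity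
  have hmul : 2 * N / (N + α) * ((N + α) / (2 * N)) = 1 := by
    have hne : (N : ℝ) + α ≠ 0 := by positivity
    field_simp
  set a := (∫⁻ y, f y ^ (2 * N / (N + α))) ^ ((N + α) / (2 * N))
  set b := (∫⁻ y, g y ^ (2 * N / (N + α))) ^ ((N + α) / (2 * N))
  have ha : a ^ (2 * N / (N + α)) = ∫⁻ y, f y ^ (2 * N / (N + α)) := by
    rw [← ENNReal.rpow_mul, mul_comm ((N + α) / (2 * N)), hmul, ENNReal.rpow_one]
  have hb : b ^ (2 * N / (N + α)) = ∫⁻ y, g y ^ (2 * N / (N + α)) := by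
    rw [← ENNReal.rpow_mul, mul_comm ((N + α) / (2 * N)), hmul, ENNReal.rpow_one]
  have haT : a ≠ ⊤ := ENNReal.rpow_ne_top_of_nonneg hs'.le hfT
  have hbT : b ≠ ⊤ := ENNReal.rpow_ne_top_of_nonneg hs'.le hgT
  have hzero : ∀ f : RN N → ENNReal, Measurable f → ∫⁻ y, f y ^ (2 * N / (N + α)) = 0 →
      ∀ᵐ y, f y = 0 := by
    intro f hf h0
    rw [lintegral_eq_zero_iff (hf.pow_const _)] at h0
    filter_upwards [h0] with y hy
    simpa [hs, hs.not_gt] using hy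
  rcases eq_or_ne a 0 with ha0 | ha0
  · have h0 := hzero f hf (by rw [← ha, ha0, ENNReal.zero_rpow_of_pos hs])
    have : ∫⁻ x, ∫⁻ y, g x * (f y * powKernel α (x - y)) = 0 := by
      refine (lintegral_congr fun x => ?_).trans lintegral_zero
      refine (lintegral_congr_ae ?_).trans lintegral_zero
      filter_upwards [h0] with y hy
      simp [hy]
    rw [this]; exact zero_le
  rcases eq_or_ne b 0 with hb0 | hb0
  · have h0 := hzero g hg (by rw [← hb, hb0, ENNReal.zero_rpow_of_pos hs])
    have : ∫⁻ x, ∫⁻ y, g x * (f y * powKernel α (x - y)) = 0 := by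
      refine (lintegral_congr_ae ?_).trans lintegral_zero
      filter_upwards [h0] with x hx
      simp [hx]
    rw [this]; exact zero_le
  have hnorm : ∀ (f : RN N → ENNReal) (a : ENNReal), Measurable f → a ≠ 0 → a ≠ ⊤ →
      a ^ (2 * N / (N + α)) = ∫⁻ y, f y ^ (2 * N / (N + α)) →
      ∫⁻ y, (a⁻¹ * f y) ^ (2 * N / (N + α)) ≤ 1 := by
    intro f a hf ha0 haT ha
    have : ∀ y, (a⁻¹ * f y) ^ (2 * N / (N + α))
        = (a⁻¹) ^ (2 * N / (N + α)) * f y ^ (2 * N / (N + α)) :=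
      fun y => ENNReal.mul_rpow_of_nonneg _ _ hs.le
    rw [lintegral_congr this, lintegral_const_mul _ (hf.pow_const _), ← ha,
      ← ENNReal.mul_rpow_of_nonneg _ _ hs.le, ENNReal.inv_mul_cancel ha0 haT, ENNReal.one_rpow]
  have main := h (fun y => a⁻¹ * f y) (fun y => b⁻¹ * g y) (hf.const_mul _) (hg.const_mul _)
    (hnorm f a hf ha0 haT ha) (hnorm g b hg hb0 hbT hb)
  have hk : Measurable fun z : RN N × RN N => powKernel α (z.1 - z.2) :=
    (measurable_powKernel α).comp (measurable_fst.sub measurable_snd)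
  have hmeas : Measurable fun z : RN N × RN N => g z.1 * (f z.2 * powKernel α (z.1 - z.2)) :=
    (hg.comp measurable_fst).mul ((hf.comp measurable_snd).mul hk)
  have hpull : ∫⁻ x, ∫⁻ y, b⁻¹ * g x * (a⁻¹ * f y * powKernel α (x - y))
      = (a⁻¹ * b⁻¹) * ∫⁻ x, ∫⁻ y, g x * (f y * powKernel α (x - y)) := by
    rw [← lintegral_const_mul _ hmeas.lintegral_prod_right']
    refine lintegral_congr fun x => ?_
    rw [← lintegral_const_mul (a⁻¹ * b⁻¹) (f := fun y => g x * (f y * powKernel α (x - y)))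
      (hmeas.comp measurable_prodMk_left)]
    refine lintegral_congr fun y => ?_
    ring
  rw [hpull] at main
  calc ∫⁻ x, ∫⁻ y, g x * (f y * powKernel α (x - y))
      = (a * a⁻¹) * (b * b⁻¹) * ∫⁻ x, ∫⁻ y, g x * (f y * powKernel α (x - y)) := by
        rw [ENNReal.mul_inv_cancel ha0 haT, ENNReal.mul_inv_cancel hb0 hbT, one_mul, one_mul]
    _ = (a * b) * ((a⁻¹ * b⁻¹) * ∫⁻ x, ∫⁻ y, g x * (f y * powKernel α (x - y))) := by ring
    _ ≤ (a * b) * ENNReal.ofReal C := by gcongr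
    _ = _ := mul_comm _ _

section Cut

variable {N : ℕ} {p : ENNReal}

theorem memLp_indicator_ball (R : ℝ) (f : Lp ℝ p (volume : Measure (RN N))) :
    MemLp ((Metric.ball (0 : RN N) R).indicator f) p volume :=
  (Lp.memLp f).indicator measurableSet_ball

/-- Multiplication by the indicator of the ball of radius `R`, as a linear map on `L^p`. -/
noncomputable def ballCutₗ (N : ℕ) (p : ENNReal) (R : ℝ) :
    Lp ℝ p (volume : Measure (RN N)) →ₗ[ℝ] Lp ℝ p (volume : Measure (RN N)) where
  toFun f := (memLp_indicator_ball R f).toLp _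
  map_add' f g := by
    rw [← MemLp.toLp_add]
    refine MemLp.toLp_congr _ _ ?_
    filter_upwards [Lp.coeFn_add f g] with x hx
    by_cases h : x ∈ Metric.ball (0 : RN N) R
    · simpa [Set.indicator_of_mem h] using hx
    · simp [Set.indicator_of_notMem h]
  map_smul' c f := by
    rw [RingHom.id_apply, ← MemLp.toLp_const_smul]
    refine MemLp.toLp_congr _ _ ?_
    filter_upwards [Lp.coeFn_smul c f] with x hx
    by_cases h : x ∈ Metric.ball (0 : RN N) R
    · simpa [Set.indicator_of_mem h] using hx
    · simp [Set.indicator_of_notMem h]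

theorem coeFn_ballCutₗ (R : ℝ) (f : Lp ℝ p (volume : Measure (RN N))) :
    ballCutₗ N p R f =ᵐ[volume] (Metric.ball (0 : RN N) R).indicator f := by
  have h : ballCutₗ N p R f = (memLp_indicator_ball R f).toLp _ := rfl
  rw [h]
  exact MemLp.coeFn_toLp _

variable [hp : Fact (1 ≤ p)]

/-- Multiplication by the indicator of the ball of radius `R`, as a continuous linear map. -/
noncomputable def ballCut (R : ℝ) :
    Lp ℝ p (volume : Measure (RN N)) →L[ℝ] Lp ℝ p (volume : Measure (RN N)) :=
  (ballCutₗ N p R).mkContinuous 1 fun f => by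
    rw [one_mul]
    refine Lp.norm_le_norm_of_ae_le ?_
    filter_upwards [coeFn_ballCutₗ R f] with x hx
    rw [hx]
    exact norm_indicator_le_norm_self _ _

theorem coeFn_ballCut (R : ℝ) (f : Lp ℝ p (volume : Measure (RN N))) :
    ballCut R f =ᵐ[volume] (Metric.ball (0 : RN N) R).indicator f := by
  have h : ballCut R f = (memLp_indicator_ball R f).toLp _ := rfl
  rw [h]
  exact MemLp.coeFn_toLp _

theorem coeFn_sub_ballCut (R : ℝ) (f : Lp ℝ p (volume : Measure (RN N))) :
    (f - ballCut R f : Lp ℝ p (volume : Measure (RN N))) =ᵐ[volume]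
      (Metric.ball (0 : RN N) R)ᶜ.indicator f := by
  filter_upwards [coeFn_ballCut R f, Lp.coeFn_sub f (ballCut R f)] with x h1 h2
  rw [h2, Pi.sub_apply, h1]
  by_cases h : x ∈ Metric.ball (0 : RN N) R
  · rw [Set.indicator_of_mem h, Set.indicator_of_notMem (by simpa using h), sub_self]
  · have h' : x ∈ (Metric.ball (0 : RN N) R)ᶜ := h
    simp [Set.indicator_of_mem h', Set.indicator_of_notMem h]

theorem norm_ballCut_le (R : ℝ) (f : Lp ℝ p (volume : Measure (RN N))) :
    ‖ballCut R f‖ ≤ ‖f‖ := by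
  refine Lp.norm_le_norm_of_ae_le ?_
  filter_upwards [coeFn_ballCut R f] with x hx
  rw [hx]
  exact norm_indicator_le_norm_self _ _

theorem norm_sub_ballCut_le (R : ℝ) (f : Lp ℝ p (volume : Measure (RN N))) :
    ‖f - ballCut R f‖ ≤ ‖f‖ := by
  refine Lp.norm_le_norm_of_ae_le ?_
  filter_upwards [coeFn_sub_ballCut R f] with x hx
  rw [hx]
  exact norm_indicator_le_norm_self _ _

theorem tendsto_ballCut (hpT : p ≠ ⊤) (f : Lp ℝ p (volume : Measure (RN N))) :
    Tendsto (fun R : ℝ => ballCut R f) atTop (𝓝 f) := by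
  have hp0 : p ≠ 0 := (zero_lt_one.trans_le hp.out).ne'
  rw [tendsto_iff_norm_sub_tendsto_zero]
  have h1 : ∀ R : ℝ, ‖ballCut R f - f‖
      = (∫⁻ x, ‖(Metric.ball (0 : RN N) R)ᶜ.indicator f x‖ₑ ^ p.toReal).toReal ^ (1 / p.toReal) := by
    intro R
    rw [norm_sub_rev, Lp.norm_def, eLpNorm_congr_ae (coeFn_sub_ballCut R f),
      eLpNorm_eq_lintegral_rpow_enorm_toReal hp0 hpT, ENNReal.toReal_rpow]
  have hpr : 0 < p.toReal := ENNReal.toReal_pos hp0 hpT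
  have h2 : Tendsto (fun R : ℝ =>
      ∫⁻ x, ‖(Metric.ball (0 : RN N) R)ᶜ.indicator f x‖ₑ ^ p.toReal) atTop
      (𝓝 (∫⁻ _ : RN N, 0)) := by
    refine tendsto_lintegral_filter_of_dominated_convergence (fun x => ‖f x‖ₑ ^ p.toReal) ?_ ?_ ?_ ?_
    · refine Eventually.of_forall fun R => ?_
      exact (((Lp.stronglyMeasurable f).indicator measurableSet_ball.compl).measurable.enorm).pow_const _
    · refine Eventually.of_forall fun R => ae_of_all _ fun x => ?_
      gcongr
      exact enorm_indicator_le_enorm_self _ _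
    · exact (lintegral_rpow_enorm_lt_top_of_eLpNorm_lt_top hp0 hpT (Lp.memLp f).2).ne
    · refine ae_of_all _ fun x => ?_
      refine tendsto_const_nhds.congr' ?_
      filter_upwards [eventually_gt_atTop ‖x‖] with R hR
      have hx : x ∉ (Metric.ball (0 : RN N) R)ᶜ := by simpa using hR
      rw [Set.indicator_of_notMem hx, enorm_zero, ENNReal.zero_rpow_of_pos hpr]
  rw [lintegral_zero] at h2
  have h3 := ((ENNReal.tendsto_toReal ENNReal.zero_ne_top).comp h2).rpow_const
    (p := 1 / p.toReal) (Or.inr (by positivity))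
  rw [ENNReal.toReal_zero, Real.zero_rpow (by positivity)] at h3
  exact h3.congr fun R => (h1 R).symm

end Cut

section RieszForm

/-- The exponent `2N/(N+α)` of the Hardy–Littlewood–Sobolev inequality. -/
noncomputable def hlsExp (N : ℕ) (α : ℝ) : ENNReal := ENNReal.ofReal (2 * N / (N + α))

variable {N : ℕ} {α : ℝ} [hα : Fact (0 < α ∧ α < (N : ℝ))]

include hα in
theorem one_le_dim : 1 ≤ N := by
  have h : (0 : ℝ) < N := hα.out.1.trans hα.out.2
  exact_mod_cast h

theorem one_lt_two_mul_div : 1 < 2 * (N : ℝ) / (N + α) := by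
  have := hα.out
  rw [one_lt_div (by linarith)]
  linarith

instance : Fact (1 ≤ hlsExp N α) := ⟨by
  rw [hlsExp, ENNReal.one_le_ofReal]
  exact one_lt_two_mul_div.le⟩

theorem hlsExp_toReal : (hlsExp N α).toReal = 2 * N / (N + α) :=
  ENNReal.toReal_ofReal (zero_lt_one.trans (one_lt_two_mul_div (N := N) (α := α))).le

omit hα in
theorem hlsExp_ne_top : hlsExp N α ≠ ⊤ := ENNReal.ofReal_ne_top

theorem hlsExp_ne_zero : hlsExp N α ≠ 0 :=
  (zero_lt_one.trans_le (Fact.out : 1 ≤ hlsExp N α)).ne'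

theorem eLpNorm_hlsExp (f : RN N → ℝ) : eLpNorm f (hlsExp N α) volume
    = (∫⁻ y, ‖f y‖ₑ ^ (2 * N / (N + α))) ^ ((N + α) / (2 * N)) := by
  rw [eLpNorm_eq_lintegral_rpow_enorm_toReal hlsExp_ne_zero hlsExp_ne_top, hlsExp_toReal,
    one_div_div]

theorem lintegral_hlsExp_ne_top (f : Lp ℝ (hlsExp N α) (volume : Measure (RN N))) :
    ∫⁻ y, ‖f y‖ₑ ^ (2 * N / (N + α)) ≠ ⊤ := by
  have := lintegral_rpow_enorm_lt_top_of_eLpNorm_lt_top hlsExp_ne_zero hlsExp_ne_top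
    (Lp.memLp f).2
  rw [hlsExp_toReal] at this
  exact this.ne

/-- The constant `A_α` of the Riesz kernel. -/
noncomputable def rieszConst (N : ℕ) (α : ℝ) : ℝ :=
  Real.Gamma (((N : ℝ) - α) / 2) / (Real.Gamma (α / 2) * Real.pi ^ ((N : ℝ) / 2) * 2 ^ α)

theorem rieszConst_pos : 0 < rieszConst N α := by
  have := hα.out
  have h1 : 0 < Real.Gamma (((N : ℝ) - α) / 2) := Real.Gamma_pos_of_pos (by linarith)
  have h2 : 0 < Real.Gamma (α / 2) := Real.Gamma_pos_of_pos (by linarith)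
  unfold rieszConst
  positivity

omit hα in
theorem rieszKernel_eq (x : RN N) : rieszKernel α x = rieszConst N α * ‖x‖ ^ (α - N) := by
  rw [rieszKernel, rieszConst, div_eq_mul_inv _ (‖x‖ ^ _), ← Real.rpow_neg (norm_nonneg _), neg_sub]

theorem rieszKernel_nonneg (x : RN N) : 0 ≤ rieszKernel α x := by
  have := rieszConst_pos (N := N) (α := α)
  rw [rieszKernel_eq]
  positivity

theorem enorm_rieszKernel (x : RN N) :
    ‖rieszKernel α x‖ₑ = ENNReal.ofReal (rieszConst N α) * powKernel α x := by
  rw [Real.enorm_eq_ofReal (rieszKernel_nonneg x), rieszKernel_eq,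
    ENNReal.ofReal_mul rieszConst_pos.le, powKernel]

omit hα in
theorem rieszKernel_sub_comm (x y : RN N) : rieszKernel α (x - y) = rieszKernel α (y - x) := by
  rw [rieszKernel_eq, rieszKernel_eq, norm_sub_rev]

omit hα in
theorem measurable_rieszKernel : Measurable (rieszKernel (N := N) α) := by
  unfold rieszKernel
  fun_prop

omit hα in
theorem rieszPotential_congr {f g : RN N → ℝ} (h : f =ᵐ[volume] g) (x : RN N) :
    rieszPotential α f x = rieszPotential α g x := by
  refine integral_congr_ae ?_
  filter_upwards [h] with y hy
  rw [hy]

/-- The integrand of the bilinear form of the Riesz potential. -/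
noncomputable def rieszIntegrand (α : ℝ) (f g : RN N → ℝ) (z : RN N × RN N) : ℝ :=
  rieszKernel α (z.1 - z.2) * f z.2 * g z.1

omit hα in
theorem measurable_rieszIntegrand {f g : RN N → ℝ} (hf : Measurable f) (hg : Measurable g) :
    Measurable (rieszIntegrand α f g) :=
  ((measurable_rieszKernel.comp (measurable_fst.sub measurable_snd)).mul
    (hf.comp measurable_snd)).mul (hg.comp measurable_fst)

theorem lintegral_enorm_rieszIntegrand {f g : RN N → ℝ} (hf : Measurable f) (hg : Measurable g) :
    ∫⁻ z, ‖rieszIntegrand α f g z‖ₑ ∂(volume.prod volume)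
      = ENNReal.ofReal (rieszConst N α) *
        ∫⁻ x, ∫⁻ y, ‖g x‖ₑ * (‖f y‖ₑ * powKernel α (x - y)) := by
  have hk : Measurable fun z : RN N × RN N => powKernel α (z.1 - z.2) :=
    (measurable_powKernel α).comp (measurable_fst.sub measurable_snd)
  have hm : Measurable fun z : RN N × RN N => ‖g z.1‖ₑ * (‖f z.2‖ₑ * powKernel α (z.1 - z.2)) :=
    (hg.comp measurable_fst).enorm.mul ((hf.comp measurable_snd).enorm.mul hk)
  rw [lintegral_prod _ (measurable_rieszIntegrand hf hg).enorm.aemeasurable,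
    ← lintegral_const_mul _ hm.lintegral_prod_right']
  refine lintegral_congr fun x => ?_
  rw [← lintegral_const_mul _
    (f := fun y => ‖g x‖ₑ * (‖f y‖ₑ * powKernel α (x - y))) (hm.comp measurable_prodMk_left)]
  refine lintegral_congr fun y => ?_
  simp only [rieszIntegrand, enorm_mul, enorm_rieszKernel]
  ring

theorem exists_rieszIntegrand_bound : ∃ C : ℝ, 0 < C ∧
    ∀ f g : Lp ℝ (hlsExp N α) (volume : Measure (RN N)),
      ∫⁻ z, ‖rieszIntegrand α f g z‖ₑ ∂(volume.prod volume) ≤ ENNReal.ofReal (C * ‖f‖ * ‖g‖) := by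
  obtain ⟨C, hC, h⟩ := exists_hardyLittlewoodSobolev (one_le_dim (α := α)) hα.out.1 hα.out.2
  have hA := rieszConst_pos (N := N) (α := α)
  refine ⟨rieszConst N α * C, by positivity, fun f g => ?_⟩
  have hf := (Lp.stronglyMeasurable f).measurable
  have hg := (Lp.stronglyMeasurable g).measurable
  rw [lintegral_enorm_rieszIntegrand hf hg, mul_assoc, mul_assoc,
    ENNReal.ofReal_mul hA.le, ENNReal.ofReal_mul hC.le, ENNReal.ofReal_mul (norm_nonneg _),
    ofReal_norm, ofReal_norm, Lp.enorm_def, Lp.enorm_def, eLpNorm_hlsExp, eLpNorm_hlsExp]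
  gcongr
  exact h _ _ hf.enorm hg.enorm (lintegral_hlsExp_ne_top f) (lintegral_hlsExp_ne_top g)

theorem integrable_rieszIntegrand (f g : Lp ℝ (hlsExp N α) (volume : Measure (RN N))) :
    Integrable (rieszIntegrand α f g) (volume.prod volume) := by
  obtain ⟨C, hC, h⟩ := exists_rieszIntegrand_bound (N := N) (α := α)
  refine ⟨(measurable_rieszIntegrand (Lp.stronglyMeasurable f).measurable
    (Lp.stronglyMeasurable g).measurable).aestronglyMeasurable, ?_⟩
  exact (h f g).trans_lt ENNReal.ofReal_lt_top

omit hα in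
theorem rieszIntegrand_congr {f f' g g' : RN N → ℝ} (hf : f =ᵐ[volume] f') (hg : g =ᵐ[volume] g') :
    rieszIntegrand α f g =ᵐ[volume.prod volume] rieszIntegrand α f' g' := by
  have h1 := (Measure.quasiMeasurePreserving_snd
    (μ := (volume : Measure (RN N))) (ν := (volume : Measure (RN N)))).ae hf
  have h2 := (Measure.quasiMeasurePreserving_fst
    (μ := (volume : Measure (RN N))) (ν := (volume : Measure (RN N)))).ae hg
  filter_upwards [h1, h2] with z hz1 hz2
  simp only [rieszIntegrand, hz1, hz2]

/-- The bilinear form `(f, g) ↦ ∫ (I_α * f) g` as a continuous bilinear form on `L^{2N/(N+α)}`. -/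
noncomputable def rieszForm (N : ℕ) (α : ℝ) [hα : Fact (0 < α ∧ α < (N : ℝ))] :
    Lp ℝ (hlsExp N α) (volume : Measure (RN N)) →L[ℝ]
      Lp ℝ (hlsExp N α) (volume : Measure (RN N)) →L[ℝ] ℝ :=
  LinearMap.mkContinuous₂
    (LinearMap.mk₂ ℝ (fun f g => ∫ z, rieszIntegrand α f g z ∂(volume.prod volume))
      (fun f f' g => by
        rw [← integral_add (integrable_rieszIntegrand f g) (integrable_rieszIntegrand f' g)]
        refine integral_congr_ae ((rieszIntegrand_congr (Lp.coeFn_add f f') .rfl).trans ?_)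
        refine ae_of_all _ fun z => ?_
        simp only [rieszIntegrand, Pi.add_apply]
        ring)
      (fun c f g => by
        rw [smul_eq_mul, ← integral_const_mul]
        refine integral_congr_ae ((rieszIntegrand_congr (Lp.coeFn_smul c f) .rfl).trans ?_)
        refine ae_of_all _ fun z => ?_
        simp only [rieszIntegrand, Pi.smul_apply, smul_eq_mul]
        ring)
      (fun f g g' => by
        rw [← integral_add (integrable_rieszIntegrand f g) (integrable_rieszIntegrand f g')]
        refine integral_congr_ae ((rieszIntegrand_congr .rfl (Lp.coeFn_add g g')).trans ?_)
        refine ae_of_all _ fun z => ?_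
        simp only [rieszIntegrand, Pi.add_apply]
        ring)
      (fun c f g => by
        rw [smul_eq_mul, ← integral_const_mul]
        refine integral_congr_ae ((rieszIntegrand_congr .rfl (Lp.coeFn_smul c g)).trans ?_)
        refine ae_of_all _ fun z => ?_
        simp only [rieszIntegrand, Pi.smul_apply, smul_eq_mul]
        ring))
    (exists_rieszIntegrand_bound (N := N) (α := α)).choose
    (fun f g => by
      obtain ⟨hC, h⟩ := (exists_rieszIntegrand_bound (N := N) (α := α)).choose_spec
      refine (norm_integral_le_lintegral_norm _).trans ?_
      refine ENNReal.toReal_le_of_le_ofReal (by positivity) ?_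
      simpa only [ofReal_norm] using h f g)

theorem rieszForm_apply (f g : Lp ℝ (hlsExp N α) (volume : Measure (RN N))) :
    rieszForm N α f g = ∫ z, rieszIntegrand α f g z ∂(volume.prod volume) := rfl

omit hα in
theorem integral_rieszIntegrand_right (f g : RN N → ℝ) (x : RN N) :
    ∫ y, rieszIntegrand α f g (x, y) = rieszPotential α f x * g x := by
  simp only [rieszIntegrand, rieszPotential]
  rw [integral_mul_const]

theorem rieszForm_eq_integral (f g : Lp ℝ (hlsExp N α) (volume : Measure (RN N))) :
    rieszForm N α f g = ∫ x, rieszPotential α f x * g x := by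
  rw [rieszForm_apply, integral_prod _ (integrable_rieszIntegrand f g)]
  simp only [integral_rieszIntegrand_right]

theorem integrable_rieszPotential_mul (f g : Lp ℝ (hlsExp N α) (volume : Measure (RN N))) :
    Integrable (fun x => rieszPotential α f x * g x) := by
  have h := (integrable_rieszIntegrand f g).integral_prod_left
  simpa only [integral_rieszIntegrand_right] using h

theorem rieszForm_comm (f g : Lp ℝ (hlsExp N α) (volume : Measure (RN N))) :
    rieszForm N α f g = rieszForm N α g f := by
  rw [rieszForm_apply, rieszForm_apply, ← integral_prod_swap]
  refine integral_congr_ae (ae_of_all _ fun z => ?_)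
  simp only [rieszIntegrand, Prod.fst_swap, Prod.snd_swap]
  rw [rieszKernel_sub_comm]
  ring

theorem abs_rieszForm_le_lintegral {f g : Lp ℝ (hlsExp N α) (volume : Measure (RN N))}
    {C : ℝ} (hC : 0 ≤ C) (h : ENNReal.ofReal (rieszConst N α) *
        ∫⁻ x, ∫⁻ y, ‖g x‖ₑ * (‖f y‖ₑ * powKernel α (x - y)) ≤ ENNReal.ofReal C) :
    |rieszForm N α f g| ≤ C := by
  rw [rieszForm_apply, ← Real.norm_eq_abs]
  refine (norm_integral_le_lintegral_norm _).trans (ENNReal.toReal_le_of_le_ofReal hC ?_)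
  rw [← lintegral_enorm_rieszIntegrand (Lp.stronglyMeasurable f).measurable
    (Lp.stronglyMeasurable g).measurable] at h
  simpa only [ofReal_norm] using h

theorem exists_lintegral_ballCut_le (ρ : ℝ) : ∃ C : ℝ, 0 ≤ C ∧
    ∀ f : Lp ℝ (hlsExp N α) (volume : Measure (RN N)),
      ∫⁻ x, ‖ballCut ρ f x‖ₑ ≤ ENNReal.ofReal (C * ‖f‖) := by
  have hα' := hα.out
  set V : ENNReal := volume (Metric.ball (0 : RN N) ρ) with hV
  have hVT : V ≠ ⊤ := measure_ball_lt_top.ne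
  set e : ℝ := 1 / (1 : ENNReal).toReal - 1 / (hlsExp N α).toReal
  have he : 0 ≤ e := by
    have h1 := one_lt_two_mul_div (N := N) (α := α)
    have : 1 / (2 * (N : ℝ) / (N + α)) ≤ 1 := by
      rw [div_le_one (by linarith)]; exact h1.le
    simp only [e, hlsExp_toReal, ENNReal.toReal_one]
    linarith
  refine ⟨(V ^ e).toReal, by positivity, fun f => ?_⟩
  calc ∫⁻ x, ‖ballCut ρ f x‖ₑ = ∫⁻ x in Metric.ball (0 : RN N) ρ, ‖f x‖ₑ := by
        rw [← lintegral_indicator measurableSet_ball]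
        refine lintegral_congr_ae ?_
        filter_upwards [coeFn_ballCut ρ f] with x hx
        rw [hx, enorm_indicator_eq_indicator_enorm]
    _ = eLpNorm f 1 (volume.restrict (Metric.ball (0 : RN N) ρ)) := by
        rw [eLpNorm_one_eq_lintegral_enorm]
    _ ≤ eLpNorm f (hlsExp N α) (volume.restrict (Metric.ball (0 : RN N) ρ)) *
          volume.restrict (Metric.ball (0 : RN N) ρ) Set.univ ^ e :=
        eLpNorm_le_eLpNorm_mul_rpow_measure_univ Fact.out
          (Lp.stronglyMeasurable f).aestronglyMeasurable
    _ ≤ eLpNorm f (hlsExp N α) volume * V ^ e := by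
        rw [Measure.restrict_apply_univ]
        gcongr
        exact Measure.restrict_le_self
    _ = _ := by
        rw [ENNReal.ofReal_mul (by positivity), ofReal_norm, Lp.enorm_def, mul_comm,
          ENNReal.ofReal_toReal (ENNReal.rpow_ne_top_of_nonneg he hVT)]

/-- The interaction between a ball and the complement of a much larger ball is small. -/
theorem exists_rieszForm_far_le (ρ : ℝ) {ε : ℝ} (hε : 0 < ε) : ∃ R : ℝ, ρ < R ∧
    ∀ f g : Lp ℝ (hlsExp N α) (volume : Measure (RN N)),
      |rieszForm N α (ballCut ρ f) (g - ballCut R g)| ≤ ε * (‖f‖ * ‖g‖) := by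
  obtain ⟨C, hC, hfar⟩ := exists_lintegral_far_le (one_le_dim (α := α)) hα.out.1 hα.out.2
  obtain ⟨D, hD, hL1⟩ := exists_lintegral_ballCut_le (N := N) (α := α) ρ
  have hA := rieszConst_pos (N := N) (α := α)
  have hα' := hα.out
  have hlim : Tendsto (fun d : ℝ => rieszConst N α * (D * (C * d ^ (-((N - α) / 2))))) atTop
      (𝓝 (rieszConst N α * (D * (C * 0)))) :=
    (((tendsto_rpow_neg_atTop (by linarith)).const_mul C).const_mul D).const_mul _
  rw [mul_zero, mul_zero, mul_zero] at hlim
  obtain ⟨d, hd, hd0⟩ := ((hlim.eventually (gt_mem_nhds hε)).and (eventually_gt_atTop 0)).exists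
  refine ⟨ρ + d, by linarith, fun f g => ?_⟩
  rw [rieszForm_comm]
  refine abs_rieszForm_le_lintegral (by positivity) ?_
  set f' := ballCut ρ f
  set g' := g - ballCut (ρ + d) g
  have hf'm : Measurable f' := (Lp.stronglyMeasurable f').measurable
  have hg'm : Measurable g' := (Lp.stronglyMeasurable g').measurable
  have hinner : ∀ᵐ x, ∫⁻ y, ‖f' x‖ₑ * (‖g' y‖ₑ * powKernel α (x - y))
      ≤ ‖f' x‖ₑ * ENNReal.ofReal (C * d ^ (-((N - α) / 2)) * ‖g‖) := by
    filter_upwards [coeFn_ballCut ρ f] with x hx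
    have hmeas : Measurable fun y => ‖g' y‖ₑ * powKernel α (x - y) :=
      hg'm.enorm.mul ((measurable_powKernel α).comp (measurable_const.sub measurable_id))
    rw [lintegral_const_mul _ hmeas]
    by_cases hxρ : x ∈ Metric.ball (0 : RN N) ρ
    · gcongr
      have hset : MeasurableSet {y | x - y ∈ (Metric.ball (0 : RN N) d)ᶜ} :=
        (measurable_const.sub measurable_id) measurableSet_ball.compl
      calc ∫⁻ y, ‖g' y‖ₑ * powKernel α (x - y)
          = ∫⁻ y in {y | x - y ∈ (Metric.ball (0 : RN N) d)ᶜ}, ‖g' y‖ₑ * powKernel α (x - y) := by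
            rw [← lintegral_indicator hset]
            refine lintegral_congr_ae ?_
            filter_upwards [coeFn_sub_ballCut (ρ + d) g] with y hy
            by_cases hyd : x - y ∈ (Metric.ball (0 : RN N) d)ᶜ
            · rw [Set.indicator_of_mem (by exact hyd)]
            · rw [Set.indicator_of_notMem (by exact hyd), hy]
              have : y ∈ Metric.ball (0 : RN N) (ρ + d) := by
                simp only [Set.mem_compl_iff, mem_ball_zero_iff, not_not] at hyd hxρ ⊢
                calc ‖y‖ = ‖x - (x - y)‖ := by rw [sub_sub_cancel]
                  _ ≤ ‖x‖ + ‖x - y‖ := norm_sub_le _ _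
                  _ < ρ + d := add_lt_add hxρ hyd
              rw [Set.indicator_of_notMem (by simpa using this)]
              simp
        _ ≤ ENNReal.ofReal (C * d ^ (-(N - α) / 2)) *
          (∫⁻ y, ‖g' y‖ₑ ^ (2 * N / (N + α))) ^ ((N + α) / (2 * N)) :=
            hfar d hd0 _ hg'm.enorm x
        _ ≤ ENNReal.ofReal (C * d ^ (-(N - α) / 2)) * ENNReal.ofReal ‖g‖ := by
            gcongr
            rw [← eLpNorm_hlsExp, ← Lp.enorm_def, ← ofReal_norm]
            exact ENNReal.ofReal_le_ofReal (norm_sub_ballCut_le _ _)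
        _ = _ := by
            rw [← ENNReal.ofReal_mul (by positivity), neg_div]
    · have : f' x = 0 := by rw [hx, Set.indicator_of_notMem hxρ]
      simp [this]
  calc ENNReal.ofReal (rieszConst N α) *
        ∫⁻ x, ∫⁻ y, ‖f' x‖ₑ * (‖g' y‖ₑ * powKernel α (x - y))
      ≤ ENNReal.ofReal (rieszConst N α) *
        ∫⁻ x, ‖f' x‖ₑ * ENNReal.ofReal (C * d ^ (-((N - α) / 2)) * ‖g‖) := by
        exact mul_le_mul_right (lintegral_mono_ae hinner) _
    _ ≤ ENNReal.ofReal (rieszConst N α) * (ENNReal.ofReal (D * ‖f‖) *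
          ENNReal.ofReal (C * d ^ (-((N - α) / 2)) * ‖g‖)) := by
        rw [lintegral_mul_const _ hf'm.enorm]
        gcongr
        exact hL1 f
    _ = ENNReal.ofReal (rieszConst N α * (D * (C * d ^ (-((N - α) / 2)))) * (‖f‖ * ‖g‖)) := by
        rw [← ENNReal.ofReal_mul (by positivity), ← ENNReal.ofReal_mul hA.le]
        congr 1
        ring
    _ ≤ _ := by gcongr

end RieszForm

section Pointwise

theorem abs_rpow_sub_two_mul_self {t : ℝ} (ht : 1 < t) (x : ℝ) :
    |(|x| ^ (t - 2) * x)| = |x| ^ (t - 1) := by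
  rcases eq_or_ne x 0 with rfl | hx
  · simp [Real.zero_rpow (by linarith : t - 1 ≠ 0)]
  · rw [abs_mul, abs_of_nonneg (by positivity : 0 ≤ |x| ^ (t - 2))]
    nth_rewrite 2 [← Real.rpow_one |x|]
    rw [← Real.rpow_add (abs_pos.2 hx)]
    congr 1
    ring

theorem rpow_sub_two_mul_self_of_nonneg {t : ℝ} (ht : 1 < t) {x : ℝ} (hx : 0 ≤ x) :
    |x| ^ (t - 2) * x = x ^ (t - 1) := by
  have h := abs_rpow_sub_two_mul_self ht x
  have h0 : 0 ≤ |x| ^ (t - 2) * x := by positivity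
  rw [abs_of_nonneg h0] at h
  rw [h, abs_of_nonneg hx]

theorem rpow_sub_two_mul_self_mul {t : ℝ} (ht : 1 < t) (x : ℝ) :
    |x| ^ (t - 2) * x * x = |x| ^ t := by
  rcases eq_or_ne x 0 with rfl | hx
  · simp [Real.zero_rpow (by linarith : t ≠ 0)]
  · rw [mul_assoc, ← sq, ← sq_abs, ← Real.rpow_natCast, ← Real.rpow_add (abs_pos.2 hx)]
    congr 1
    push_cast
    ring

/-- The Hölder exponent of `x ↦ |x|^(t-2) x`. -/
noncomputable def holderExp (t : ℝ) : ℝ := min 1 (t - 1)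

theorem holderExp_pos {t : ℝ} (ht : 1 < t) : 0 < holderExp t := lt_min one_pos (by linarith)

theorem holderExp_le {t : ℝ} : holderExp t ≤ t - 1 := min_le_right _ _

theorem rpow_sub_rpow_le {t : ℝ} (ht : 1 < t) {x y : ℝ} (hy : 0 ≤ y) (hxy : y ≤ x) :
    x ^ (t - 1) - y ^ (t - 1) ≤ t * ((x - y) ^ holderExp t * (x + y) ^ (t - 1 - holderExp t)) := by
  have hx : 0 ≤ x := hy.trans hxy
  rcases le_total (t - 1) 1 with h | h
  · have h0 : holderExp t = t - 1 := min_eq_right h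
    rw [h0, sub_self, Real.rpow_zero, mul_one]
    have := Real.rpow_add_le_add_rpow (sub_nonneg.2 hxy) hy (by linarith : 0 ≤ t - 1) h
    rw [sub_add_cancel] at this
    have h1 : 0 ≤ (x - y) ^ (t - 1) := Real.rpow_nonneg (sub_nonneg.2 hxy) _
    nlinarith
  · have h0 : holderExp t = 1 := min_eq_left h
    rw [h0, Real.rpow_one]
    rcases eq_or_lt_of_le hxy with rfl | hlt
    · simp
    have hx0 : 0 < x := lt_of_le_of_lt hy hlt
    -- Bernoulli's inequality at `y / x`
    have hb := one_add_mul_self_le_rpow_one_add (s := y / x - 1) (p := t - 1)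
      (by have : 0 ≤ y / x := by positivity
          linarith) h
    rw [add_sub_cancel, Real.div_rpow hy hx] at hb
    have hxt : 0 < x ^ (t - 1) := Real.rpow_pos_of_pos hx0 _
    rw [le_div_iff₀ hxt] at hb
    have hsplit : x ^ (t - 1) = x ^ (t - 1 - 1) * x := by
      rw [← Real.rpow_add_one hx0.ne']
      congr 1
      ring
    have hkey : x ^ (t - 1) - y ^ (t - 1) ≤ (t - 1) * ((x - y) * x ^ (t - 1 - 1)) := by
      have : (t - 1) * (y / x - 1) * x ^ (t - 1) = (t - 1) * ((y - x) * x ^ (t - 1 - 1)) := by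
        rw [hsplit]
        field_simp
      nlinarith
    have hmono : x ^ (t - 1 - 1) ≤ (x + y) ^ (t - 1 - 1) :=
      Real.rpow_le_rpow hx (by linarith) (by linarith)
    have hp : 0 ≤ (x - y) * x ^ (t - 1 - 1) := mul_nonneg (by linarith) (by positivity)
    calc x ^ (t - 1) - y ^ (t - 1) ≤ (t - 1) * ((x - y) * x ^ (t - 1 - 1)) := hkey
      _ ≤ t * ((x - y) * x ^ (t - 1 - 1)) := by nlinarith
      _ ≤ _ := by
        gcongr

theorem abs_rpow_mul_sub_le {t : ℝ} (ht : 1 < t) (x y : ℝ) :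
    |(|x| ^ (t - 2) * x - |y| ^ (t - 2) * y)|
      ≤ (t + 1) * (|x - y| ^ holderExp t * (|x| + |y|) ^ (t - 1 - holderExp t)) := by
  wlog h : |y| ≤ |x| generalizing x y
  · rw [abs_sub_comm, abs_sub_comm x, add_comm |x|]
    exact this y x (le_of_not_ge h)
  wlog hx : 0 ≤ x generalizing x y
  · have := this (-x) (-y) (by simpa using h) (by linarith)
    rw [abs_neg, abs_neg, ← abs_neg] at this
    convert! this using 2
    · ring
    · rw [← abs_neg]; congr 3; ring
  have hθ := holderExp_pos ht
  have hθ' := holderExp_le (t := t)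
  rw [rpow_sub_two_mul_self_of_nonneg ht hx]
  rw [abs_of_nonneg hx] at h ⊢
  rcases le_total 0 y with hy | hy
  · rw [rpow_sub_two_mul_self_of_nonneg ht hy]
    rw [abs_of_nonneg hy] at h ⊢
    have hm : y ^ (t - 1) ≤ x ^ (t - 1) := Real.rpow_le_rpow hy h (by linarith)
    rw [abs_of_nonneg (by linarith), abs_of_nonneg (by linarith : 0 ≤ x - y)]
    refine (rpow_sub_rpow_le ht hy h).trans ?_
    have : 0 ≤ (x - y) ^ holderExp t * (x + y) ^ (t - 1 - holderExp t) :=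
      mul_nonneg (Real.rpow_nonneg (by linarith) _) (Real.rpow_nonneg (by linarith) _)
    nlinarith
  · have e1 : |x - y| = x + |y| := by
      rw [abs_of_nonneg (by linarith), abs_of_nonpos hy]; ring
    rw [e1, ← Real.rpow_add_of_nonneg (by positivity) hθ.le (by linarith), add_sub_cancel]
    calc |x ^ (t - 1) - |y| ^ (t - 2) * y| ≤ |x ^ (t - 1)| + |(|y| ^ (t - 2) * y)| := abs_sub _ _
      _ = x ^ (t - 1) + |y| ^ (t - 1) := by
        rw [abs_rpow_sub_two_mul_self ht, abs_of_nonneg (by positivity)]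
      _ ≤ (x + |y|) ^ (t - 1) + (x + |y|) ^ (t - 1) := by
        gcongr <;> linarith [abs_nonneg y]
      _ ≤ _ := by
        have : 0 ≤ (x + |y|) ^ (t - 1) := by positivity
        nlinarith

theorem abs_abs_rpow_sub_le {t : ℝ} (ht : 1 < t) (x y : ℝ) :
    |(|x| ^ t - |y| ^ t)| ≤ t * ((|x| + |y|) ^ (t - 1) * |x - y|) := by
  have h := (convex_uIcc y x).norm_image_sub_le_of_norm_hasDerivWithin_le
    (f := fun z : ℝ => |z| ^ t) (f' := fun z => t * |z| ^ (t - 2) * z)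
    (C := t * (|x| + |y|) ^ (t - 1))
    (fun z _ => (hasDerivAt_abs_rpow z ht).hasDerivWithinAt) (fun z hz => ?_)
    Set.left_mem_uIcc Set.right_mem_uIcc
  · simpa only [Real.norm_eq_abs, mul_assoc] using h
  · rw [Real.norm_eq_abs, mul_assoc, abs_mul, abs_rpow_sub_two_mul_self ht, abs_of_pos (by linarith)]
    have hz' : |z| ≤ |x| + |y| := by
      rcases Set.mem_uIcc.1 hz with ⟨h1, h2⟩ | ⟨h1, h2⟩ <;>
      · rw [abs_le]
        constructor <;>
        linarith [neg_abs_le x, neg_abs_le y, le_abs_self x, le_abs_self y, abs_nonneg x,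
          abs_nonneg y]
    gcongr

theorem abs_taylor_abs_rpow_le {t : ℝ} (ht : 1 < t) (x v : ℝ) :
    |(|x + v| ^ t - |x| ^ t - t * (|x| ^ (t - 2) * x * v))|
      ≤ t * (t + 1) * 2 ^ (t - 1 - holderExp t) *
        (|v| ^ holderExp t * (|x| + |v|) ^ (t - 1 - holderExp t) * |v|) := by
  have hθ := holderExp_pos ht
  have hθ' := holderExp_le (t := t)
  have h := (convex_uIcc 0 v).norm_image_sub_le_of_norm_hasDerivWithin_le
    (f := fun w : ℝ => |x + w| ^ t - t * (|x| ^ (t - 2) * x) * w)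
    (f' := fun w => t * |x + w| ^ (t - 2) * (x + w) - t * (|x| ^ (t - 2) * x))
    (C := t * (t + 1) * 2 ^ (t - 1 - holderExp t) *
        (|v| ^ holderExp t * (|x| + |v|) ^ (t - 1 - holderExp t)))
    (fun w _ => ?_) (fun w hw => ?_) Set.left_mem_uIcc Set.right_mem_uIcc
  · simp only [add_zero, mul_zero, sub_zero, Real.norm_eq_abs] at h
    convert! h using 1
    · congr 1; ring
    · ring
  · refine HasDerivAt.hasDerivWithinAt (HasDerivAt.sub ?_ ?_)
    · have := (hasDerivAt_abs_rpow (x + w) ht).comp w ((hasDerivAt_id w).const_add x)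
      simpa [Function.comp_def] using this
    · simpa using (hasDerivAt_id w).const_mul (t * (|x| ^ (t - 2) * x))
  · have hw' : |w| ≤ |v| := by
      rcases Set.mem_uIcc.1 hw with ⟨h1, h2⟩ | ⟨h1, h2⟩
      · rwa [abs_of_nonneg h1, abs_of_nonneg (h1.trans h2)]
      · rw [abs_of_nonpos h2, abs_of_nonpos (h1.trans h2)]; linarith
    rw [Real.norm_eq_abs, mul_assoc, ← mul_sub, abs_mul, abs_of_pos (by linarith : 0 < t)]
    have h1 := abs_rpow_mul_sub_le ht (x + w) x
    rw [add_sub_cancel_left] at h1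
    have h2 : |x + w| + |x| ≤ 2 * (|x| + |v|) := by
      have := abs_add_le x w
      have := abs_nonneg v
      linarith
    calc t * |(|x + w| ^ (t - 2) * (x + w) - |x| ^ (t - 2) * x)|
        ≤ t * ((t + 1) * (|w| ^ holderExp t * (|x + w| + |x|) ^ (t - 1 - holderExp t))) := by gcongr
      _ ≤ t * ((t + 1) * (|v| ^ holderExp t * (2 * (|x| + |v|)) ^ (t - 1 - holderExp t))) := by
          gcongr
      _ = _ := by
          rw [Real.mul_rpow (by norm_num) (by positivity)]
          ring

end Pointwise

section Nemytskii

variable {Ω : Type*} [MeasurableSpace Ω] {μ : Measure Ω}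

/-- The exponent `s t`, for which `|U|^t ∈ L^s` if `U ∈ L^{s t}`. -/
noncomputable def nemExp (s : ENNReal) (t : ℝ) : ENNReal := s * ENNReal.ofReal t

variable {s : ENNReal} {t : ℝ}

theorem nemExp_toReal (ht : 0 ≤ t) : (nemExp s t).toReal = s.toReal * t := by
  rw [nemExp, ENNReal.toReal_mul, ENNReal.toReal_ofReal ht]

/-- Hölder's inequality in the form needed for Nemytskii operators. -/
theorem eLpNorm_le_of_ae_le_mul_rpow (hs0 : s ≠ 0) (hsT : s ≠ ⊤) (ht : 0 < t) {a b c : ℝ}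
    (ha : 0 ≤ a) (hb : 0 ≤ b) (hab : a + b + 1 = t) {k f g h : Ω → ℝ}
    (hf : AEStronglyMeasurable f μ) (hg : AEStronglyMeasurable g μ) (hh : AEStronglyMeasurable h μ)
    (hk : ∀ᵐ x ∂μ, |k x| ≤ c * (|f x| ^ a * |g x| ^ b * |h x|)) :
    eLpNorm k s μ ≤ ENNReal.ofReal c *
      (eLpNorm f (nemExp s t) μ ^ a * eLpNorm g (nemExp s t) μ ^ b * eLpNorm h (nemExp s t) μ) := by
  have hsr : 0 < s.toReal := ENNReal.toReal_pos hs0 hsT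
  have hm0 : nemExp s t ≠ 0 := by simp [nemExp, hs0, ht]
  have hmT : nemExp s t ≠ ⊤ := ENNReal.mul_ne_top hsT ENNReal.ofReal_ne_top
  set m := s.toReal * t with hm
  have hmr : (nemExp s t).toReal = m := nemExp_toReal ht.le
  have hm' : 0 < m := by positivity
  have hE : ∀ f : Ω → ℝ, eLpNorm f (nemExp s t) μ = (∫⁻ x, ‖f x‖ₑ ^ m ∂μ) ^ (1 / m) := fun f => by
    rw [eLpNorm_eq_lintegral_rpow_enorm_toReal hm0 hmT, hmr]
  calc eLpNorm k s μ = (∫⁻ x, ‖k x‖ₑ ^ s.toReal ∂μ) ^ (1 / s.toReal) :=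
        eLpNorm_eq_lintegral_rpow_enorm_toReal hs0 hsT
    _ ≤ (∫⁻ x, ENNReal.ofReal c ^ s.toReal *
          ((‖f x‖ₑ ^ m) ^ (a / t) * (‖g x‖ₑ ^ m) ^ (b / t) * (‖h x‖ₑ ^ m) ^ (1 / t)) ∂μ)
          ^ (1 / s.toReal) := by
        gcongr ?_ ^ _
        refine lintegral_mono_ae ?_
        filter_upwards [hk] with x hx
        have : ‖k x‖ₑ ≤ ENNReal.ofReal c * (‖f x‖ₑ ^ a * ‖g x‖ₑ ^ b * ‖h x‖ₑ) := by
          have h1 : ‖k x‖ₑ ≤ ENNReal.ofReal (c * (|f x| ^ a * |g x| ^ b * |h x|)) := by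
            rw [Real.enorm_eq_ofReal_abs]
            exact ENNReal.ofReal_le_ofReal hx
          refine h1.trans_eq ?_
          rw [ENNReal.ofReal_mul' (by positivity), ENNReal.ofReal_mul (by positivity),
            ENNReal.ofReal_mul (by positivity), Real.enorm_eq_ofReal_abs, Real.enorm_eq_ofReal_abs,
            Real.enorm_eq_ofReal_abs, ENNReal.ofReal_rpow_of_nonneg (abs_nonneg _) ha,
            ENNReal.ofReal_rpow_of_nonneg (abs_nonneg _) hb]
        refine (ENNReal.rpow_le_rpow this hsr.le).trans_eq ?_
        rw [ENNReal.mul_rpow_of_nonneg _ _ hsr.le, ENNReal.mul_rpow_of_nonneg _ _ hsr.le,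
          ENNReal.mul_rpow_of_nonneg _ _ hsr.le]
        simp only [← ENNReal.rpow_mul]
        have e1 : m * (a / t) = a * s.toReal := by rw [hm]; field_simp
        have e2 : m * (b / t) = b * s.toReal := by rw [hm]; field_simp
        have e3 : m * (1 / t) = s.toReal := by rw [hm]; field_simp
        rw [e1, e2, e3]
    _ ≤ (ENNReal.ofReal c ^ s.toReal * ((∫⁻ x, ‖f x‖ₑ ^ m ∂μ) ^ (a / t) *
          (∫⁻ x, ‖g x‖ₑ ^ m ∂μ) ^ (b / t) * (∫⁻ x, ‖h x‖ₑ ^ m ∂μ) ^ (1 / t))) ^ (1 / s.toReal) := by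
        gcongr ?_ ^ _
        rw [lintegral_const_mul' _ _ (ENNReal.rpow_ne_top_of_nonneg hsr.le ENNReal.ofReal_ne_top)]
        gcongr
        have := ENNReal.lintegral_prod_norm_pow_le (μ := μ) (Finset.univ : Finset (Fin 3))
          (f := ![fun x => ‖f x‖ₑ ^ m, fun x => ‖g x‖ₑ ^ m, fun x => ‖h x‖ₑ ^ m])
          (p := ![a / t, b / t, 1 / t]) ?_ ?_ ?_
        · simpa [Fin.prod_univ_three] using this
        · intro i _
          fin_cases i
          · exact hf.enorm.pow_const _
          · exact hg.enorm.pow_const _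
          · exact hh.enorm.pow_const _
        · simp only [Fin.sum_univ_three, Matrix.cons_val_zero, Matrix.cons_val_one, Matrix.cons_val]
          rw [← add_div, ← add_div, hab, div_self ht.ne']
        · intro i _
          fin_cases i
          · exact div_nonneg ha ht.le
          · exact div_nonneg hb ht.le
          · exact div_nonneg zero_le_one ht.le
    _ = _ := by
        have hs' : 0 ≤ 1 / s.toReal := by positivity
        rw [ENNReal.mul_rpow_of_nonneg _ _ hs', ENNReal.mul_rpow_of_nonneg _ _ hs',
          ENNReal.mul_rpow_of_nonneg _ _ hs', hE, hE, hE]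
        simp only [← ENNReal.rpow_mul]
        have e0 : s.toReal * (1 / s.toReal) = 1 := by field_simp
        have e1 : a / t * (1 / s.toReal) = 1 / m * a := by rw [hm]; field_simp
        have e2 : b / t * (1 / s.toReal) = 1 / m * b := by rw [hm]; field_simp
        have e3 : 1 / t * (1 / s.toReal) = 1 / m := by rw [hm]; field_simp
        rw [e0, e1, e2, e3, ENNReal.rpow_one]

variable [hs : Fact (1 ≤ s)] [hsT : Fact (s ≠ ⊤)] [ht : Fact (1 < t)]

instance : Fact (1 ≤ nemExp s t) := ⟨by
  have h1 : 1 ≤ ENNReal.ofReal t := by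
    rw [ENNReal.one_le_ofReal]
    exact ht.out.le
  calc (1 : ENNReal) = 1 * 1 := (one_mul _).symm
    _ ≤ _ := mul_le_mul' hs.out h1⟩

omit hs ht in
theorem nemExp_ne_top : nemExp s t ≠ ⊤ := ENNReal.mul_ne_top hsT.out ENNReal.ofReal_ne_top

omit hsT in
theorem ne_zero_of_fact : s ≠ 0 := (zero_lt_one.trans_le hs.out).ne'

theorem norm_le_of_ae_le_mul_rpow {a b c : ℝ} (hc : 0 ≤ c)
    (ha : 0 ≤ a) (hb : 0 ≤ b) (hab : a + b + 1 = t) {k : Lp ℝ s μ}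
    {f g₁ g₂ h : Lp ℝ (nemExp s t) μ}
    (hk : ∀ᵐ x ∂μ, |k x| ≤ c * (|f x| ^ a * (|g₁ x| + |g₂ x|) ^ b * |h x|)) :
    ‖k‖ ≤ c * (‖f‖ ^ a * (‖g₁‖ + ‖g₂‖) ^ b * ‖h‖) := by
  have hg : AEStronglyMeasurable (fun x => |g₁ x| + |g₂ x|) μ :=
    (Lp.aestronglyMeasurable g₁).norm.add (Lp.aestronglyMeasurable g₂).norm
  have h1 := eLpNorm_le_of_ae_le_mul_rpow (ne_zero_of_fact (s := s)) hsT.out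
    (zero_lt_one.trans ht.out) ha hb hab (Lp.aestronglyMeasurable f)
    hg (Lp.aestronglyMeasurable h) (c := c) (k := k) (by
      filter_upwards [hk] with x hx
      rwa [abs_of_nonneg (by positivity : 0 ≤ |g₁ x| + |g₂ x|)])
  have h2 : eLpNorm (fun x => |g₁ x| + |g₂ x|) (nemExp s t) μ ≤ ENNReal.ofReal (‖g₁‖ + ‖g₂‖) := by
    rw [ENNReal.ofReal_add (norm_nonneg _) (norm_nonneg _), ofReal_norm, ofReal_norm,
      Lp.enorm_def, Lp.enorm_def]
    refine (eLpNorm_add_le (Lp.aestronglyMeasurable g₁).norm (Lp.aestronglyMeasurable g₂).norm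
      (Fact.out : 1 ≤ nemExp s t)).trans_eq ?_
    rw [eLpNorm_norm, eLpNorm_norm]
  have h3 : ‖k‖ₑ ≤ ENNReal.ofReal (c * (‖f‖ ^ a * (‖g₁‖ + ‖g₂‖) ^ b * ‖h‖)) := by
    rw [Lp.enorm_def]
    refine h1.trans ?_
    rw [ENNReal.ofReal_mul hc, ENNReal.ofReal_mul (by positivity),
      ENNReal.ofReal_mul (by positivity), ← ENNReal.ofReal_rpow_of_nonneg (norm_nonneg _) ha,
      ← ENNReal.ofReal_rpow_of_nonneg (by positivity) hb, ofReal_norm, ofReal_norm,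
      Lp.enorm_def, Lp.enorm_def]
    gcongr
  rw [← ofReal_norm] at h3
  exact (ENNReal.ofReal_le_ofReal_iff (by positivity)).1 h3

theorem memLp_abs_rpow (U : Lp ℝ (nemExp s t) μ) : MemLp (fun x => |U x| ^ t) s μ := by
  have ht' := ht.out
  have hU := Lp.aestronglyMeasurable U
  refine ⟨(hU.norm.aemeasurable.pow_const t).aestronglyMeasurable, ?_⟩
  refine (eLpNorm_le_of_ae_le_mul_rpow (ne_zero_of_fact (s := s)) hsT.out (t := t)
    (by linarith) (a := t - 1) (b := 0) (c := 1) (by linarith) le_rfl (by ring) hU hU hU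
    (ae_of_all _ fun x => ?_)).trans_lt ?_
  · have h0 : 0 ≤ |U x| ^ t := by positivity
    rw [Real.rpow_zero, mul_one, one_mul, abs_of_nonneg h0,
      ← abs_rpow_sub_two_mul_self ht', ← abs_mul, rpow_sub_two_mul_self_mul ht',
      abs_of_nonneg h0]
  · have := (Lp.memLp U).2
    simp only [ENNReal.ofReal_one, ENNReal.rpow_zero, mul_one, one_mul]
    exact ENNReal.mul_lt_top (ENNReal.rpow_lt_top_of_nonneg (by linarith) this.ne) this

/-- The Nemytskii operator `U ↦ |U|^t` from `L^{st}` to `L^s`. -/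
noncomputable def nem (U : Lp ℝ (nemExp s t) μ) : Lp ℝ s μ := (memLp_abs_rpow U).toLp _

theorem coeFn_nem (U : Lp ℝ (nemExp s t) μ) : nem U =ᵐ[μ] fun x => |U x| ^ t :=
  MemLp.coeFn_toLp _

theorem memLp_rpow_mul (U V : Lp ℝ (nemExp s t) μ) :
    MemLp (fun x => |U x| ^ (t - 2) * U x * V x) s μ := by
  have ht' := ht.out
  have hU := Lp.aestronglyMeasurable U
  have hV := Lp.aestronglyMeasurable V
  refine ⟨((hU.norm.aemeasurable.pow_const _).aestronglyMeasurable.mul hU).mul hV, ?_⟩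
  refine (eLpNorm_le_of_ae_le_mul_rpow (ne_zero_of_fact (s := s)) hsT.out (t := t)
    (by linarith) (a := t - 1) (b := 0) (c := 1) (by linarith) le_rfl (by ring) hU hU hV
    (ae_of_all _ fun x => ?_)).trans_lt ?_
  · rw [Real.rpow_zero, mul_one, one_mul, abs_mul, abs_rpow_sub_two_mul_self ht']
  · have := (Lp.memLp U).2
    have := (Lp.memLp V).2
    simp only [ENNReal.ofReal_one, ENNReal.rpow_zero, mul_one, one_mul]
    exact ENNReal.mul_lt_top (ENNReal.rpow_lt_top_of_nonneg (by linarith)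
      (Lp.memLp U).2.ne) this

/-- The linear map `V ↦ |U|^(t-2) U V`. -/
noncomputable def dnemₗ (U : Lp ℝ (nemExp s t) μ) : Lp ℝ (nemExp s t) μ →ₗ[ℝ] Lp ℝ s μ where
  toFun V := (memLp_rpow_mul U V).toLp _
  map_add' V W := by
    rw [← MemLp.toLp_add]
    refine MemLp.toLp_congr _ _ ?_
    filter_upwards [Lp.coeFn_add V W] with x hx
    simp only [hx, Pi.add_apply]
    ring
  map_smul' c V := by
    rw [RingHom.id_apply, ← MemLp.toLp_const_smul]
    refine MemLp.toLp_congr _ _ ?_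
    filter_upwards [Lp.coeFn_smul c V] with x hx
    simp only [hx, Pi.smul_apply, smul_eq_mul]
    ring

theorem coeFn_dnemₗ (U V : Lp ℝ (nemExp s t) μ) :
    dnemₗ U V =ᵐ[μ] fun x => |U x| ^ (t - 2) * U x * V x := by
  have h : dnemₗ U V = (memLp_rpow_mul U V).toLp _ := rfl
  rw [h]
  exact MemLp.coeFn_toLp _

theorem norm_dnemₗ_le (U V : Lp ℝ (nemExp s t) μ) : ‖dnemₗ U V‖ ≤ ‖U‖ ^ (t - 1) * ‖V‖ := by
  have ht' := ht.out
  have := norm_le_of_ae_le_mul_rpow (s := s) (t := t) (a := t - 1) (b := 0) (c := 1) (k := dnemₗ U V)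
    (f := U) (g₁ := U) (g₂ := U) (h := V) zero_le_one (by linarith) le_rfl (by ring) (by
      filter_upwards [coeFn_dnemₗ U V] with x hx
      rw [hx, Real.rpow_zero, mul_one, one_mul, abs_mul, abs_rpow_sub_two_mul_self ht'])
  simpa using this

/-- The linear map `V ↦ |U|^(t-2) U V` as a continuous linear map; up to the factor `t`, it is the
derivative of `nem` at `U`. -/
noncomputable def dnem (U : Lp ℝ (nemExp s t) μ) : Lp ℝ (nemExp s t) μ →L[ℝ] Lp ℝ s μ :=
  (dnemₗ U).mkContinuous (‖U‖ ^ (t - 1)) (norm_dnemₗ_le U)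

theorem coeFn_dnem (U V : Lp ℝ (nemExp s t) μ) :
    dnem U V =ᵐ[μ] fun x => |U x| ^ (t - 2) * U x * V x := coeFn_dnemₗ U V

theorem norm_dnem_le (U : Lp ℝ (nemExp s t) μ) : ‖dnem U‖ ≤ ‖U‖ ^ (t - 1) :=
  LinearMap.mkContinuous_norm_le _ (by positivity) _

theorem dnem_self (U : Lp ℝ (nemExp s t) μ) : dnem U U = nem U := by
  refine Lp.ext ?_
  filter_upwards [coeFn_dnem U U, coeFn_nem U] with x h1 h2
  rw [h1, h2, rpow_sub_two_mul_self_mul ht.out]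

theorem norm_nem_le (U : Lp ℝ (nemExp s t) μ) : ‖nem U‖ ≤ ‖U‖ ^ t := by
  rw [← dnem_self]
  refine ((dnem U).le_of_opNorm_le (norm_dnem_le U) U).trans_eq ?_
  rcases eq_or_ne U 0 with rfl | hU
  · rw [norm_zero, mul_zero, Real.zero_rpow (by linarith [ht.out])]
  · rw [← Real.rpow_add_one (norm_ne_zero_iff.2 hU), sub_add_cancel]

theorem norm_nem_sub_le (U V : Lp ℝ (nemExp s t) μ) :
    ‖nem U - nem V‖ ≤ t * ((‖U‖ + ‖V‖) ^ (t - 1) * ‖U - V‖) := by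
  have ht' := ht.out
  have := norm_le_of_ae_le_mul_rpow (s := s) (t := t) (a := 0) (b := t - 1) (c := t)
    (k := nem U - nem V)
    (f := U) (g₁ := U) (g₂ := V) (h := U - V) (by linarith) le_rfl (by linarith) (by ring) (by
      filter_upwards [coeFn_nem U, coeFn_nem V, Lp.coeFn_sub (nem U) (nem V), Lp.coeFn_sub U V]
        with x h1 h2 h3 h4
      rw [h3, h4, Pi.sub_apply, Pi.sub_apply, h1, h2, Real.rpow_zero, one_mul]
      exact abs_abs_rpow_sub_le ht' _ _)
  simpa using this

theorem norm_dnem_sub_le (U V : Lp ℝ (nemExp s t) μ) :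
    ‖dnem U - dnem V‖ ≤
      (t + 1) * (‖U - V‖ ^ holderExp t * (‖U‖ + ‖V‖) ^ (t - 1 - holderExp t)) := by
  have ht' := ht.out
  have hθ := holderExp_pos ht'
  have hθ' := holderExp_le (t := t)
  refine ContinuousLinearMap.opNorm_le_bound _ (by positivity) fun W => ?_
  rw [mul_assoc]
  refine norm_le_of_ae_le_mul_rpow (s := s) (t := t) (by linarith) hθ.le (by linarith) (by ring) ?_
  filter_upwards [coeFn_dnem U W, coeFn_dnem V W, Lp.coeFn_sub (dnem U W) (dnem V W),
    Lp.coeFn_sub U V] with x h1 h2 h3 h4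
  rw [sub_apply, h3, h4, Pi.sub_apply, Pi.sub_apply, h1, h2, ← sub_mul,
    abs_mul, ← mul_assoc]
  gcongr
  exact abs_rpow_mul_sub_le ht' _ _

theorem norm_nem_add_sub_le (U V : Lp ℝ (nemExp s t) μ) :
    ‖nem (U + V) - nem U - (t • dnem U) V‖ ≤
      t * (t + 1) * 2 ^ (t - 1 - holderExp t) *
        (‖V‖ ^ holderExp t * (‖U‖ + ‖V‖) ^ (t - 1 - holderExp t) * ‖V‖) := by
  have ht' := ht.out
  have hθ := holderExp_pos ht'
  have hθ' := holderExp_le (t := t)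
  refine norm_le_of_ae_le_mul_rpow (s := s) (t := t) (by positivity) hθ.le (by linarith) (by ring) ?_
  filter_upwards [coeFn_dnem U V, coeFn_nem (U + V), coeFn_nem U, Lp.coeFn_add U V,
    Lp.coeFn_sub (nem (U + V)) (nem U), Lp.coeFn_sub (nem (U + V) - nem U) ((t • dnem U) V),
    Lp.coeFn_smul t (dnem U V)] with x h1 h2 h3 h4 h5 h6 h7
  rw [h6, Pi.sub_apply, h5, Pi.sub_apply, smul_apply, h7, Pi.smul_apply, h1, h2,
    h3, h4, Pi.add_apply, smul_eq_mul]
  exact abs_taylor_abs_rpow_le ht' _ _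

theorem hasFDerivAt_nem (U : Lp ℝ (nemExp s t) μ) : HasFDerivAt nem (t • dnem U) U := by
  have ht' := ht.out
  have hθ := holderExp_pos ht'
  have hθ' := holderExp_le (t := t)
  rw [hasFDerivAt_iff_isLittleO_nhds_zero, Asymptotics.isLittleO_iff]
  intro c hc
  have hlim : Tendsto (fun V : Lp ℝ (nemExp s t) μ => t * (t + 1) * 2 ^ (t - 1 - holderExp t) *
        (‖V‖ ^ holderExp t * (‖U‖ + ‖V‖) ^ (t - 1 - holderExp t))) (𝓝 0)
      (𝓝 (t * (t + 1) * 2 ^ (t - 1 - holderExp t) *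
        (0 ^ holderExp t * (‖U‖ + 0) ^ (t - 1 - holderExp t)))) := by
    have hn : Tendsto (fun V : Lp ℝ (nemExp s t) μ => ‖V‖) (𝓝 0) (𝓝 0) := tendsto_norm_zero
    refine Tendsto.const_mul _ (Tendsto.mul (hn.rpow_const (Or.inr hθ.le)) ?_)
    exact (hn.const_add _).rpow_const (Or.inr (by linarith))
  rw [Real.zero_rpow hθ.ne', zero_mul, mul_zero] at hlim
  filter_upwards [hlim.eventually (gt_mem_nhds hc)] with V hV
  refine (norm_nem_add_sub_le U V).trans ?_
  rw [← mul_assoc]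
  gcongr

end Nemytskii

section CutNemytskii

variable {N : ℕ} {s : ENNReal} {t : ℝ} [hs : Fact (1 ≤ s)] [hsT : Fact (s ≠ ⊤)] [ht : Fact (1 < t)]

theorem nem_ballCut (R : ℝ) (U : Lp ℝ (nemExp s t) (volume : Measure (RN N))) :
    nem (ballCut R U) = ballCut R (nem U) := by
  refine Lp.ext ?_
  filter_upwards [coeFn_nem (ballCut R U), coeFn_ballCut R U, coeFn_ballCut R (nem U), coeFn_nem U]
    with x h1 h2 h3 h4
  have ht' := ht.out
  rw [h1, h2, h3]
  by_cases h : x ∈ Metric.ball (0 : RN N) R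
  · rw [Set.indicator_of_mem h, Set.indicator_of_mem h, h4]
  · rw [Set.indicator_of_notMem h, Set.indicator_of_notMem h, abs_zero,
      Real.zero_rpow (by linarith)]

theorem nem_sub_ballCut (R : ℝ) (U : Lp ℝ (nemExp s t) (volume : Measure (RN N))) :
    nem (U - ballCut R U) = nem U - ballCut R (nem U) := by
  refine Lp.ext ?_
  filter_upwards [coeFn_nem (U - ballCut R U), coeFn_sub_ballCut R U, coeFn_sub_ballCut R (nem U),
    coeFn_nem U] with x h1 h2 h3 h4
  have ht' := ht.out
  rw [h1, h2, h3]
  by_cases h : x ∈ (Metric.ball (0 : RN N) R)ᶜ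
  · rw [Set.indicator_of_mem h, Set.indicator_of_mem h, h4]
  · rw [Set.indicator_of_notMem h, Set.indicator_of_notMem h, abs_zero,
      Real.zero_rpow (by linarith)]

theorem dnem_ballCut (R : ℝ) (U V : Lp ℝ (nemExp s t) (volume : Measure (RN N))) :
    dnem (ballCut R U) V = ballCut R (dnem U V) := by
  refine Lp.ext ?_
  filter_upwards [coeFn_dnem (ballCut R U) V, coeFn_ballCut R U, coeFn_ballCut R (dnem U V),
    coeFn_dnem U V] with x h1 h2 h3 h4
  rw [h1, h2, h3]
  by_cases h : x ∈ Metric.ball (0 : RN N) R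
  · rw [Set.indicator_of_mem h, Set.indicator_of_mem h, h4]
  · rw [Set.indicator_of_notMem h, Set.indicator_of_notMem h, mul_zero, zero_mul]

theorem dnem_sub_ballCut (R : ℝ) (U V : Lp ℝ (nemExp s t) (volume : Measure (RN N))) :
    dnem (U - ballCut R U) V = dnem U V - ballCut R (dnem U V) := by
  refine Lp.ext ?_
  filter_upwards [coeFn_dnem (U - ballCut R U) V, coeFn_sub_ballCut R U,
    coeFn_sub_ballCut R (dnem U V), coeFn_dnem U V] with x h1 h2 h3 h4
  rw [h1, h2, h3]
  by_cases h : x ∈ (Metric.ball (0 : RN N) R)ᶜ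
  · rw [Set.indicator_of_mem h, Set.indicator_of_mem h, h4]
  · rw [Set.indicator_of_notMem h, Set.indicator_of_notMem h, mul_zero, zero_mul]

theorem dnem_apply_ballCut (R : ℝ) (U V : Lp ℝ (nemExp s t) (volume : Measure (RN N))) :
    dnem U (ballCut R V) = dnem (ballCut R U) V := by
  refine Lp.ext ?_
  filter_upwards [coeFn_dnem (ballCut R U) V, coeFn_ballCut R U, coeFn_ballCut R V,
    coeFn_dnem U (ballCut R V)] with x h1 h2 h3 h4
  rw [h1, h2, h4, h3]
  by_cases h : x ∈ Metric.ball (0 : RN N) R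
  · rw [Set.indicator_of_mem h, Set.indicator_of_mem h]
  · rw [Set.indicator_of_notMem h, Set.indicator_of_notMem h, mul_zero, mul_zero, zero_mul]

omit hsT in
theorem disjoint_or_of_lt {ρ R : ℝ} (h : ρ ≤ R) (U Z : Lp ℝ s (volume : Measure (RN N))) :
    ∀ᵐ x, ballCut ρ U x = 0 ∨ (Z - ballCut R Z : Lp ℝ s (volume : Measure (RN N))) x = 0 := by
  filter_upwards [coeFn_ballCut ρ U, coeFn_sub_ballCut R Z] with x h1 h2
  by_cases hx : x ∈ Metric.ball (0 : RN N) ρ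
  · right
    have : x ∉ (Metric.ball (0 : RN N) R)ᶜ := by
      simpa using Metric.ball_subset_ball h hx
    rw [h2, Set.indicator_of_notMem this]
  · left
    rw [h1, Set.indicator_of_notMem hx]

theorem nem_add_of_disjoint {U Z : Lp ℝ (nemExp s t) (volume : Measure (RN N))}
    (h : ∀ᵐ x, U x = 0 ∨ Z x = 0) : nem (U + Z) = nem U + nem Z := by
  refine Lp.ext ?_
  have ht' := ht.out
  filter_upwards [coeFn_nem (U + Z), coeFn_nem U, coeFn_nem Z, Lp.coeFn_add U Z,
    Lp.coeFn_add (nem U) (nem Z), h] with x h1 h2 h3 h4 h5 h6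
  rw [h1, h4, h5, Pi.add_apply, Pi.add_apply, h2, h3]
  rcases h6 with h6 | h6 <;> simp [h6, Real.zero_rpow (by linarith : t ≠ 0)]

theorem dnem_add_of_disjoint {U Z : Lp ℝ (nemExp s t) (volume : Measure (RN N))}
    (h : ∀ᵐ x, U x = 0 ∨ Z x = 0) : dnem (U + Z) = dnem U + dnem Z := by
  refine ContinuousLinearMap.ext fun V => Lp.ext ?_
  filter_upwards [coeFn_dnem (U + Z) V, coeFn_dnem U V, coeFn_dnem Z V, Lp.coeFn_add U Z,
    Lp.coeFn_add (dnem U V) (dnem Z V), h] with x h1 h2 h3 h4 h5 h6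
  rw [add_apply, h1, h4, h5, Pi.add_apply, Pi.add_apply, h2, h3]
  rcases h6 with h6 | h6 <;> simp [h6]

end CutNemytskii

section NonlocalForm

variable {N : ℕ} {α t : ℝ} [hα : Fact (0 < α ∧ α < (N : ℝ))] [ht : Fact (1 < t)]

instance : Fact (hlsExp N α ≠ ⊤) := ⟨hlsExp_ne_top⟩

variable (N α t) in
/-- The Lebesgue space `L^{2Nt/(N+α)}`. -/
abbrev NonlocalSpace : Type := Lp ℝ (nemExp (hlsExp N α) t) (volume : Measure (RN N))

/-- The functional `U ↦ ∫ (I_α * |U|^t) |U|^t`. -/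
noncomputable def nonlocal (U : NonlocalSpace N α t) : ℝ := rieszForm N α (nem U) (nem U)

/-- The functional `V ↦ ∫ (I_α * |U|^t) |U|^(t-2) U V`. -/
noncomputable def nonlocalDeriv (U : NonlocalSpace N α t) : NonlocalSpace N α t →L[ℝ] ℝ :=
  (rieszForm N α (nem U)).comp (dnem U)

theorem nonlocalDeriv_apply (U V : NonlocalSpace N α t) :
    nonlocalDeriv U V = rieszForm N α (nem U) (dnem U V) := rfl

theorem nonlocalDeriv_self (U : NonlocalSpace N α t) : nonlocalDeriv U U = nonlocal U := by
  rw [nonlocalDeriv_apply, dnem_self, nonlocal]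

theorem hasFDerivAt_nonlocal (U : NonlocalSpace N α t) :
    HasFDerivAt nonlocal ((2 * t) • nonlocalDeriv U) U := by
  have h := (rieszForm N α).hasFDerivAt_of_bilinear (hasFDerivAt_nem U) (hasFDerivAt_nem U)
  refine h.congr_fderiv (ContinuousLinearMap.ext fun V => ?_)
  simp only [add_apply, ContinuousLinearMap.precompR_apply, ContinuousLinearMap.precompL_apply,
    smul_apply, nonlocalDeriv_apply, map_smul, smul_eq_mul]
  rw [rieszForm_comm (dnem U V), ContinuousLinearMap.compL_apply, ContinuousLinearMap.comp_apply]
  ring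

theorem norm_nonlocalDeriv_le (U : NonlocalSpace N α t) :
    ‖nonlocalDeriv U‖ ≤ ‖rieszForm N α‖ * (‖U‖ ^ t * ‖U‖ ^ (t - 1)) := by
  calc ‖nonlocalDeriv U‖ ≤ ‖rieszForm N α (nem U)‖ * ‖dnem U‖ :=
        ContinuousLinearMap.opNorm_comp_le _ _
    _ ≤ (‖rieszForm N α‖ * ‖nem U‖) * ‖dnem U‖ := by
        gcongr
        exact ContinuousLinearMap.le_opNorm _ _
    _ ≤ (‖rieszForm N α‖ * ‖U‖ ^ t) * ‖U‖ ^ (t - 1) := by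
        gcongr
        exacts [norm_nem_le U, norm_dnem_le U]
    _ = _ := by ring

theorem nonlocal_le (U : NonlocalSpace N α t) :
    nonlocal U ≤ ‖rieszForm N α‖ * (‖U‖ ^ t * ‖U‖ ^ t) := by
  calc nonlocal U ≤ ‖rieszForm N α (nem U) (nem U)‖ := le_abs_self _
    _ ≤ ‖rieszForm N α‖ * ‖nem U‖ * ‖nem U‖ := ContinuousLinearMap.le_opNorm₂ _ _ _
    _ ≤ ‖rieszForm N α‖ * ‖U‖ ^ t * ‖U‖ ^ t := by
        gcongr <;> exact norm_nem_le U
    _ = _ := by ring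

theorem nonlocal_nonneg (U : NonlocalSpace N α t) : 0 ≤ nonlocal U := by
  rw [nonlocal, rieszForm_eq_integral]
  have h0 : ∀ᵐ x, 0 ≤ nem U x := by
    filter_upwards [coeFn_nem U] with x hx
    rw [hx]
    positivity
  refine integral_nonneg_of_ae ?_
  filter_upwards [h0] with x hx
  refine mul_nonneg (integral_nonneg_of_ae ?_) hx
  filter_upwards [h0] with y hy
  exact mul_nonneg (rieszKernel_nonneg _) hy

theorem norm_nonlocalDeriv_sub_le {M : ℝ} {A B : NonlocalSpace N α t} (hA : ‖A‖ ≤ M)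
    (hB : ‖B‖ ≤ M) : ‖nonlocalDeriv A - nonlocalDeriv B‖ ≤ ‖rieszForm N α‖ *
      (t * ((M + M) ^ (t - 1) * ‖A - B‖) * M ^ (t - 1) +
        M ^ t * ((t + 1) * (‖A - B‖ ^ holderExp t * (M + M) ^ (t - 1 - holderExp t)))) := by
  have ht' := ht.out
  have hM : 0 ≤ M := (norm_nonneg _).trans hA
  have hθ := holderExp_pos ht'
  have hθ' := holderExp_le (t := t)
  have e : nonlocalDeriv A - nonlocalDeriv B = (rieszForm N α (nem A - nem B)).comp (dnem A)
      + (rieszForm N α (nem B)).comp (dnem A - dnem B) := by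
    ext V
    simp only [nonlocalDeriv_apply, sub_apply, add_apply, ContinuousLinearMap.comp_apply, map_sub]
    ring
  rw [e]
  calc _ ≤ ‖(rieszForm N α (nem A - nem B)).comp (dnem A)‖
          + ‖(rieszForm N α (nem B)).comp (dnem A - dnem B)‖ := norm_add_le _ _
    _ ≤ (‖rieszForm N α‖ * ‖nem A - nem B‖) * ‖dnem A‖
          + (‖rieszForm N α‖ * ‖nem B‖) * ‖dnem A - dnem B‖ := by
        gcongr <;> refine (ContinuousLinearMap.opNorm_comp_le _ _).trans ?_ <;> gcongr <;>
          exact ContinuousLinearMap.le_opNorm _ _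
    _ ≤ (‖rieszForm N α‖ * (t * ((M + M) ^ (t - 1) * ‖A - B‖))) * M ^ (t - 1)
          + (‖rieszForm N α‖ * M ^ t) *
            ((t + 1) * (‖A - B‖ ^ holderExp t * (M + M) ^ (t - 1 - holderExp t))) := by
        gcongr
        · exact (norm_nem_sub_le A B).trans (by gcongr)
        · exact (norm_dnem_le A).trans (by gcongr)
        · exact (norm_nem_le B).trans (by gcongr)
        · exact (norm_dnem_sub_le A B).trans (by gcongr)
    _ = _ := by ring

/-- `nonlocalDeriv` is uniformly continuous on bounded sets. -/
theorem exists_norm_nonlocalDeriv_sub_lt (M : ℝ) {ε : ℝ} (hε : 0 < ε) : ∃ δ : ℝ, 0 < δ ∧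
    ∀ A B : NonlocalSpace N α t, ‖A‖ ≤ M → ‖B‖ ≤ M → ‖A - B‖ < δ →
      ‖nonlocalDeriv A - nonlocalDeriv B‖ < ε := by
  have ht' := ht.out
  have hθ := holderExp_pos ht'
  have hlim : Tendsto (fun d : ℝ => ‖rieszForm N α‖ *
      (t * ((M + M) ^ (t - 1) * d) * M ^ (t - 1) +
        M ^ t * ((t + 1) * (d ^ holderExp t * (M + M) ^ (t - 1 - holderExp t))))) (𝓝 0)
      (𝓝 (‖rieszForm N α‖ * (t * ((M + M) ^ (t - 1) * 0) * M ^ (t - 1) +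
        M ^ t * ((t + 1) * (0 ^ holderExp t * (M + M) ^ (t - 1 - holderExp t)))))) := by
    have hd : Tendsto (fun d : ℝ => d) (𝓝 0) (𝓝 0) := tendsto_id
    refine Tendsto.const_mul _ (Tendsto.add ?_ ?_)
    · exact ((hd.const_mul _).const_mul _).mul_const _
    · exact (((hd.rpow_const (Or.inr hθ.le)).mul_const _).const_mul _).const_mul _
  rw [Real.zero_rpow hθ.ne'] at hlim
  simp only [mul_zero, zero_mul, add_zero] at hlim
  obtain ⟨δ, hδ, h⟩ := Metric.eventually_nhds_iff.1 (hlim.eventually (gt_mem_nhds hε))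
  refine ⟨δ, hδ, fun A B hA hB hAB => ?_⟩
  refine (norm_nonlocalDeriv_sub_le hA hB).trans_lt (h ?_)
  simpa using hAB

theorem continuous_nonlocalDeriv :
    Continuous (nonlocalDeriv : NonlocalSpace N α t → (NonlocalSpace N α t →L[ℝ] ℝ)) := by
  rw [Metric.continuous_iff]
  intro B ε hε
  obtain ⟨δ, hδ, h⟩ := exists_norm_nonlocalDeriv_sub_lt (N := N) (α := α) (t := t) (‖B‖ + 1) hε
  refine ⟨min δ 1, by positivity, fun A hAB => ?_⟩
  rw [dist_eq_norm] at hAB ⊢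
  have h1 : ‖A‖ ≤ ‖B‖ + ‖A - B‖ := norm_le_norm_add_norm_sub' A B
  exact h A B (by linarith [lt_min_iff.1 hAB]) (by linarith) (lt_min_iff.1 hAB).1

/-- Functions supported in a ball and outside of a much larger ball do not interact. -/
theorem exists_norm_nonlocalDeriv_add_le (ρ M : ℝ) {ε : ℝ} (hε : 0 < ε) : ∃ R : ℝ, ρ < R ∧
    ∀ U Z : NonlocalSpace N α t, ‖U‖ ≤ M → ‖Z‖ ≤ M →
      ‖nonlocalDeriv (Z - ballCut R Z + ballCut ρ U) - nonlocalDeriv (Z - ballCut R Z)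
        - nonlocalDeriv (ballCut ρ U)‖ ≤ ε := by
  have ht' := ht.out
  set D : ℝ := 2 * (|M| ^ t * |M| ^ (t - 1)) + 1
  have hD : 0 < D := by positivity
  obtain ⟨R, hR, h⟩ := exists_rieszForm_far_le (N := N) (α := α) ρ (div_pos hε hD)
  refine ⟨R, hR, fun U Z hU hZ => ?_⟩
  have hU' : ‖U‖ ≤ |M| := hU.trans (le_abs_self _)
  have hZ' : ‖Z‖ ≤ |M| := hZ.trans (le_abs_self _)
  refine ContinuousLinearMap.opNorm_le_bound _ hε.le fun V => ?_
  have hdis : ∀ᵐ x, (Z - ballCut R Z : NonlocalSpace N α t) x = 0 ∨ ballCut ρ U x = 0 := by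
    filter_upwards [disjoint_or_of_lt hR.le U Z] with x hx using hx.symm
  have e : (nonlocalDeriv (Z - ballCut R Z + ballCut ρ U) - nonlocalDeriv (Z - ballCut R Z)
        - nonlocalDeriv (ballCut ρ U)) V
      = rieszForm N α (ballCut ρ (nem U)) (dnem Z V - ballCut R (dnem Z V))
        + rieszForm N α (ballCut ρ (dnem U V)) (nem Z - ballCut R (nem Z)) := by
    rw [rieszForm_comm (ballCut ρ (dnem U V))]
    simp only [sub_apply, nonlocalDeriv_apply, nem_add_of_disjoint hdis,
      dnem_add_of_disjoint hdis, add_apply, nem_sub_ballCut, nem_ballCut,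
      dnem_ballCut, dnem_sub_ballCut]
    simp only [map_add, add_apply]
    ring
  rw [e, Real.norm_eq_abs]
  have b1 : ‖dnem Z V‖ ≤ |M| ^ (t - 1) * ‖V‖ :=
    ((dnem Z).le_of_opNorm_le (norm_dnem_le Z) V).trans (by gcongr)
  have b2 : ‖dnem U V‖ ≤ |M| ^ (t - 1) * ‖V‖ :=
    ((dnem U).le_of_opNorm_le (norm_dnem_le U) V).trans (by gcongr)
  have b3 : ‖nem U‖ ≤ |M| ^ t := (norm_nem_le U).trans (by gcongr)
  have b4 : ‖nem Z‖ ≤ |M| ^ t := (norm_nem_le Z).trans (by gcongr)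
  calc _ ≤ ε / D * (‖nem U‖ * ‖dnem Z V‖) + ε / D * (‖dnem U V‖ * ‖nem Z‖) :=
        (abs_add_le _ _).trans (add_le_add (h _ _) (h _ _))
    _ ≤ ε / D * (|M| ^ t * (|M| ^ (t - 1) * ‖V‖)) + ε / D * (|M| ^ (t - 1) * ‖V‖ * |M| ^ t) := by
        gcongr
    _ = ε * ‖V‖ * ((D - 1) / D) := by
        simp only [D]
        ring
    _ ≤ ε * ‖V‖ * 1 := by
        gcongr
        rw [div_le_one hD]
        linarith
    _ = _ := mul_one _

/-- Splitting of `nonlocalDeriv` along a bounded sequence that vanishes locally. -/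
theorem tendsto_nonlocalDeriv_add_sub {Z : ℕ → NonlocalSpace N α t} {M : ℝ}
    (hZ : ∀ n, ‖Z n‖ ≤ M) (hloc : ∀ R : ℝ, Tendsto (fun n => ballCut R (Z n)) atTop (𝓝 0))
    (U : NonlocalSpace N α t) :
    Tendsto (fun n => nonlocalDeriv (Z n + U) - nonlocalDeriv (Z n) - nonlocalDeriv U)
      atTop (𝓝 0) := by
  have hM : 0 ≤ M := (norm_nonneg _).trans (hZ 0)
  rw [tendsto_zero_iff_norm_tendsto_zero, Metric.tendsto_atTop]
  intro ε hε
  obtain ⟨δ, hδ, hu⟩ := exists_norm_nonlocalDeriv_sub_lt (N := N) (α := α) (t := t) (M + ‖U‖)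
    (by positivity : 0 < ε / 4)
  have hUlim := (tendsto_iff_norm_sub_tendsto_zero.1 (tendsto_ballCut nemExp_ne_top U)).eventually
    (gt_mem_nhds (by positivity : 0 < δ / 2))
  obtain ⟨ρ, hρ⟩ := hUlim.exists
  obtain ⟨R, hρR, hfar⟩ := exists_norm_nonlocalDeriv_add_le (N := N) (α := α) (t := t) ρ (M + ‖U‖)
    (by positivity : 0 < ε / 4)
  have hZlim := (tendsto_zero_iff_norm_tendsto_zero.1 (hloc R)).eventually
    (gt_mem_nhds (by positivity : 0 < δ / 2))
  obtain ⟨n₀, hn₀⟩ := eventually_atTop.1 hZlim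
  refine ⟨n₀, fun n hn => ?_⟩
  rw [Real.dist_eq, sub_zero, abs_norm]
  set Z' := Z n - ballCut R (Z n) with hZ'
  set U' := ballCut ρ U with hU'
  have hU0 := norm_nonneg U
  have nZ : ‖Z n‖ ≤ M + ‖U‖ := (hZ n).trans (by linarith)
  have nZ' : ‖Z'‖ ≤ M := (norm_sub_ballCut_le R (Z n)).trans (hZ n)
  have nU' : ‖U'‖ ≤ ‖U‖ := norm_ballCut_le ρ U
  have dZ : ‖Z n - Z'‖ < δ / 2 := by
    rw [hZ', sub_sub_cancel]
    exact hn₀ n hn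
  have dU : ‖U - U'‖ < δ / 2 := by
    rw [norm_sub_rev]
    exact hρ
  have h1 : ‖nonlocalDeriv (Z n + U) - nonlocalDeriv (Z' + U')‖ < ε / 4 := by
    refine hu _ _ ((norm_add_le _ _).trans (by linarith [hZ n]))
      ((norm_add_le _ _).trans (by linarith)) ?_
    calc ‖Z n + U - (Z' + U')‖ = ‖(Z n - Z') + (U - U')‖ := by congr 1; abel
      _ ≤ _ := norm_add_le _ _
      _ < δ := by linarith
  have h2 : ‖nonlocalDeriv (Z n) - nonlocalDeriv Z'‖ < ε / 4 :=
    hu _ _ nZ (by linarith) (by linarith)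
  have h3 : ‖nonlocalDeriv U - nonlocalDeriv U'‖ < ε / 4 :=
    hu _ _ (by linarith) (by linarith) (by linarith)
  have h4 : ‖nonlocalDeriv (Z' + U') - nonlocalDeriv Z' - nonlocalDeriv U'‖ ≤ ε / 4 :=
    hfar U (Z n) (by linarith) nZ
  calc ‖nonlocalDeriv (Z n + U) - nonlocalDeriv (Z n) - nonlocalDeriv U‖
      = ‖(nonlocalDeriv (Z n + U) - nonlocalDeriv (Z' + U'))
        - (nonlocalDeriv (Z n) - nonlocalDeriv Z') - (nonlocalDeriv U - nonlocalDeriv U')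
        + (nonlocalDeriv (Z' + U') - nonlocalDeriv Z' - nonlocalDeriv U')‖ := by
        congr 1
        abel
    _ ≤ ‖nonlocalDeriv (Z n + U) - nonlocalDeriv (Z' + U')‖
        + ‖nonlocalDeriv (Z n) - nonlocalDeriv Z'‖ + ‖nonlocalDeriv U - nonlocalDeriv U'‖
        + ‖nonlocalDeriv (Z' + U') - nonlocalDeriv Z' - nonlocalDeriv U'‖ := by
        refine (norm_add_le _ _).trans (add_le_add_left ?_ _)
        refine (norm_sub_le _ _).trans (add_le_add_left ?_ _)
        exact norm_sub_le _ _
    _ < ε := by linarith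

theorem tendsto_nonlocalDeriv_apply_of_ballCut {Z : ℕ → NonlocalSpace N α t} {M : ℝ}
    (hZ : ∀ n, ‖Z n‖ ≤ M) (hloc : ∀ R : ℝ, Tendsto (fun n => ballCut R (Z n)) atTop (𝓝 0))
    (V : NonlocalSpace N α t) : Tendsto (fun n => nonlocalDeriv (Z n) V) atTop (𝓝 0) := by
  have ht' := ht.out
  have hM : 0 ≤ M := (norm_nonneg _).trans (hZ 0)
  set D : ℝ := ‖rieszForm N α‖ * (M ^ t * M ^ (t - 1)) + 1
  have hD : 0 < D := by positivity
  rw [Metric.tendsto_atTop]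
  intro ε hε
  have hVlim := (tendsto_iff_norm_sub_tendsto_zero.1 (tendsto_ballCut nemExp_ne_top V)).eventually
    (gt_mem_nhds (by positivity : 0 < ε / (2 * D)))
  obtain ⟨ρ, hρ⟩ := hVlim.exists
  have hZlim : Tendsto (fun n => ‖rieszForm N α‖ * M ^ t * (‖ballCut ρ (Z n)‖ ^ (t - 1) * ‖V‖))
      atTop (𝓝 (‖rieszForm N α‖ * M ^ t * (0 ^ (t - 1) * ‖V‖))) :=
    (((tendsto_zero_iff_norm_tendsto_zero.1 (hloc ρ)).rpow_const
      (Or.inr (by linarith))).mul_const _).const_mul _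
  rw [Real.zero_rpow (by linarith), zero_mul, mul_zero] at hZlim
  obtain ⟨n₀, hn₀⟩ := eventually_atTop.1 (hZlim.eventually (gt_mem_nhds (half_pos hε)))
  refine ⟨n₀, fun n hn => ?_⟩
  rw [Real.dist_eq, sub_zero]
  have h1 : |nonlocalDeriv (Z n) (ballCut ρ V)| < ε / 2 := by
    refine lt_of_le_of_lt ?_ (hn₀ n hn)
    rw [nonlocalDeriv_apply, dnem_apply_ballCut]
    calc _ ≤ ‖rieszForm N α‖ * ‖nem (Z n)‖ * ‖dnem (ballCut ρ (Z n)) V‖ :=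
          ContinuousLinearMap.le_opNorm₂ _ _ _
      _ ≤ ‖rieszForm N α‖ * M ^ t * (‖ballCut ρ (Z n)‖ ^ (t - 1) * ‖V‖) := by
          gcongr
          · exact (norm_nem_le _).trans (by gcongr; exact hZ n)
          · exact (dnem (ballCut ρ (Z n))).le_of_opNorm_le (norm_dnem_le _) V
  have h2 : |nonlocalDeriv (Z n) (V - ballCut ρ V)| ≤ ε / 2 := by
    have hb : ‖nonlocalDeriv (Z n)‖ ≤ D := by
      refine (norm_nonlocalDeriv_le _).trans ?_
      have : ‖rieszForm N α‖ * (‖Z n‖ ^ t * ‖Z n‖ ^ (t - 1))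
          ≤ ‖rieszForm N α‖ * (M ^ t * M ^ (t - 1)) := by
        gcongr <;> exact hZ n
      simp only [D]
      linarith
    calc |nonlocalDeriv (Z n) (V - ballCut ρ V)| ≤ D * ‖V - ballCut ρ V‖ :=
          (nonlocalDeriv (Z n)).le_of_opNorm_le hb _
      _ ≤ D * (ε / (2 * D)) := by
          gcongr
          rw [norm_sub_rev]
          exact hρ.le
      _ = ε / 2 := by field_simp
  have e : nonlocalDeriv (Z n) V
      = nonlocalDeriv (Z n) (ballCut ρ V) + nonlocalDeriv (Z n) (V - ballCut ρ V) := by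
    rw [← map_add, add_sub_cancel]
  rw [e]
  exact (abs_add_le _ _).trans_lt (by linarith)

end NonlocalForm

section HilbertWeak

variable {H : Type*} [NormedAddCommGroup H] [InnerProductSpace ℝ H] [CompleteSpace H]

/-- Bounded sequences in a separable Hilbert space have weakly convergent subsequences. -/
theorem exists_weak_subseq [TopologicalSpace.SeparableSpace H] {u : ℕ → H} {M : ℝ}
    (hu : ∀ n, ‖u n‖ ≤ M) : ∃ (v : H) (σ : ℕ → ℕ), StrictMono σ ∧
      ∀ w : H, Tendsto (fun n => ⟪u (σ n), w⟫) atTop (𝓝 ⟪v, w⟫) := by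
  set d := TopologicalSpace.denseSeq H
  have hM : 0 ≤ M := (norm_nonneg _).trans (hu 0)
  have hcomp : IsCompact (Set.pi Set.univ fun k : ℕ => Set.Icc (-(M * ‖d k‖)) (M * ‖d k‖)) :=
    isCompact_univ_pi fun _ => isCompact_Icc
  have hmem : ∀ n, (fun k => ⟪u n, d k⟫) ∈
      Set.pi Set.univ fun k : ℕ => Set.Icc (-(M * ‖d k‖)) (M * ‖d k‖) := by
    intro n k _
    have h1 : |⟪u n, d k⟫| ≤ M * ‖d k‖ :=
      (abs_real_inner_le_norm _ _).trans (by gcongr; exact hu n)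
    exact abs_le.1 h1
  obtain ⟨a, -, σ, hσ, hlim⟩ := hcomp.tendsto_subseq hmem
  rw [tendsto_pi_nhds] at hlim
  have hcauchy : ∀ w : H, CauchySeq fun n => ⟪u (σ n), w⟫ := by
    intro w
    rw [Metric.cauchySeq_iff']
    intro ε hε
    obtain ⟨k, hk⟩ := (TopologicalSpace.denseRange_denseSeq H).exists_dist_lt w
      (by positivity : 0 < ε / (4 * (M + 1)))
    obtain ⟨n₀, hn₀⟩ := Metric.cauchySeq_iff'.1 (hlim k).cauchySeq (ε / 2) (half_pos hε)
    refine ⟨n₀, fun n hn => ?_⟩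
    have h1 := hn₀ n hn
    simp only [Function.comp_apply, Real.dist_eq] at h1 ⊢
    have h2 : ∀ n, |⟪u (σ n), w - d k⟫| ≤ ε / 4 := by
      intro n
      refine (abs_real_inner_le_norm _ _).trans ?_
      rw [dist_eq_norm] at hk
      calc ‖u (σ n)‖ * ‖w - d k‖ ≤ (M + 1) * (ε / (4 * (M + 1))) := by
            gcongr
            exact (hu _).trans (by linarith)
        _ = ε / 4 := by field_simp
    have e : ⟪u (σ n), w⟫ - ⟪u (σ n₀), w⟫ = ⟪u (σ n), w - d k⟫ - ⟪u (σ n₀), w - d k⟫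
        + (⟪u (σ n), d k⟫ - ⟪u (σ n₀), d k⟫) := by
      simp only [inner_sub_right]
      ring
    rw [e]
    calc _ ≤ |⟪u (σ n), w - d k⟫| + |⟪u (σ n₀), w - d k⟫| + |⟪u (σ n), d k⟫ - ⟪u (σ n₀), d k⟫| :=
          (abs_add_le _ _).trans (add_le_add_left (abs_sub _ _) _)
      _ < ε / 4 + ε / 4 + ε / 2 := add_lt_add_of_le_of_lt (add_le_add (h2 n) (h2 n₀)) h1
      _ = ε := by ring
  choose ℓ hℓ using fun w => cauchySeq_tendsto_of_complete (hcauchy w)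
  let L : H →ₗ[ℝ] ℝ :=
    { toFun := ℓ
      map_add' := fun w w' => by
        refine tendsto_nhds_unique (hℓ (w + w')) ?_
        simpa only [inner_add_right] using (hℓ w).add (hℓ w')
      map_smul' := fun c w => by
        refine tendsto_nhds_unique (hℓ (c • w)) ?_
        simpa only [real_inner_smul_right, RingHom.id_apply, smul_eq_mul] using (hℓ w).const_mul c }
  have hL : ∀ w, ‖L w‖ ≤ M * ‖w‖ := by
    intro w
    refine le_of_tendsto (hℓ w).norm (Eventually.of_forall fun n => ?_)
    exact (norm_inner_le_norm _ _).trans (by gcongr; exact hu _)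
  refine ⟨(InnerProductSpace.toDual ℝ H).symm (L.mkContinuous M hL), σ, hσ, fun w => ?_⟩
  rw [InnerProductSpace.toDual_symm_apply]
  exact hℓ w

end HilbertWeak

section Sobolev

variable {N : ℕ}

instance : Fact ((2 : ENNReal) ≠ ⊤) := ⟨by simp⟩

theorem isClosed_isWeakGradient {φ : RN N → ℝ} (h : ContDiff ℝ ∞ φ) (hc : HasCompactSupport φ)
    (e : RN N) : IsClosed {w : L2Pair N | ∫ x, w.fst x * fderiv ℝ φ x e
      = - ∫ x, ⟪w.snd x, e⟫ * φ x} := by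
  set a : Lp ℝ 2 (volume : Measure (RN N)) := (memLp_test_fderiv h hc e).toLp _
  have hφe : MemLp (fun x => φ x • e) 2 (volume : Measure (RN N)) :=
    (h.continuous.smul continuous_const).memLp_of_hasCompactSupport hc.smul_right
  set b : Lp (RN N) 2 (volume : Measure (RN N)) := hφe.toLp _
  have h1 : ∀ w : L2Pair N, ∫ x, w.fst x * fderiv ℝ φ x e = ⟪a, w.fst⟫ := by
    intro w
    rw [L2.inner_def]
    refine integral_congr_ae ?_
    filter_upwards [(memLp_test_fderiv h hc e).coeFn_toLp] with x hx
    rw [hx]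
    simp
  have h2 : ∀ w : L2Pair N, ∫ x, ⟪w.snd x, e⟫ * φ x = ⟪b, w.snd⟫ := by
    intro w
    rw [L2.inner_def]
    refine integral_congr_ae ?_
    filter_upwards [hφe.coeFn_toLp] with x hx
    rw [hx, real_inner_smul_left, real_inner_comm, mul_comm]
  simp only [h1, h2]
  exact isClosed_eq (continuous_const.inner (WithLp.prod_continuous_ofLp 2 _ _).fst)
    (continuous_const.inner (WithLp.prod_continuous_ofLp 2 _ _).snd).neg

instance : CompleteSpace (H1 N) := by
  suffices h : IsClosed (sobolevSubspace N : Set (L2Pair N)) from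
    completeSpace_coe_iff_isComplete.2 h.isComplete
  have : (sobolevSubspace N : Set (L2Pair N)) = ⋂ (φ : RN N → ℝ) (_ : ContDiff ℝ ∞ φ)
      (_ : HasCompactSupport φ) (e : RN N), {w : L2Pair N | ∫ x, w.fst x * fderiv ℝ φ x e
      = - ∫ x, ⟪w.snd x, e⟫ * φ x} := by
    ext w
    simp only [Set.mem_iInter]
    rfl
  rw [this]
  exact isClosed_iInter fun φ => isClosed_iInter fun h => isClosed_iInter fun hc =>
    isClosed_iInter fun e => isClosed_isWeakGradient h hc e

instance : TopologicalSpace.SeparableSpace (H1 N) := by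
  have h1 : SecondCountableTopology (Lp ℝ 2 (volume : Measure (RN N))) := inferInstance
  have h2 : SecondCountableTopology (Lp (RN N) 2 (volume : Measure (RN N))) := inferInstance
  have : SecondCountableTopology (L2Pair N) :=
    (WithLp.homeomorphProd 2 (Lp ℝ 2 (volume : Measure (RN N)))
      (Lp (RN N) 2 (volume : Measure (RN N)))).secondCountableTopology
  infer_instance

theorem weakTendsto_iff {u : ℕ → H1 N} {v : H1 N} :
    WeakTendsto u v ↔ ∀ w : H1 N, Tendsto (fun n => ⟪u n, w⟫) atTop (𝓝 ⟪v, w⟫) := by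
  constructor
  · intro h w
    simpa [real_inner_comm] using h (innerSL ℝ w)
  · intro h f
    have hf : ∀ w, f w = ⟪w, (InnerProductSpace.toDual ℝ (H1 N)).symm f⟫ := fun w => by
      rw [real_inner_comm, InnerProductSpace.toDual_symm_apply]
    simpa only [← hf] using h ((InnerProductSpace.toDual ℝ (H1 N)).symm f)

theorem exists_weakTendsto_subseq {u : ℕ → H1 N} {M : ℝ} (hu : ∀ n, ‖u n‖ ≤ M) :
    ∃ (v : H1 N) (σ : ℕ → ℕ), StrictMono σ ∧ WeakTendsto (fun n => u (σ n)) v := by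
  obtain ⟨v, σ, hσ, h⟩ := exists_weak_subseq hu
  exact ⟨v, σ, hσ, weakTendsto_iff.2 h⟩

theorem WeakTendsto.comp {u : ℕ → H1 N} {v : H1 N} (h : WeakTendsto u v) {σ : ℕ → ℕ}
    (hσ : Tendsto σ atTop atTop) : WeakTendsto (fun n => u (σ n)) v :=
  fun f => (h f).comp hσ

theorem WeakTendsto.sub {u u' : ℕ → H1 N} {v v' : H1 N} (h : WeakTendsto u v)
    (h' : WeakTendsto u' v') : WeakTendsto (fun n => u n - u' n) (v - v') := by
  intro f
  simpa using (h f).sub (h' f)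

theorem WeakTendsto.add {u u' : ℕ → H1 N} {v v' : H1 N} (h : WeakTendsto u v)
    (h' : WeakTendsto u' v') : WeakTendsto (fun n => u n + u' n) (v + v') := by
  intro f
  simpa using (h f).add (h' f)

theorem weakTendsto_of_tendsto {u : ℕ → H1 N} {v : H1 N} (h : Tendsto u atTop (𝓝 v)) :
    WeakTendsto u v := fun f => (f.continuous.tendsto v).comp h

theorem WeakTendsto.unique {u : ℕ → H1 N} {v w : H1 N} (hv : WeakTendsto u v)
    (hw : WeakTendsto u w) : v = w := by
  rw [← sub_eq_zero, ← inner_self_eq_zero (𝕜 := ℝ), inner_sub_left, sub_eq_zero]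
  exact tendsto_nhds_unique (weakTendsto_iff.1 hv _) (weakTendsto_iff.1 hw _)

/-- Translation as a linear isometry of `H¹`. -/
noncomputable def translateₗᵢ (y : RN N) : H1 N →ₗᵢ[ℝ] H1 N where
  toFun := H1.translate y
  map_add' u v := by
    refine Subtype.ext ((WithLp.ofLp_injective 2) (Prod.ext ?_ ?_))
    · exact map_add (Lp.compMeasurePreserving (fun x => x + y) (measurePreserving_shift y))
        (u : L2Pair N).fst (v : L2Pair N).fst
    · exact map_add (Lp.compMeasurePreserving (fun x => x + y) (measurePreserving_shift y))
        (u : L2Pair N).snd (v : L2Pair N).snd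
  map_smul' c u := by
    refine Subtype.ext ((WithLp.ofLp_injective 2) (Prod.ext ?_ ?_))
    · exact map_smul (Lp.compMeasurePreservingₗ ℝ (fun x => x + y) (measurePreserving_shift y))
        c (u : L2Pair N).fst
    · exact map_smul (Lp.compMeasurePreservingₗ ℝ (fun x => x + y) (measurePreserving_shift y))
        c (u : L2Pair N).snd
  norm_map' u := by
    have h1 : ‖(u.translate y : L2Pair N).fst‖ = ‖(u : L2Pair N).fst‖ :=
      Lp.norm_compMeasurePreserving _ _
    have h2 : ‖(u.translate y : L2Pair N).snd‖ = ‖(u : L2Pair N).snd‖ :=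
      Lp.norm_compMeasurePreserving _ _
    change ‖(u.translate y : L2Pair N)‖ = ‖(u : L2Pair N)‖
    rw [WithLp.prod_norm_eq_of_L2, WithLp.prod_norm_eq_of_L2, h1, h2]

theorem translateₗᵢ_apply (y : RN N) (u : H1 N) : translateₗᵢ y u = u.translate y := rfl

theorem norm_translate (y : RN N) (u : H1 N) : ‖u.translate y‖ = ‖u‖ :=
  (translateₗᵢ y).norm_map u

theorem translate_sub (y : RN N) (u v : H1 N) :
    (u - v).translate y = u.translate y - v.translate y := (translateₗᵢ y).map_sub u v

theorem H1.ext_ae {u v : H1 N} (h1 : u.fn =ᵐ[volume] v.fn) (h2 : u.grad =ᵐ[volume] v.grad) :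
    u = v :=
  Subtype.ext ((WithLp.ofLp_injective 2) (Prod.ext (Lp.ext h1) (Lp.ext h2)))

theorem ae_shift {p : RN N → Prop} (h : ∀ᵐ x, p x) (y : RN N) : ∀ᵐ x, p (x + y) :=
  (measurePreserving_shift y).quasiMeasurePreserving.ae h

theorem translate_translate (y z : RN N) (u : H1 N) :
    (u.translate y).translate z = u.translate (z + y) := by
  refine H1.ext_ae ?_ ?_
  · filter_upwards [(u.translate y).translate_fn z, u.translate_fn (z + y),
      ae_shift (u.translate_fn y) z] with x h1 h2 h3
    rw [h1, h2, h3, add_assoc]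
  · filter_upwards [(u.translate y).translate_grad z, u.translate_grad (z + y),
      ae_shift (u.translate_grad y) z] with x h1 h2 h3
    rw [h1, h2, h3, add_assoc]

theorem translate_zero (u : H1 N) : u.translate 0 = u := by
  refine H1.ext_ae ?_ ?_
  · filter_upwards [u.translate_fn 0] with x h
    rw [h, add_zero]
  · filter_upwards [u.translate_grad 0] with x h
    rw [h, add_zero]

theorem translate_neg_translate (y : RN N) (u : H1 N) :
    (u.translate y).translate (-y) = u := by
  rw [translate_translate, neg_add_cancel, translate_zero]

theorem translate_translate_neg (y : RN N) (u : H1 N) :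
    (u.translate (-y)).translate y = u := by
  rw [translate_translate, add_neg_cancel, translate_zero]

theorem inner_translate (y : RN N) (u v : H1 N) :
    ⟪u.translate y, v⟫ = ⟪u, v.translate (-y)⟫ := by
  conv_lhs => rw [← translate_translate_neg y v]
  exact (translateₗᵢ y).inner_map_map u _

theorem tendsto_translate {y : ℕ → RN N} {z : RN N} (hy : Tendsto y atTop (𝓝 z)) (u : H1 N) :
    Tendsto (fun n => u.translate (y n)) atTop (𝓝 (u.translate z)) := by
  let g : RN N → C(RN N, RN N) := fun z => ⟨fun x => x + z, by fun_prop⟩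
  have hg : Continuous g :=
    (ContinuousMap.curry ⟨fun p : RN N × RN N => p.2 + p.1, by fun_prop⟩).continuous
  have hg' : Tendsto (fun n => g (y n)) atTop (𝓝 (g z)) := (hg.tendsto z).comp hy
  have h1 : Tendsto (fun n => (u.translate (y n) : L2Pair N).fst) atTop
      (𝓝 (u.translate z : L2Pair N).fst) :=
    Filter.Tendsto.compMeasurePreservingLp (tendsto_const_nhds (x := (u : L2Pair N).fst)) hg'
      (fun n => measurePreserving_shift (y n)) (measurePreserving_shift z) (by simp)
  have h2 : Tendsto (fun n => (u.translate (y n) : L2Pair N).snd) atTop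
      (𝓝 (u.translate z : L2Pair N).snd) :=
    Filter.Tendsto.compMeasurePreservingLp (tendsto_const_nhds (x := (u : L2Pair N).snd)) hg'
      (fun n => measurePreserving_shift (y n)) (measurePreserving_shift z) (by simp)
  rw [tendsto_subtype_rng]
  exact ((WithLp.prod_continuous_toLp 2 _ _).tendsto _).comp (h1.prodMk_nhds h2)

end Sobolev

section Jensen

theorem lintegral_rpow_le_lintegral_rpow {Ω : Type*} [MeasurableSpace Ω] {ν : Measure Ω}
    [IsProbabilityMeasure ν] {G : Ω → ENNReal} (hG : AEMeasurable G ν) {p : ℝ} (hp : 1 ≤ p) :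
    (∫⁻ x, G x ∂ν) ^ p ≤ ∫⁻ x, G x ^ p ∂ν := by
  have hp0 : 0 < p := by linarith
  have h := ENNReal.lintegral_mul_norm_pow_le (μ := ν) (hG.pow_const p)
    (aemeasurable_const (b := (1 : ENNReal))) (p := 1 / p) (q := 1 - 1 / p) (by positivity)
    (by rw [sub_nonneg, div_le_one hp0]; exact hp) (by ring)
  simp only [ENNReal.one_rpow, mul_one, lintegral_const, measure_univ, ← ENNReal.rpow_mul] at h
  have e : p * (1 / p) = 1 := by field_simp
  simp only [e, ENNReal.rpow_one] at h
  calc (∫⁻ x, G x ∂ν) ^ p ≤ ((∫⁻ x, G x ^ p ∂ν) ^ (1 / p)) ^ p := by gcongr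
    _ = _ := by rw [← ENNReal.rpow_mul, mul_comm, e, ENNReal.rpow_one]

theorem tendsto_eLpNorm_of_dominated {Ω E : Type*} [MeasurableSpace Ω] {ν : Measure Ω}
    [NormedAddCommGroup E] {p : ENNReal} (hp0 : p ≠ 0) (hpT : p ≠ ⊤) {f : ℕ → Ω → E} {g : Ω → ℝ}
    (hf : ∀ n, AEStronglyMeasurable (f n) ν) (hg : MemLp g p ν)
    (hle : ∀ n, ∀ᵐ x ∂ν, ‖f n x‖ ≤ g x) (hlim : ∀ᵐ x ∂ν, Tendsto (fun n => f n x) atTop (𝓝 0)) :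
    Tendsto (fun n => eLpNorm (f n) p ν) atTop (𝓝 0) := by
  have hpr : 0 < p.toReal := ENNReal.toReal_pos hp0 hpT
  have h2 : Tendsto (fun n => ∫⁻ x, ‖f n x‖ₑ ^ p.toReal ∂ν) atTop (𝓝 (∫⁻ _, 0 ∂ν)) := by
    refine tendsto_lintegral_of_dominated_convergence' (fun x => ‖g x‖ₑ ^ p.toReal)
      (fun n => (hf n).enorm.pow_const _) (fun n => ?_) ?_ ?_
    · filter_upwards [hle n] with x hx
      gcongr
      rw [enorm_le_iff_norm_le]
      exact hx.trans (le_abs_self _)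
    · exact (lintegral_rpow_enorm_lt_top_of_eLpNorm_lt_top hp0 hpT hg.2).ne
    · filter_upwards [hlim] with x hx
      have := (ENNReal.continuous_rpow_const (y := p.toReal)).tendsto (0 : ENNReal)
      rw [ENNReal.zero_rpow_of_pos hpr] at this
      refine this.comp ?_
      simpa using hx.enorm
  rw [lintegral_zero] at h2
  have h3 := ((ENNReal.continuous_rpow_const (y := 1 / p.toReal)).tendsto (0 : ENNReal)).comp h2
  rw [ENNReal.zero_rpow_of_pos (by positivity)] at h3
  refine h3.congr fun n => ?_
  rw [eLpNorm_eq_lintegral_rpow_enorm_toReal hp0 hpT]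
  rfl

end Jensen

section Mollify

variable {N : ℕ} {F : Type*} [NormedAddCommGroup F] [NormedSpace ℝ F]

/-- The mollification of `f` by a normalized bump function. -/
noncomputable def mollify (ρ : ContDiffBump (0 : RN N)) (f : RN N → F) (x : RN N) : F :=
  ∫ h, ρ.normed volume h • f (x - h)

theorem mollify_eq_convolution (ρ : ContDiffBump (0 : RN N)) (f : RN N → F) :
    mollify ρ f = convolution (ρ.normed volume) f (ContinuousLinearMap.lsmul ℝ ℝ) volume := by
  ext x
  rw [convolution_lsmul, mollify]

theorem mollify_eq_swap (ρ : ContDiffBump (0 : RN N)) (f : RN N → F) (x : RN N) :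
    mollify ρ f x = ∫ y, ρ.normed volume (x - y) • f y := by
  rw [mollify_eq_convolution, convolution_eq_swap]
  rfl

theorem mollify_congr {ρ : ContDiffBump (0 : RN N)} {f g : RN N → F} (h : f =ᵐ[volume] g) :
    mollify ρ f = mollify ρ g := by
  ext x
  rw [mollify_eq_swap, mollify_eq_swap]
  refine integral_congr_ae ?_
  filter_upwards [h] with y hy
  rw [hy]

theorem integrable_mollify (ρ : ContDiffBump (0 : RN N)) {f : RN N → F}
    (hf : LocallyIntegrable f volume) (x : RN N) :
    Integrable fun h => ρ.normed volume h • f (x - h) :=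
  ρ.hasCompactSupport_normed.convolutionExists_left (ContinuousLinearMap.lsmul ℝ ℝ)
    ρ.continuous_normed hf x

theorem contDiff_mollify [CompleteSpace F] (ρ : ContDiffBump (0 : RN N)) {f : RN N → F}
    (hf : LocallyIntegrable f volume) : ContDiff ℝ ∞ (mollify ρ f) := by
  rw [mollify_eq_convolution]
  exact ρ.hasCompactSupport_normed.contDiff_convolution_left _ (n := ⊤) ρ.contDiff_normed hf

theorem mollify_sub_self (ρ : ContDiffBump (0 : RN N)) [CompleteSpace F] {f : RN N → F}
    (hf : LocallyIntegrable f volume) (x : RN N) :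
    mollify ρ f x - f x = ∫ h, ρ.normed volume h • (f (x - h) - f x) := by
  simp only [smul_sub]
  rw [integral_sub (integrable_mollify ρ hf x) (ρ.integrable_normed.smul_const _),
    integral_smul_const, ρ.integral_normed, one_smul]
  rfl

/-- The probability measure with density a normalized bump function. -/
noncomputable def bumpMeasure (ρ : ContDiffBump (0 : RN N)) : Measure (RN N) :=
  volume.withDensity fun h => ENNReal.ofReal (ρ.normed volume h)

theorem measurable_ofReal_normed (ρ : ContDiffBump (0 : RN N)) :
    Measurable fun h => ENNReal.ofReal (ρ.normed volume h) :=
  ρ.continuous_normed.measurable.ennreal_ofReal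

instance (ρ : ContDiffBump (0 : RN N)) : IsProbabilityMeasure (bumpMeasure ρ) := ⟨by
  rw [bumpMeasure, withDensity_apply _ MeasurableSet.univ, Measure.restrict_univ,
    ← ofReal_integral_eq_lintegral_ofReal ρ.integrable_normed
      (ae_of_all _ fun x => ρ.nonneg_normed x), ρ.integral_normed, ENNReal.ofReal_one]⟩

theorem lintegral_integral_normed_smul_le (ρ : ContDiffBump (0 : RN N)) {G : RN N → RN N → F}
    (hG : StronglyMeasurable (Function.uncurry G)) {p : ℝ} (hp : 1 ≤ p) {B : ENNReal}
    (hB : ∀ h ∈ Metric.ball (0 : RN N) ρ.rOut, ∫⁻ x, ‖G x h‖ₑ ^ p ≤ B) :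
    ∫⁻ x, ‖∫ h, ρ.normed volume h • G x h‖ₑ ^ p ≤ B := by
  have hGx : ∀ x, Measurable fun h => ‖G x h‖ₑ := fun x =>
    (hG.comp_measurable measurable_prodMk_left).enorm
  have hm : Measurable fun z : RN N × RN N => ‖G z.1 z.2‖ₑ ^ p := (hG.enorm).pow_const p
  have hae : ∀ᵐ h ∂(bumpMeasure ρ), h ∈ Metric.ball (0 : RN N) ρ.rOut := by
    rw [bumpMeasure, ae_withDensity_iff (measurable_ofReal_normed ρ)]
    refine ae_of_all _ fun h hh => ?_
    rw [← ρ.support_normed_eq (μ := volume)]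
    intro h0
    exact hh (by rw [h0, ENNReal.ofReal_zero])
  calc ∫⁻ x, ‖∫ h, ρ.normed volume h • G x h‖ₑ ^ p
      ≤ ∫⁻ x, (∫⁻ h, ‖G x h‖ₑ ∂(bumpMeasure ρ)) ^ p := by
        refine lintegral_mono fun x => ?_
        gcongr
        rw [bumpMeasure, lintegral_withDensity_eq_lintegral_mul _ (measurable_ofReal_normed ρ)
          (hGx x)]
        refine (enorm_integral_le_lintegral_enorm _).trans_eq (lintegral_congr fun h => ?_)
        rw [enorm_smul, Real.enorm_eq_ofReal (ρ.nonneg_normed h)]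
        rfl
    _ ≤ ∫⁻ x, ∫⁻ h, ‖G x h‖ₑ ^ p ∂(bumpMeasure ρ) :=
        lintegral_mono fun x => lintegral_rpow_le_lintegral_rpow (hGx x).aemeasurable hp
    _ = ∫⁻ h, (∫⁻ x, ‖G x h‖ₑ ^ p) ∂(bumpMeasure ρ) := lintegral_lintegral_swap hm.aemeasurable
    _ ≤ ∫⁻ _, B ∂(bumpMeasure ρ) := by
        refine lintegral_mono_ae ?_
        filter_upwards [hae] with h hh using hB h hh
    _ = B := by simp

omit [NormedSpace ℝ F] in
theorem stronglyMeasurable_comp_sub {f : RN N → F} (hf : StronglyMeasurable f) :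
    StronglyMeasurable (Function.uncurry fun x h => f (x - h)) :=
  hf.comp_measurable (measurable_fst.sub measurable_snd)

theorem eLpNorm_mollify_le (ρ : ContDiffBump (0 : RN N)) {f : RN N → F} (hf : StronglyMeasurable f)
    {p : ENNReal} (hp : 1 ≤ p) (hpT : p ≠ ⊤) :
    eLpNorm (mollify ρ f) p volume ≤ eLpNorm f p volume := by
  have hp0 : p ≠ 0 := (zero_lt_one.trans_le hp).ne'
  have hp1 : 1 ≤ p.toReal := by
    rw [← ENNReal.toReal_one]
    exact ENNReal.toReal_mono hpT hp
  rw [eLpNorm_eq_lintegral_rpow_enorm_toReal hp0 hpT, eLpNorm_eq_lintegral_rpow_enorm_toReal hp0 hpT]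
  gcongr ?_ ^ _
  refine lintegral_integral_normed_smul_le ρ (stronglyMeasurable_comp_sub hf) hp1 fun h _ => ?_
  exact (lintegral_sub_right_eq_self (fun x => ‖f x‖ₑ ^ p.toReal) h).le

theorem eLpNorm_mollify_sub_le [CompleteSpace F] (ρ : ContDiffBump (0 : RN N)) {f : RN N → F}
    (hf : StronglyMeasurable f) {p : ENNReal} (hp : 1 ≤ p) (hpT : p ≠ ⊤)
    (hloc : LocallyIntegrable f volume) {B : ENNReal}
    (hB : ∀ h ∈ Metric.ball (0 : RN N) ρ.rOut,
      eLpNorm (fun x => f (x - h) - f x) p volume ≤ B) :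
    eLpNorm (fun x => mollify ρ f x - f x) p volume ≤ B := by
  have hp0 : p ≠ 0 := (zero_lt_one.trans_le hp).ne'
  have hp1 : 1 ≤ p.toReal := by
    rw [← ENNReal.toReal_one]
    exact ENNReal.toReal_mono hpT hp
  have hpr : 0 < p.toReal := by linarith
  simp only [mollify_sub_self ρ hloc]
  rw [eLpNorm_eq_lintegral_rpow_enorm_toReal hp0 hpT, one_div, ENNReal.rpow_inv_le_iff hpr]
  refine lintegral_integral_normed_smul_le ρ (G := fun x h => f (x - h) - f x)
    ((stronglyMeasurable_comp_sub hf).sub (hf.comp_measurable measurable_fst)) hp1 fun h hh => ?_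
  have := hB h hh
  rwa [eLpNorm_eq_lintegral_rpow_enorm_toReal hp0 hpT, one_div, ENNReal.rpow_inv_le_iff hpr] at this

omit [NormedSpace ℝ F] in
theorem exists_eLpNorm_translate_sub_le {p : ENNReal} [hp : Fact (1 ≤ p)] (hpT : p ≠ ⊤)
    (f : Lp F p (volume : Measure (RN N))) {ε : ℝ} (hε : 0 < ε) : ∃ δ : ℝ, 0 < δ ∧
      ∀ h ∈ Metric.ball (0 : RN N) δ,
        eLpNorm (fun x => f (x - h) - f x) p volume ≤ ENNReal.ofReal ε := by
  let g : RN N → C(RN N, RN N) := fun z => ⟨fun x => x + z, by fun_prop⟩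
  have hg : Continuous g :=
    (ContinuousMap.curry ⟨fun p : RN N × RN N => p.2 + p.1, by fun_prop⟩).continuous
  have hlim : Tendsto (fun z => Lp.compMeasurePreserving (fun x => x + z)
      (measurePreserving_shift z) f) (𝓝 0)
      (𝓝 (Lp.compMeasurePreserving (fun x => x + 0) (measurePreserving_shift 0) f)) :=
    Filter.Tendsto.compMeasurePreservingLp (tendsto_const_nhds (x := f)) (hg.tendsto 0)
      (fun z => measurePreserving_shift z) (measurePreserving_shift 0) hpT
  have h0 : Lp.compMeasurePreserving (fun x => x + 0) (measurePreserving_shift 0) f = f := by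
    refine Lp.ext ?_
    filter_upwards [Lp.coeFn_compMeasurePreserving f (measurePreserving_shift 0)] with x hx
    rw [hx]
    simp
  rw [h0, tendsto_iff_norm_sub_tendsto_zero] at hlim
  obtain ⟨δ, hδ, h⟩ := Metric.eventually_nhds_iff.1 (hlim.eventually (gt_mem_nhds hε))
  refine ⟨δ, hδ, fun z hz => ?_⟩
  have hz' : dist (-z) 0 < δ := by simpa using hz
  have h1 := (h hz').le
  rw [← ENNReal.ofReal_le_ofReal_iff hε.le, ofReal_norm, Lp.enorm_def] at h1
  refine le_of_eq_of_le (eLpNorm_congr_ae ?_) h1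
  filter_upwards [Lp.coeFn_compMeasurePreserving f (measurePreserving_shift (-z)),
    Lp.coeFn_sub (Lp.compMeasurePreserving (fun x => x + -z) (measurePreserving_shift (-z)) f) f]
    with x h2 h3
  rw [h3, Pi.sub_apply, h2, sub_eq_add_neg x z]
  rfl

end Mollify

section TestFunctions

variable {N : ℕ}

theorem inner_gradient (φ : RN N → ℝ) (x e : RN N) : ⟪gradient φ x, e⟫ = fderiv ℝ φ x e := by
  rw [gradient, InnerProductSpace.toDual_symm_apply]

theorem norm_gradient (φ : RN N → ℝ) (x : RN N) : ‖gradient φ x‖ = ‖fderiv ℝ φ x‖ := by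
  rw [gradient, LinearIsometryEquiv.norm_map]

theorem memLp_gradient {φ : RN N → ℝ} (h : ContDiff ℝ ∞ φ) (hc : HasCompactSupport φ)
    {p : ENNReal} : MemLp (gradient φ) p (volume : Measure (RN N)) := by
  have hcont : Continuous (gradient φ) :=
    (InnerProductSpace.toDual ℝ (RN N)).symm.continuous.comp (h.continuous_fderiv (by simp))
  refine hcont.memLp_of_hasCompactSupport ?_
  exact (hc.fderiv ℝ).comp_left (g := (InnerProductSpace.toDual ℝ (RN N)).symm) (map_zero _)

/-- A test function as an element of `H¹`. -/
noncomputable def testH1 (φ : RN N → ℝ) (h : ContDiff ℝ ∞ φ) (hc : HasCompactSupport φ) : H1 N :=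
  ⟨WithLp.toLp 2 ((memLp_test h hc).toLp φ, (memLp_gradient h hc).toLp (gradient φ)), by
    intro ψ hψ hcψ e
    have e1 : ∫ x, ((memLp_test h hc).toLp φ : RN N → ℝ) x * fderiv ℝ ψ x e
        = ∫ x, φ x * fderiv ℝ ψ x e := by
      refine integral_congr_ae ?_
      filter_upwards [(memLp_test h hc).coeFn_toLp] with x hx
      rw [hx]
    have e2 : ∫ x, ⟪((memLp_gradient h hc (p := 2)).toLp (gradient φ) : RN N → RN N) x, e⟫ * ψ x
        = ∫ x, fderiv ℝ φ x e * ψ x := by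
      refine integral_congr_ae ?_
      filter_upwards [(memLp_gradient h hc (p := 2)).coeFn_toLp] with x hx
      rw [hx, inner_gradient]
    refine e1.trans (Eq.trans ?_ (congrArg Neg.neg e2.symm))
    exact integral_mul_fderiv_eq_neg_fderiv_mul_of_integrable
      ((memLp_test_fderiv h hc e).integrable_mul (memLp_test hψ hcψ))
      ((memLp_test h hc).integrable_mul (memLp_test_fderiv hψ hcψ e))
      ((memLp_test h hc).integrable_mul (memLp_test hψ hcψ))
      (fun x _ => h.differentiable (by simp) x) (fun x _ => hψ.differentiable (by simp) x)⟩

theorem testH1_fn {φ : RN N → ℝ} (h : ContDiff ℝ ∞ φ) (hc : HasCompactSupport φ) :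
    (testH1 φ h hc).fn =ᵐ[volume] φ := (memLp_test h hc).coeFn_toLp

theorem testH1_grad {φ : RN N → ℝ} (h : ContDiff ℝ ∞ φ) (hc : HasCompactSupport φ) :
    (testH1 φ h hc).grad =ᵐ[volume] gradient φ := (memLp_gradient h hc).coeFn_toLp

theorem H1.memLp_fn (u : H1 N) : MemLp u.fn 2 volume := Lp.memLp _

theorem H1.memLp_grad (u : H1 N) : MemLp u.grad 2 volume := Lp.memLp _

theorem H1.stronglyMeasurable_fn (u : H1 N) : StronglyMeasurable u.fn := Lp.stronglyMeasurable _

theorem H1.stronglyMeasurable_grad (u : H1 N) : StronglyMeasurable u.grad :=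
  Lp.stronglyMeasurable _

theorem H1.locallyIntegrable_fn (u : H1 N) : LocallyIntegrable u.fn volume :=
  u.memLp_fn.locallyIntegrable (by norm_num)

theorem H1.locallyIntegrable_grad (u : H1 N) : LocallyIntegrable u.grad volume :=
  u.memLp_grad.locallyIntegrable (by norm_num)

theorem H1.enorm_fst (u : H1 N) : ‖(u : L2Pair N).fst‖ₑ = eLpNorm u.fn 2 volume := Lp.enorm_def _

theorem H1.enorm_snd (u : H1 N) : ‖(u : L2Pair N).snd‖ₑ = eLpNorm u.grad 2 volume := Lp.enorm_def _

theorem H1.norm_fst_le (u : H1 N) : ‖(u : L2Pair N).fst‖ ≤ ‖u‖ :=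
  WithLp.norm_fst_le _ (u : L2Pair N)

theorem H1.norm_snd_le (u : H1 N) : ‖(u : L2Pair N).snd‖ ≤ ‖u‖ :=
  WithLp.norm_snd_le _ (u : L2Pair N)

theorem H1.eLpNorm_fn_le (u : H1 N) : eLpNorm u.fn 2 volume ≤ ENNReal.ofReal ‖u‖ := by
  rw [← H1.enorm_fst, ← ofReal_norm]
  exact ENNReal.ofReal_le_ofReal u.norm_fst_le

theorem H1.eLpNorm_grad_le (u : H1 N) : eLpNorm u.grad 2 volume ≤ ENNReal.ofReal ‖u‖ := by
  rw [← H1.enorm_snd, ← ofReal_norm]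
  exact ENNReal.ofReal_le_ofReal u.norm_snd_le

theorem H1.norm_le_add (u : H1 N) : ‖u‖ ≤ ‖(u : L2Pair N).fst‖ + ‖(u : L2Pair N).snd‖ := by
  have h := WithLp.prod_norm_sq_eq_of_L2 (u : L2Pair N)
  have h' : ‖u‖ ^ 2 = ‖(u : L2Pair N).fst‖ ^ 2 + ‖(u : L2Pair N).snd‖ ^ 2 := h
  have h1 := norm_nonneg (u : L2Pair N).fst
  have h2 := norm_nonneg (u : L2Pair N).snd
  refine le_of_sq_le_sq ?_ (by positivity)
  nlinarith

theorem H1.norm_le_of_eLpNorm_le {u : H1 N} {a b : ℝ} (ha : 0 ≤ a) (hb : 0 ≤ b)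
    (h1 : eLpNorm u.fn 2 volume ≤ ENNReal.ofReal a)
    (h2 : eLpNorm u.grad 2 volume ≤ ENNReal.ofReal b) : ‖u‖ ≤ a + b := by
  refine u.norm_le_add.trans (add_le_add ?_ ?_)
  · rwa [← H1.enorm_fst, ← ofReal_norm, ENNReal.ofReal_le_ofReal_iff ha] at h1
  · rwa [← H1.enorm_snd, ← ofReal_norm, ENNReal.ofReal_le_ofReal_iff hb] at h2

theorem H1.sub_fn (u v : H1 N) : (u - v).fn =ᵐ[volume] fun x => u.fn x - v.fn x :=
  Lp.coeFn_sub (u : L2Pair N).fst (v : L2Pair N).fst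

theorem H1.sub_grad (u v : H1 N) : (u - v).grad =ᵐ[volume] fun x => u.grad x - v.grad x :=
  Lp.coeFn_sub (u : L2Pair N).snd (v : L2Pair N).snd

theorem H1.add_fn (u v : H1 N) : (u + v).fn =ᵐ[volume] fun x => u.fn x + v.fn x :=
  Lp.coeFn_add (u : L2Pair N).fst (v : L2Pair N).fst

theorem H1.smul_fn (c : ℝ) (u : H1 N) : (c • u).fn =ᵐ[volume] fun x => c * u.fn x :=
  Lp.coeFn_smul c (u : L2Pair N).fst

theorem gradient_mollify (ρ : ContDiffBump (0 : RN N)) (u : H1 N) (x : RN N) :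
    gradient (mollify ρ u.fn) x = mollify ρ u.grad x := by
  refine ext_inner_right ℝ fun e => ?_
  rw [inner_gradient]
  have hc1 : ContDiff ℝ 1 (ρ.normed (volume : Measure (RN N))) := ρ.contDiff_normed (n := 1)
  have hd := ρ.hasCompactSupport_normed.hasFDerivAt_convolution_left
    (ContinuousLinearMap.lsmul ℝ ℝ) (μ := (volume : Measure (RN N))) hc1 u.locallyIntegrable_fn x
  rw [← mollify_eq_convolution] at hd
  rw [hd.fderiv, convolution_eq_swap]
  have hint : Integrable fun t => (ContinuousLinearMap.precompL (RN N)
      (ContinuousLinearMap.lsmul ℝ ℝ)) (fderiv ℝ (ρ.normed volume) (x - t)) (u.fn t) := by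
    have := (ρ.hasCompactSupport_normed.fderiv ℝ).convolutionExists_left
      (ContinuousLinearMap.precompL (RN N) (ContinuousLinearMap.lsmul ℝ ℝ))
      (μ := (volume : Measure (RN N))) (hc1.continuous_fderiv one_ne_zero)
      u.locallyIntegrable_fn x
    rwa [convolutionExistsAt_iff_integrable_swap] at this
  rw [ContinuousLinearMap.integral_apply hint]
  have hψ : ContDiff ℝ ∞ fun y => ρ.normed (volume : Measure (RN N)) (x - y) :=
    (ρ.contDiff_normed (n := ⊤)).comp (contDiff_const.sub contDiff_id)
  have hψc : HasCompactSupport fun y => ρ.normed (volume : Measure (RN N)) (x - y) :=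
    ρ.hasCompactSupport_normed.comp_homeomorph (Homeomorph.subLeft x)
  have key := u.2 _ hψ hψc e
  have hfd : ∀ y, fderiv ℝ (fun y => ρ.normed (volume : Measure (RN N)) (x - y)) y e
      = - fderiv ℝ (ρ.normed volume) (x - y) e := by
    intro y
    have hd1 : HasFDerivAt (fun y : RN N => x - y) (-ContinuousLinearMap.id ℝ (RN N)) y :=
      (hasFDerivAt_id y).const_sub x
    have hd2 := (hc1.differentiable one_ne_zero (x - y)).hasFDerivAt.comp y hd1
    have e2 : fderiv ℝ (fun y => ρ.normed (volume : Measure (RN N)) (x - y)) y = _ := hd2.fderiv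
    rw [e2]
    simp
  have hR : ⟪mollify ρ u.grad x, e⟫ = ∫ y, ⟪u.grad y, e⟫ * ρ.normed volume (x - y) := by
    have hi : Integrable fun y => ρ.normed volume (x - y) • u.grad y := by
      have := (ρ.hasCompactSupport_normed (μ := volume)).convolutionExists_left
        (ContinuousLinearMap.lsmul ℝ ℝ)
        (μ := (volume : Measure (RN N))) ρ.continuous_normed u.locallyIntegrable_grad x
      rwa [convolutionExistsAt_iff_integrable_swap] at this
    rw [mollify_eq_swap, real_inner_comm, ← integral_inner hi]
    refine integral_congr_ae (ae_of_all _ fun y => ?_)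
    simp only [real_inner_smul_right]
    rw [real_inner_comm]
    ring
  rw [hR]
  have key' : ∫ y, u.fn y * (- fderiv ℝ (ρ.normed volume) (x - y) e)
      = - ∫ y, ⟪u.grad y, e⟫ * ρ.normed volume (x - y) := by
    simp only [hfd] at key
    exact key
  rw [← neg_eq_iff_eq_neg.2 key', ← integral_neg]
  refine integral_congr_ae (ae_of_all _ fun y => ?_)
  simp only [ContinuousLinearMap.precompL_apply, ContinuousLinearMap.lsmul_apply, smul_eq_mul]
  ring

/-- A smooth function which is `1` on the unit ball and supported in the ball of radius two,
rescaled by the factor `R`. -/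
noncomputable def cutoffBump (N : ℕ) (R : ℝ) (x : RN N) : ℝ :=
  (⟨1, 2, one_pos, one_lt_two⟩ : ContDiffBump (0 : RN N)) (R⁻¹ • x)

theorem contDiff_cutoffBump (R : ℝ) : ContDiff ℝ ∞ (cutoffBump N R) :=
  (ContDiffBump.contDiff _).comp (contDiff_const_smul _)

theorem hasCompactSupport_cutoffBump {R : ℝ} (hR : R ≠ 0) : HasCompactSupport (cutoffBump N R) :=
  (ContDiffBump.hasCompactSupport _).comp_smul (inv_ne_zero hR)

theorem cutoffBump_mem_Icc (R : ℝ) (x : RN N) : cutoffBump N R x ∈ Set.Icc (0 : ℝ) 1 :=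
  ⟨ContDiffBump.nonneg _, ContDiffBump.le_one _⟩

theorem cutoffBump_eventuallyEq_one {R : ℝ} {x : RN N} (hx : ‖x‖ < R) :
    cutoffBump N R =ᶠ[𝓝 x] fun _ => 1 := by
  have hR : 0 < R := (norm_nonneg x).trans_lt hx
  have hopen : {y : RN N | ‖y‖ < R} ∈ 𝓝 x := (isOpen_lt continuous_norm continuous_const).mem_nhds hx
  filter_upwards [hopen] with y hy
  refine ContDiffBump.one_of_mem_closedBall _ ?_
  rw [mem_closedBall_zero_iff, norm_smul, norm_inv, Real.norm_of_nonneg hR.le, inv_mul_le_iff₀ hR]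
  have hy' : ‖y‖ < R := hy
  simpa using hy'.le

theorem exists_norm_fderiv_cutoffBump_le (N : ℕ) : ∃ C : ℝ, 0 ≤ C ∧ ∀ R : ℝ, 1 ≤ R → ∀ x : RN N,
    ‖fderiv ℝ (cutoffBump N R) x‖ ≤ C := by
  set χ : ContDiffBump (0 : RN N) := ⟨1, 2, one_pos, one_lt_two⟩ with hχ
  have hcd : ContDiff ℝ 1 χ := χ.contDiff
  obtain ⟨C, hC⟩ := (χ.hasCompactSupport.fderiv ℝ).exists_bound_of_continuous
    (hcd.continuous_fderiv one_ne_zero)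
  have hC0 : 0 ≤ C := (norm_nonneg _).trans (hC 0)
  refine ⟨C, hC0, fun R hR x => ?_⟩
  have : fderiv ℝ (cutoffBump N R) x = R⁻¹ • fderiv ℝ χ (R⁻¹ • x) := by
    change fderiv ℝ (fun x => χ (R⁻¹ • x)) x = _
    rw [fderiv_comp_smul]
  rw [this, norm_smul]
  have h1 : ‖R⁻¹‖ ≤ 1 := by
    rw [norm_inv, Real.norm_of_nonneg (by linarith)]
    exact inv_le_one_of_one_le₀ hR
  calc _ ≤ 1 * C := by gcongr; exact hC _
    _ = C := one_mul C

/-- Test functions are dense in `H¹`. -/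
theorem exists_testH1_norm_sub_le (u : H1 N) {ε : ℝ} (hε : 0 < ε) :
    ∃ (φ : RN N → ℝ) (h : ContDiff ℝ ∞ φ) (hc : HasCompactSupport φ),
      ‖testH1 φ h hc - u‖ ≤ ε := by
  obtain ⟨δ₁, hδ₁, h₁⟩ := exists_eLpNorm_translate_sub_le (by simp) (u : L2Pair N).fst
    (by positivity : 0 < ε / 4)
  obtain ⟨δ₂, hδ₂, h₂⟩ := exists_eLpNorm_translate_sub_le (by simp) (u : L2Pair N).snd
    (by positivity : 0 < ε / 4)
  have hδ : 0 < min δ₁ δ₂ := lt_min hδ₁ hδ₂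
  set ρ : ContDiffBump (0 : RN N) := ⟨min δ₁ δ₂ / 2, min δ₁ δ₂, by positivity, by linarith⟩
  set v := mollify ρ u.fn with hv
  set V := mollify ρ u.grad with hV
  have hvs : ContDiff ℝ ∞ v := contDiff_mollify ρ u.locallyIntegrable_fn
  have hVs : ContDiff ℝ ∞ V := contDiff_mollify ρ u.locallyIntegrable_grad
  have m1 : eLpNorm (fun x => v x - u.fn x) 2 volume ≤ ENNReal.ofReal (ε / 4) :=
    eLpNorm_mollify_sub_le ρ u.stronglyMeasurable_fn (by norm_num) (by simp)
      u.locallyIntegrable_fn fun h hh => h₁ h (Metric.ball_subset_ball (min_le_left _ _) hh)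
  have m2 : eLpNorm (fun x => V x - u.grad x) 2 volume ≤ ENNReal.ofReal (ε / 4) :=
    eLpNorm_mollify_sub_le ρ u.stronglyMeasurable_grad (by norm_num) (by simp)
      u.locallyIntegrable_grad fun h hh => h₂ h (Metric.ball_subset_ball (min_le_right _ _) hh)
  have hvL : MemLp v 2 volume := ⟨hvs.continuous.aestronglyMeasurable,
    (eLpNorm_mollify_le ρ u.stronglyMeasurable_fn (by norm_num) (by simp)).trans_lt u.memLp_fn.2⟩
  have hVL : MemLp V 2 volume := ⟨hVs.continuous.aestronglyMeasurable,
    (eLpNorm_mollify_le ρ u.stronglyMeasurable_grad (by norm_num) (by simp)).trans_lt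
      u.memLp_grad.2⟩
  obtain ⟨C, hC, hχ⟩ := exists_norm_fderiv_cutoffBump_le N
  set R : ℕ → ℝ := fun n => n + 1
  have hR1 : ∀ n, 1 ≤ R n := fun n => by simp [R]
  have hRlim : Tendsto R atTop atTop := tendsto_natCast_atTop_atTop.atTop_add tendsto_const_nhds
  set ψ : ℕ → RN N → ℝ := fun n x => cutoffBump N (R n) x * v x
  have hψs : ∀ n, ContDiff ℝ ∞ (ψ n) := fun n => (contDiff_cutoffBump _).mul hvs
  have hψc : ∀ n, HasCompactSupport (ψ n) := fun n =>
    (hasCompactSupport_cutoffBump (by linarith [hR1 n])).mul_right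
  have hgrad : ∀ n x, gradient (ψ n) x
      = cutoffBump N (R n) x • V x + v x • gradient (cutoffBump N (R n)) x := by
    intro n x
    refine ext_inner_right ℝ fun e => ?_
    rw [inner_add_left, real_inner_smul_left, real_inner_smul_left, inner_gradient, inner_gradient,
      hV, ← gradient_mollify, inner_gradient,
      fderiv_fun_mul ((contDiff_cutoffBump _).differentiable (by simp) x)
        (hvs.differentiable (by simp) x)]
    simp [hv]
  have l1 : Tendsto (fun n => eLpNorm (fun x => ψ n x - v x) 2 volume) atTop (𝓝 0) := by
    refine tendsto_eLpNorm_of_dominated (by simp) (by simp)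
      (fun n => ((hψs n).continuous.sub hvs.continuous).aestronglyMeasurable) hvL.norm
      (fun n => ae_of_all _ fun x => ?_) (ae_of_all _ fun x => ?_)
    · have hb := cutoffBump_mem_Icc (R n) x
      have : ψ n x - v x = (cutoffBump N (R n) x - 1) * v x := by simp only [ψ]; ring
      rw [this, norm_mul]
      have : ‖cutoffBump N (R n) x - 1‖ ≤ 1 := by
        rw [Real.norm_eq_abs, abs_le]
        constructor <;> linarith [hb.1, hb.2]
      nlinarith [norm_nonneg (v x)]
    · refine tendsto_const_nhds.congr' ?_
      filter_upwards [hRlim.eventually_gt_atTop ‖x‖] with n hn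
      have := (cutoffBump_eventuallyEq_one hn).eq_of_nhds
      simp only [ψ, this, one_mul, sub_self]
  have l2 : Tendsto (fun n => eLpNorm (fun x => gradient (ψ n) x - V x) 2 volume) atTop (𝓝 0) := by
    refine tendsto_eLpNorm_of_dominated (by simp) (by simp) (g := fun x => ‖V x‖ + C * ‖v x‖)
      (fun n => ((memLp_gradient (hψs n) (hψc n) (p := 2)).aestronglyMeasurable.sub
        hVs.continuous.aestronglyMeasurable)) (hVL.norm.add (hvL.norm.const_mul C))
      (fun n => ae_of_all _ fun x => ?_) (ae_of_all _ fun x => ?_)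
    · have hb := cutoffBump_mem_Icc (R n) x
      have e1 : gradient (ψ n) x - V x = (cutoffBump N (R n) x - 1) • V x
          + v x • gradient (cutoffBump N (R n)) x := by
        rw [hgrad, sub_smul, one_smul]
        abel
      have e2 : ‖cutoffBump N (R n) x - 1‖ ≤ 1 := by
        rw [Real.norm_eq_abs, abs_le]
        constructor <;> linarith [hb.1, hb.2]
      have e3 : ‖gradient (cutoffBump N (R n)) x‖ ≤ C := by
        rw [norm_gradient]
        exact hχ _ (hR1 n) x
      rw [e1]
      refine (norm_add_le _ _).trans ?_
      rw [norm_smul, norm_smul, mul_comm C]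
      gcongr
      nlinarith [norm_nonneg (V x)]
    · refine tendsto_const_nhds.congr' ?_
      filter_upwards [hRlim.eventually_gt_atTop ‖x‖] with n hn
      have h1 := cutoffBump_eventuallyEq_one hn
      have h2 : gradient (cutoffBump N (R n)) x = 0 := by
        rw [gradient, h1.fderiv_eq]
        simp
      rw [hgrad, h1.eq_of_nhds, h2]
      simp
  have hε4 : 0 < ENNReal.ofReal (ε / 4) := ENNReal.ofReal_pos.2 (by positivity)
  obtain ⟨n, hn1, hn2⟩ := ((l1.eventually (gt_mem_nhds hε4)).and
    (l2.eventually (gt_mem_nhds hε4))).exists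
  have hsum : ENNReal.ofReal (ε / 4) + ENNReal.ofReal (ε / 4) = ENNReal.ofReal (ε / 2) := by
    rw [← ENNReal.ofReal_add (by positivity) (by positivity)]
    congr 1
    ring
  refine ⟨ψ n, hψs n, hψc n, ?_⟩
  refine (H1.norm_le_of_eLpNorm_le (a := ε / 2) (b := ε / 2) (by positivity) (by positivity)
    ?_ ?_).trans_eq (by ring)
  · calc eLpNorm (testH1 (ψ n) (hψs n) (hψc n) - u).fn 2 volume
        = eLpNorm ((fun x => ψ n x - v x) + fun x => v x - u.fn x) 2 volume := by
          refine eLpNorm_congr_ae ?_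
          filter_upwards [H1.sub_fn (testH1 (ψ n) (hψs n) (hψc n)) u,
            testH1_fn (hψs n) (hψc n)] with x h1 h2
          rw [h1, h2, Pi.add_apply]
          ring
      _ ≤ _ := eLpNorm_add_le ((hψs n).continuous.sub hvs.continuous).aestronglyMeasurable
          (hvL.aestronglyMeasurable.sub u.memLp_fn.aestronglyMeasurable) (by norm_num)
      _ ≤ _ := (add_le_add hn1.le m1).trans_eq hsum
  · calc eLpNorm (testH1 (ψ n) (hψs n) (hψc n) - u).grad 2 volume
        = eLpNorm ((fun x => gradient (ψ n) x - V x) + fun x => V x - u.grad x) 2 volume := by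
          refine eLpNorm_congr_ae ?_
          filter_upwards [H1.sub_grad (testH1 (ψ n) (hψs n) (hψc n)) u,
            testH1_grad (hψs n) (hψc n)] with x h1 h2
          rw [h1, h2, Pi.add_apply]
          abel
      _ ≤ _ := eLpNorm_add_le ((memLp_gradient (hψs n) (hψc n) (p := 2)).aestronglyMeasurable.sub
          hVs.continuous.aestronglyMeasurable)
          (hVL.aestronglyMeasurable.sub u.memLp_grad.aestronglyMeasurable) (by norm_num)
      _ ≤ _ := (add_le_add hn2.le m2).trans_eq hsum

/-- To prove a closed property of elements of `H¹`, it suffices to consider test functions. -/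
theorem H1.induction_test {P : H1 N → Prop} (hP : IsClosed {u | P u})
    (h : ∀ φ (hφ : ContDiff ℝ ∞ φ) (hc : HasCompactSupport φ), P (testH1 φ hφ hc)) (u : H1 N) :
    P u := by
  have hmem : u ∈ closure {u | P u} := by
    rw [Metric.mem_closure_iff]
    intro ε hε
    obtain ⟨φ, hφ, hc, hle⟩ := exists_testH1_norm_sub_le u (half_pos hε)
    refine ⟨testH1 φ hφ hc, h φ hφ hc, ?_⟩
    rw [dist_comm, dist_eq_norm]
    linarith
  rwa [hP.closure_eq] at hmem

end TestFunctions

section Interpolation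

variable {Ω : Type*} [MeasurableSpace Ω] {μ : Measure Ω}

/-- Interpolation between Lebesgue norms. -/
theorem exists_eLpNorm_le_rpow_mul_rpow {a b m : ENNReal} (ha0 : a ≠ 0) (ham : a < m)
    (hmb : m < b) : ∃ θ : ℝ, 0 < θ ∧ θ < 1 ∧ ∀ (ν : Measure Ω) (f : Ω → ℝ),
      AEStronglyMeasurable f ν →
      eLpNorm f m ν ≤ eLpNorm f a ν ^ θ * eLpNorm f b ν ^ (1 - θ) := by
  have haT : a ≠ ⊤ := (ham.trans hmb).ne_top
  have hmT : m ≠ ⊤ := hmb.ne_top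
  have hm0 : m ≠ 0 := (bot_le.trans_lt ham).ne'
  have hb0 : b ≠ 0 := (bot_le.trans_lt hmb).ne'
  set A := (a⁻¹).toReal with hA
  set B := (b⁻¹).toReal with hB
  set X := (m⁻¹).toReal with hX
  have haT' : a⁻¹ ≠ ⊤ := ENNReal.inv_ne_top.2 ha0
  have hbT' : b⁻¹ ≠ ⊤ := ENNReal.inv_ne_top.2 hb0
  have hmT' : m⁻¹ ≠ ⊤ := ENNReal.inv_ne_top.2 hm0
  have h1 : B < X := (ENNReal.toReal_lt_toReal hbT' hmT').2 (ENNReal.inv_lt_inv.2 hmb)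
  have h2 : X < A := (ENNReal.toReal_lt_toReal hmT' haT').2 (ENNReal.inv_lt_inv.2 ham)
  have hBn : 0 ≤ B := ENNReal.toReal_nonneg
  set θ := (X - B) / (A - B) with hθ
  have hAB : 0 < A - B := by linarith
  have hθ0 : 0 < θ := div_pos (by linarith) hAB
  have hθ1 : θ < 1 := (div_lt_one hAB).2 (by linarith)
  have hθ1' : 0 < 1 - θ := by linarith
  have hX' : θ * A + (1 - θ) * B = X := by
    rw [hθ]
    field_simp
    ring
  refine ⟨θ, hθ0, hθ1, fun ν f hf => ?_⟩
  have hθe : ENNReal.ofReal θ ≠ 0 := by simpa using hθ0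
  have hθe' : ENNReal.ofReal (1 - θ) ≠ 0 := by simpa using hθ1
  have hT : ENNReal.HolderTriple (a / ENNReal.ofReal θ) (b / ENNReal.ofReal (1 - θ)) m := by
    constructor
    rw [ENNReal.inv_div (Or.inl ENNReal.ofReal_ne_top) (Or.inl hθe),
      ENNReal.inv_div (Or.inl ENNReal.ofReal_ne_top) (Or.inl hθe'), div_eq_mul_inv, div_eq_mul_inv,
      ← ENNReal.ofReal_toReal haT', ← ENNReal.ofReal_toReal hbT', ← ENNReal.ofReal_toReal hmT',
      ← ENNReal.ofReal_mul hθ0.le, ← ENNReal.ofReal_mul hθ1'.le,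
      ← ENNReal.ofReal_add (by positivity) (by positivity), hX']
  have key := eLpNorm_smul_le_mul_eLpNorm (p := a / ENNReal.ofReal θ)
    (q := b / ENNReal.ofReal (1 - θ)) (r := m)
    (f := fun x => ‖f x‖ ^ (1 - θ)) (φ := fun x => ‖f x‖ ^ θ) (μ := ν)
    ((hf.norm.aemeasurable.pow_const _).aestronglyMeasurable)
    ((hf.norm.aemeasurable.pow_const _).aestronglyMeasurable)
  rw [eLpNorm_norm_rpow f hθ0, eLpNorm_norm_rpow f hθ1',
    ENNReal.div_mul_cancel hθe ENNReal.ofReal_ne_top,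
    ENNReal.div_mul_cancel hθe' ENNReal.ofReal_ne_top] at key
  refine le_trans (eLpNorm_mono fun x => ?_) key
  simp only [Pi.smul_apply', smul_eq_mul]
  rw [← Real.rpow_add_of_nonneg (norm_nonneg _) hθ0.le hθ1'.le, add_sub_cancel, Real.rpow_one,
    norm_norm]

theorem exists_ofReal_rpow_mul_le {θ : ℝ} (hθ : 0 < θ) {B : ENNReal} (hB : B ≠ ⊤) {ε : ENNReal}
    (hε : ε ≠ 0) : ∃ δ : ℝ, 0 < δ ∧ ENNReal.ofReal δ ^ θ * B ≤ ε := by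
  have h1 : Tendsto (fun δ : ℝ => ENNReal.ofReal δ ^ θ * B) (𝓝[>] 0) (𝓝 0) := by
    have h2 : Tendsto (fun δ : ℝ => ENNReal.ofReal δ ^ θ) (𝓝[>] 0) (𝓝 0) := by
      have h3 : Tendsto (fun δ : ℝ => ENNReal.ofReal δ ^ θ) (𝓝 0) (𝓝 (ENNReal.ofReal 0 ^ θ)) :=
        (ENNReal.continuous_rpow_const.comp ENNReal.continuous_ofReal).tendsto _
      rw [ENNReal.ofReal_zero, ENNReal.zero_rpow_of_pos hθ] at h3
      exact h3.mono_left nhdsWithin_le_nhds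
    simpa using ENNReal.Tendsto.mul_const h2 (Or.inr hB)
  have h2 := h1.eventually (gt_mem_nhds (pos_iff_ne_zero.2 hε))
  obtain ⟨δ, h3, h4⟩ := (h2.and self_mem_nhdsWithin).exists
  exact ⟨δ, h4, h3.le⟩

end Interpolation

section Translation

variable {N : ℕ}

theorem isClosed_setOf_tendsto_zero {E : Type*} [NormedAddCommGroup E] {T : ℕ → E → ℝ} {C : ℝ}
    (hT : ∀ n u v, |T n u - T n v| ≤ C * ‖u - v‖) :
    IsClosed {u | Tendsto (fun n => T n u) atTop (𝓝 0)} := by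
  refine isClosed_of_closure_subset fun u hu => ?_
  rw [Set.mem_ofPred_eq, Metric.tendsto_atTop]
  intro ε hε
  have hC : 0 < |C| + 1 := by positivity
  obtain ⟨v, hv, hd⟩ := Metric.mem_closure_iff.1 hu (ε / 2 / (|C| + 1)) (by positivity)
  obtain ⟨n₀, hn₀⟩ := Metric.tendsto_atTop.1 hv (ε / 2) (half_pos hε)
  refine ⟨n₀, fun n hn => ?_⟩
  have h1 := hn₀ n hn
  have h2 := hT n u v
  rw [Real.dist_eq, sub_zero] at h1 ⊢
  rw [dist_eq_norm, lt_div_iff₀ hC] at hd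
  have h3 : C * ‖u - v‖ ≤ (|C| + 1) * ‖u - v‖ := by
    gcongr
    linarith [le_abs_self C]
  calc |T n u| = |(T n u - T n v) + T n v| := by ring_nf
    _ ≤ |T n u - T n v| + |T n v| := abs_add_le _ _
    _ < ε := by linarith

/-- Translates of a fixed element of `H¹` along a sequence going to infinity converge weakly to
zero. -/
theorem weakTendsto_translate_zero {y : ℕ → RN N} (hy : Tendsto (fun n => ‖y n‖) atTop atTop)
    (u : H1 N) : WeakTendsto (fun n => u.translate (y n)) 0 := by
  rw [weakTendsto_iff]
  intro w
  rw [inner_zero_left]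
  revert w
  refine H1.induction_test ?_ fun ψ hψ hcψ => ?_
  · refine isClosed_setOf_tendsto_zero (C := ‖u‖) fun n w w' => ?_
    rw [← inner_sub_right]
    refine (abs_real_inner_le_norm _ _).trans_eq ?_
    rw [norm_translate]
  revert u
  refine H1.induction_test ?_ fun φ hφ hcφ => ?_
  · refine isClosed_setOf_tendsto_zero (C := ‖testH1 ψ hψ hcψ‖) fun n u u' => ?_
    rw [← inner_sub_left, ← translate_sub]
    refine (abs_real_inner_le_norm _ _).trans_eq ?_
    rw [norm_translate, mul_comm]
  obtain ⟨R₁, h₁⟩ := hcψ.isBounded.subset_closedBall 0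
  obtain ⟨R₂, h₂⟩ := hcφ.isBounded.subset_closedBall 0
  refine tendsto_const_nhds.congr' ?_
  filter_upwards [hy.eventually_gt_atTop (R₁ + R₂)] with n hn
  rw [H1.inner_eq]
  symm
  refine integral_eq_zero_of_ae ?_
  filter_upwards [testH1_fn hψ hcψ, testH1_grad hψ hcψ, ae_shift (testH1_fn hφ hcφ) (y n),
    ae_shift (testH1_grad hφ hcφ) (y n), (testH1 φ hφ hcφ).translate_fn (y n),
    (testH1 φ hφ hcφ).translate_grad (y n)] with x e1 e2 e3 e4 e5 e6
  rw [e5, e6, e1, e2, e3, e4]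
  by_cases hx : x ∈ tsupport ψ
  · have hx' : x + y n ∉ tsupport φ := by
      intro h
      have n1 : ‖x‖ ≤ R₁ := by simpa using h₁ hx
      have n2 : ‖x + y n‖ ≤ R₂ := by simpa using h₂ h
      have : ‖y n‖ ≤ ‖x + y n‖ + ‖x‖ := by simpa using norm_sub_le (x + y n) x
      linarith
    have z1 : φ (x + y n) = 0 := image_eq_zero_of_notMem_tsupport hx'
    have z2 : fderiv ℝ φ (x + y n) = 0 :=
      image_eq_zero_of_notMem_tsupport fun h => hx' (tsupport_fderiv_subset ℝ h)
    simp [z1, z2, gradient]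
  · have z1 : ψ x = 0 := image_eq_zero_of_notMem_tsupport hx
    have z2 : fderiv ℝ ψ x = 0 :=
      image_eq_zero_of_notMem_tsupport fun h => hx (tsupport_fderiv_subset ℝ h)
    simp [z1, z2, gradient]

theorem eLpNorm_translate_sub_le_of_test {φ : RN N → ℝ} (hφ : ContDiff ℝ ∞ φ) (h : RN N) :
    eLpNorm (fun x => φ (x + h) - φ x) 2 volume
      ≤ ENNReal.ofReal ‖h‖ * eLpNorm (gradient φ) 2 volume := by
  have hfd : Continuous (fderiv ℝ φ) := hφ.continuous_fderiv (by simp)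
  set ν : Measure ℝ := volume.restrict (Set.Ioc 0 1) with hν
  have : IsProbabilityMeasure ν := ⟨by simp [hν]⟩
  have hpt : ∀ x, ‖φ (x + h) - φ x‖ₑ ≤ ∫⁻ t, ‖fderiv ℝ φ (x + t • h)‖ₑ * ‖h‖ₑ ∂ν := by
    intro x
    have hd : ∀ t ∈ Set.uIcc (0 : ℝ) 1,
        HasDerivAt (fun t : ℝ => φ (x + t • h)) (fderiv ℝ φ (x + t • h) h) t := by
      intro t _
      have h1 : HasDerivAt (fun t : ℝ => x + t • h) h t := by
        simpa using ((hasDerivAt_id t).smul_const h).const_add x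
      exact ((hφ.differentiable (by simp) (x + t • h)).hasFDerivAt).comp_hasDerivAt t h1
    have hc : Continuous fun t : ℝ => fderiv ℝ φ (x + t • h) h :=
      (hfd.comp (by fun_prop)).clm_apply continuous_const
    have h2 := intervalIntegral.integral_eq_sub_of_hasDerivAt hd (hc.intervalIntegrable 0 1)
    simp only [one_smul, zero_smul, add_zero] at h2
    rw [← h2, intervalIntegral.integral_of_le zero_le_one]
    refine (enorm_integral_le_lintegral_enorm _).trans (lintegral_mono fun t => ?_)
    exact ContinuousLinearMap.le_opENorm _ _
  have hm : Continuous fun z : RN N × ℝ => fderiv ℝ φ (z.1 + z.2 • h) := hfd.comp (by fun_prop)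
  rw [eLpNorm_eq_lintegral_rpow_enorm_toReal (by simp) (by simp),
    eLpNorm_eq_lintegral_rpow_enorm_toReal (by simp) (by simp), one_div,
    ENNReal.rpow_inv_le_iff (by simp)]
  rw [ENNReal.mul_rpow_of_nonneg _ _ (by simp), ← ENNReal.rpow_mul,
    inv_mul_cancel₀ (by simp), ENNReal.rpow_one, ofReal_norm]
  set p := (2 : ENNReal).toReal
  have hp : 1 ≤ p := by simp [p]
  calc ∫⁻ x, ‖φ (x + h) - φ x‖ₑ ^ p
      ≤ ∫⁻ x, (∫⁻ t, ‖fderiv ℝ φ (x + t • h)‖ₑ * ‖h‖ₑ ∂ν) ^ p := by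
        gcongr with x
        exact hpt x
    _ ≤ ∫⁻ x, ∫⁻ t, (‖fderiv ℝ φ (x + t • h)‖ₑ * ‖h‖ₑ) ^ p ∂ν := by
        refine lintegral_mono fun x => lintegral_rpow_le_lintegral_rpow ?_ hp
        exact ((hfd.comp (by fun_prop)).enorm.measurable.mul_const _).aemeasurable
    _ = ∫⁻ t, ∫⁻ x, (‖fderiv ℝ φ (x + t • h)‖ₑ * ‖h‖ₑ) ^ p ∂volume ∂ν := by
        refine lintegral_lintegral_swap ?_
        exact ((hm.enorm.measurable.mul_const _).pow_const p).aemeasurable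
    _ = ∫⁻ _, ‖h‖ₑ ^ p * ∫⁻ x, ‖gradient φ x‖ₑ ^ p ∂volume ∂ν := by
        refine lintegral_congr fun t => ?_
        rw [← lintegral_const_mul' _ _ (by simp [p])]
        rw [← lintegral_add_right_eq_self (fun x => ‖h‖ₑ ^ p * ‖gradient φ x‖ₑ ^ p) (t • h)]
        refine lintegral_congr fun x => ?_
        rw [ENNReal.mul_rpow_of_nonneg _ _ (by positivity), mul_comm]
        congr 2
        rw [← ofReal_norm, ← ofReal_norm, norm_gradient]
    _ = _ := by simp

theorem H1.eLpNorm_translate_sub_le (u : H1 N) (h : RN N) :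
    eLpNorm (fun x => u.fn (x + h) - u.fn x) 2 volume ≤ ENNReal.ofReal (‖h‖ * ‖u‖) := by
  have key : ∀ u : H1 N, ‖((u.translate h - u : H1 N) : L2Pair N).fst‖ ≤ ‖h‖ * ‖u‖ := by
    refine H1.induction_test (isClosed_le ?_ (by fun_prop)) fun φ hφ hc => ?_
    · have h1 : Continuous fun u : H1 N => u.translate h := (translateₗᵢ h).continuous
      have h2 : Continuous fun u : H1 N => ((u.translate h - u : H1 N) : L2Pair N) :=
        continuous_subtype_val.comp (h1.sub continuous_id)
      exact ((WithLp.prod_continuous_ofLp 2 _ _).comp h2).fst.norm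
    · rw [← ENNReal.ofReal_le_ofReal_iff (by positivity), ofReal_norm, H1.enorm_fst]
      have e : eLpNorm ((testH1 φ hφ hc).translate h - testH1 φ hφ hc).fn 2 volume
          = eLpNorm (fun x => φ (x + h) - φ x) 2 volume := by
        refine eLpNorm_congr_ae ?_
        filter_upwards [H1.sub_fn ((testH1 φ hφ hc).translate h) (testH1 φ hφ hc),
          (testH1 φ hφ hc).translate_fn h, testH1_fn hφ hc, ae_shift (testH1_fn hφ hc) h]
          with x e1 e2 e3 e4
        rw [e1, e2, e3, e4]
      rw [e, ENNReal.ofReal_mul (norm_nonneg _)]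
      refine (eLpNorm_translate_sub_le_of_test hφ h).trans ?_
      gcongr
      rw [← eLpNorm_congr_ae (testH1_grad hφ hc)]
      exact H1.eLpNorm_grad_le _
  have h1 := ENNReal.ofReal_le_ofReal (key u)
  rw [ofReal_norm, H1.enorm_fst] at h1
  refine le_of_eq_of_le (eLpNorm_congr_ae ?_) h1
  filter_upwards [H1.sub_fn (u.translate h) u, u.translate_fn h] with x e1 e2
  rw [e1, e2]

theorem H1.eLpNorm_mollify_sub_le (ρ : ContDiffBump (0 : RN N)) (u : H1 N) :
    eLpNorm (fun x => mollify ρ u.fn x - u.fn x) 2 volume ≤ ENNReal.ofReal (ρ.rOut * ‖u‖) := by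
  refine Choquard.eLpNorm_mollify_sub_le ρ u.stronglyMeasurable_fn (by norm_num) (by simp)
    u.locallyIntegrable_fn fun h hh => ?_
  have h1 := u.eLpNorm_translate_sub_le (-h)
  simp only [← sub_eq_add_neg, norm_neg] at h1
  refine h1.trans (ENNReal.ofReal_le_ofReal ?_)
  gcongr
  exact (mem_ball_zero_iff.1 hh).le

end Translation

section MollifyAt

variable {N : ℕ}

/-- The inclusion of `H¹` into `L²`. -/
noncomputable def toL2 (N : ℕ) : H1 N →L[ℝ] Lp ℝ 2 (volume : Measure (RN N)) :=
  LinearMap.mkContinuous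
    { toFun := fun u => (u : L2Pair N).fst
      map_add' := fun _ _ => rfl
      map_smul' := fun _ _ => rfl } 1 fun u => by
        rw [one_mul]
        exact u.norm_fst_le

theorem memLp_normed_sub (ρ : ContDiffBump (0 : RN N)) (x : RN N) :
    MemLp (fun y => ρ.normed volume (x - y)) 2 (volume : Measure (RN N)) := by
  have h1 : MemLp (ρ.normed volume) 2 (volume : Measure (RN N)) :=
    ρ.continuous_normed.memLp_of_hasCompactSupport ρ.hasCompactSupport_normed
  exact h1.comp_measurePreserving (Measure.measurePreserving_sub_left volume x)

theorem mollify_eq_inner (ρ : ContDiffBump (0 : RN N)) (x : RN N) (u : H1 N) :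
    mollify ρ u.fn x = ⟪(memLp_normed_sub ρ x).toLp _, toL2 N u⟫ := by
  rw [mollify_eq_swap, L2.inner_def]
  refine integral_congr_ae ?_
  filter_upwards [(memLp_normed_sub ρ x).coeFn_toLp] with y hy
  rw [hy]
  simp only [smul_eq_mul, RCLike.inner_apply, conj_trivial]
  rw [mul_comm]
  rfl

theorem tendsto_mollify (ρ : ContDiffBump (0 : RN N)) {u : ℕ → H1 N} {v : H1 N}
    (h : WeakTendsto u v) (x : RN N) :
    Tendsto (fun n => mollify ρ (u n).fn x) atTop (𝓝 (mollify ρ v.fn x)) := by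
  simp only [mollify_eq_inner]
  exact h ((innerSL ℝ ((memLp_normed_sub ρ x).toLp _)).comp (toL2 N))

theorem exists_abs_mollify_le (ρ : ContDiffBump (0 : RN N)) :
    ∃ C : ℝ, 0 ≤ C ∧ ∀ (u : H1 N) (x : RN N), |mollify ρ u.fn x| ≤ C * ‖u‖ := by
  refine ⟨(eLpNorm (ρ.normed volume) 2 (volume : Measure (RN N))).toReal, ENNReal.toReal_nonneg,
    fun u x => ?_⟩
  rw [mollify_eq_inner]
  refine (abs_real_inner_le_norm _ _).trans ?_
  rw [Lp.norm_toLp]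
  have e := eLpNorm_comp_measurePreserving (p := 2)
    (ρ.continuous_normed (μ := volume)).aestronglyMeasurable
    (Measure.measurePreserving_sub_left (volume : Measure (RN N)) x)
  have e' : eLpNorm (fun y => ρ.normed volume (x - y)) 2 (volume : Measure (RN N))
    = eLpNorm (ρ.normed volume) 2 (volume : Measure (RN N)) := e
  rw [e']
  gcongr
  exact u.norm_fst_le

theorem mollify_translate (ρ : ContDiffBump (0 : RN N)) (u : H1 N) (z x : RN N) :
    mollify ρ (u.translate z).fn x = mollify ρ u.fn (x + z) := by
  rw [mollify_congr (u.translate_fn z)]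
  simp only [mollify]
  refine integral_congr_ae (ae_of_all _ fun h => ?_)
  simp only
  congr 2
  abel

end MollifyAt

section SobolevEmbedding

/-- The critical Sobolev exponent `2N/(N-2)`. -/
noncomputable def critExp (N : ℕ) : ENNReal := ENNReal.ofReal (2 * N / (N - 2))

theorem exists_eLpNorm_critExp_le {N : ℕ} (hN : 3 ≤ N) : ∃ C : ℝ, 0 ≤ C ∧
    ∀ u : H1 N, eLpNorm u.fn (critExp N) volume ≤ ENNReal.ofReal (C * ‖u‖) := by
  have hN' : (3 : ℝ) ≤ N := by exact_mod_cast hN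
  have hfin : Module.finrank ℝ (RN N) = N := by simp
  set C := eLpNormLESNormFDerivOfEqInnerConst (volume : Measure (RN N)) ((2 : NNReal) : ℝ)
  refine ⟨C, NNReal.coe_nonneg C, fun u => ?_⟩
  have htest : ∀ (φ : RN N → ℝ) (hφ : ContDiff ℝ ∞ φ) (hc : HasCompactSupport φ),
      eLpNorm (testH1 φ hφ hc).fn (critExp N) volume
        ≤ ENNReal.ofReal (C * ‖testH1 φ hφ hc‖) := by
    intro φ hφ hc
    have h1 := eLpNorm_le_eLpNorm_fderiv_of_eq_inner (volume : Measure (RN N))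
      (u := φ) (p := 2) (p' := Real.toNNReal (2 * N / (N - 2))) (hφ.of_le (by simp)) hc
      (by norm_num) (by rw [hfin]; omega) (by
        rw [hfin, Real.coe_toNNReal _ (div_nonneg (by linarith) (by linarith))]
        have : (N : ℝ) - 2 ≠ 0 := by linarith
        have : (N : ℝ) ≠ 0 := by linarith
        push_cast
        field_simp)
    rw [eLpNorm_congr_ae (testH1_fn hφ hc), ENNReal.ofReal_mul (NNReal.coe_nonneg C), ENNReal.ofReal_coe_nnreal]
    refine h1.trans ?_
    gcongr
    rw [← eLpNorm_norm]
    have e : (fun x => ‖fderiv ℝ φ x‖) = fun x => ‖gradient φ x‖ := by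
      ext x
      rw [norm_gradient]
    rw [e, eLpNorm_norm]
    have := H1.eLpNorm_grad_le (testH1 φ hφ hc)
    rwa [eLpNorm_congr_ae (testH1_grad hφ hc)] at this
  choose φ hφ hc hle using fun n : ℕ => exists_testH1_norm_sub_le u
    (by positivity : 0 < (1 : ℝ) / (n + 1))
  set w := fun n => testH1 (φ n) (hφ n) (hc n) with hw
  have hlim : Tendsto w atTop (𝓝 u) := by
    rw [tendsto_iff_norm_sub_tendsto_zero]
    exact squeeze_zero (fun n => norm_nonneg _) hle tendsto_one_div_add_atTop_nhds_zero_nat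
  have hlim2 : Tendsto (fun n => toL2 N (w n)) atTop (𝓝 (toL2 N u)) :=
    ((toL2 N).continuous.tendsto u).comp hlim
  obtain ⟨σ, hσ, hae⟩ := (tendstoInMeasure_of_tendsto_Lp hlim2).exists_seq_tendsto_ae
  refine (Lp.eLpNorm_lim_le_liminf_eLpNorm (f := fun n => (w (σ n)).fn)
    (fun n => (w (σ n)).stronglyMeasurable_fn.aestronglyMeasurable) u.fn hae).trans ?_
  have h2 : Tendsto (fun n => ENNReal.ofReal (C * ‖w (σ n)‖)) atTop
      (𝓝 (ENNReal.ofReal (C * ‖u‖))) :=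
    (ENNReal.continuous_ofReal.tendsto _).comp
      ((hlim.norm.comp hσ.tendsto_atTop).const_mul _)
  rw [← h2.liminf_eq]
  exact liminf_le_liminf (Eventually.of_forall fun n => htest _ _ _)

end SobolevEmbedding

section LocalCompactness

variable {N : ℕ}

theorem mollify_zero (ρ : ContDiffBump (0 : RN N)) (x : RN N) :
    mollify ρ (0 : H1 N).fn x = 0 := by
  rw [mollify_eq_inner, map_zero, inner_zero_right]

theorem exists_contDiffBump_rOut {δ : ℝ} (hδ : 0 < δ) :
    ∃ ρ : ContDiffBump (0 : RN N), ρ.rOut = δ :=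
  ⟨⟨δ / 2, δ, by positivity, by linarith⟩, rfl⟩

/-- Rellich's theorem on balls. -/
theorem tendsto_eLpNorm_two_restrict_ball {v : ℕ → H1 N} {M : ℝ} (hM : ∀ n, ‖v n‖ ≤ M)
    (hv : WeakTendsto v 0) (R : ℝ) :
    Tendsto (fun n => eLpNorm (v n).fn 2 (volume.restrict (Metric.ball 0 R))) atTop (𝓝 0) := by
  have hM0 : 0 ≤ M := (norm_nonneg _).trans (hM 0)
  rw [ENNReal.tendsto_nhds_zero]
  intro ε hε
  obtain ⟨δ, hδ, hδε⟩ := exists_ofReal_rpow_mul_le one_pos (ENNReal.ofReal_ne_top (r := M))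
    (ENNReal.half_pos hε.ne').ne'
  rw [ENNReal.rpow_one, ← ENNReal.ofReal_mul hδ.le] at hδε
  obtain ⟨ρ, hρ⟩ := exists_contDiffBump_rOut (N := N) hδ
  obtain ⟨C, hC, hCb⟩ := exists_abs_mollify_le ρ
  have : IsFiniteMeasure (volume.restrict (Metric.ball (0 : RN N) R)) :=
    ⟨by simpa using measure_ball_lt_top⟩
  have hcont : ∀ n, Continuous (mollify ρ (v n).fn) := fun n =>
    (contDiff_mollify ρ (v n).locallyIntegrable_fn).continuous
  have h1 : Tendsto (fun n => eLpNorm (mollify ρ (v n).fn) 2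
      (volume.restrict (Metric.ball 0 R))) atTop (𝓝 0) := by
    refine tendsto_eLpNorm_of_dominated (by simp) (by simp) (g := fun _ => C * M)
      (fun n => (hcont n).aestronglyMeasurable) (memLp_const _) (fun n => ?_) ?_
    · refine ae_of_all _ fun x => (hCb (v n) x).trans ?_
      gcongr
      exact hM n
    · refine ae_of_all _ fun x => ?_
      simpa only [mollify_zero] using tendsto_mollify ρ hv x
  filter_upwards [ENNReal.tendsto_nhds_zero.1 h1 (ε / 2) (ENNReal.half_pos hε.ne')] with n hn
  have e : (v n).fn = mollify ρ (v n).fn - fun x => mollify ρ (v n).fn x - (v n).fn x := by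
    ext x
    simp
  calc eLpNorm (v n).fn 2 (volume.restrict (Metric.ball 0 R))
      ≤ eLpNorm (mollify ρ (v n).fn) 2 (volume.restrict (Metric.ball 0 R))
        + eLpNorm (fun x => mollify ρ (v n).fn x - (v n).fn x) 2
          (volume.restrict (Metric.ball 0 R)) := by
        conv_lhs => rw [e]
        exact eLpNorm_sub_le (hcont n).aestronglyMeasurable
          ((hcont n).aestronglyMeasurable.sub
            (v n).stronglyMeasurable_fn.aestronglyMeasurable) (by norm_num)
    _ ≤ ε / 2 + ε / 2 := by
        refine add_le_add hn ?_
        refine ((eLpNorm_restrict_le _ _ _ _).trans ((v n).eLpNorm_mollify_sub_le ρ)).trans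
          (le_trans (ENNReal.ofReal_le_ofReal ?_) hδε)
        rw [hρ]
        gcongr
        exact hM n
    _ = ε := ENNReal.add_halves ε

theorem two_lt_critExp (hN : 3 ≤ N) : 2 < critExp N := by
  have hN' : (3 : ℝ) ≤ N := by exact_mod_cast hN
  rw [critExp, show (2 : ENNReal) = ENNReal.ofReal 2 by simp,
    ENNReal.ofReal_lt_ofReal_iff (div_pos (by linarith) (by linarith)), lt_div_iff₀ (by linarith)]
  linarith

theorem tendsto_eLpNorm_restrict_ball (hN : 3 ≤ N) {m : ENNReal} (hm1 : 1 ≤ m)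
    (hm : m < critExp N) {v : ℕ → H1 N} {M : ℝ} (hM : ∀ n, ‖v n‖ ≤ M) (hv : WeakTendsto v 0)
    (R : ℝ) :
    Tendsto (fun n => eLpNorm (v n).fn m (volume.restrict (Metric.ball 0 R))) atTop (𝓝 0) := by
  have h2 := tendsto_eLpNorm_two_restrict_ball hM hv R
  have hmeas : ∀ n, AEStronglyMeasurable (v n).fn (volume.restrict (Metric.ball 0 R)) :=
    fun n => (v n).stronglyMeasurable_fn.aestronglyMeasurable
  have hvol : (volume.restrict (Metric.ball (0 : RN N) R)) Set.univ ≠ ⊤ := by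
    rw [Measure.restrict_apply_univ]
    exact measure_ball_lt_top.ne
  rcases le_or_gt m 2 with h | h
  · refine tendsto_of_tendsto_of_tendsto_of_le_of_le tendsto_const_nhds ?_ (fun n => zero_le)
      (fun n => eLpNorm_le_eLpNorm_mul_rpow_measure_univ h (hmeas n))
    have hT : (volume.restrict (Metric.ball (0 : RN N) R)) Set.univ
        ^ (1 / m.toReal - 1 / (2 : ENNReal).toReal) ≠ ⊤ := by
      refine ENNReal.rpow_ne_top_of_nonneg ?_ hvol
      have h0 : 0 < m.toReal := ENNReal.toReal_pos (zero_lt_one.trans_le hm1).ne' hm.ne_top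
      have h3 : m.toReal ≤ (2 : ENNReal).toReal := ENNReal.toReal_mono (by simp) h
      exact sub_nonneg.2 (one_div_le_one_div_of_le h0 h3)
    simpa using ENNReal.Tendsto.mul_const h2 (Or.inr hT)
  · obtain ⟨θ, hθ0, hθ1, hθ⟩ := exists_eLpNorm_le_rpow_mul_rpow (Ω := RN N) (by simp) h hm
    obtain ⟨C, hC, hCb⟩ := exists_eLpNorm_critExp_le hN
    refine tendsto_of_tendsto_of_tendsto_of_le_of_le tendsto_const_nhds ?_ (fun n => zero_le)
      (h := fun n => eLpNorm (v n).fn 2 (volume.restrict (Metric.ball 0 R)) ^ θ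
        * ENNReal.ofReal (C * M) ^ (1 - θ)) (fun n => (hθ _ _ (hmeas n)).trans ?_)
    · have h3 := (ENNReal.continuous_rpow_const (y := θ)).tendsto (0 : ENNReal)
      rw [ENNReal.zero_rpow_of_pos hθ0] at h3
      have hT : ENNReal.ofReal (C * M) ^ (1 - θ) ≠ ⊤ :=
        ENNReal.rpow_ne_top_of_nonneg (by linarith) ENNReal.ofReal_ne_top
      simpa using ENNReal.Tendsto.mul_const (h3.comp h2) (Or.inr hT)
    · have h4 : 0 ≤ 1 - θ := by linarith
      dsimp only
      gcongr
      refine (eLpNorm_restrict_le _ _ _ _).trans ((hCb _).trans (ENNReal.ofReal_le_ofReal ?_))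
      gcongr
      exact hM n

theorem eLpNorm_mul_le_of_critExp {κ : RN N → ℝ} {a m : ENNReal}
    [ENNReal.HolderTriple a (critExp N) m] (hκ : AEStronglyMeasurable κ volume) (u : H1 N) :
    eLpNorm (fun x => κ x * u.fn x) m volume
      ≤ eLpNorm κ a volume * eLpNorm u.fn (critExp N) volume := by
  have e : (fun x => κ x * u.fn x) = κ • u.fn := by
    ext x
    simp only [Pi.smul_apply', smul_eq_mul]
  rw [e]
  exact eLpNorm_smul_le_mul_eLpNorm u.stronglyMeasurable_fn.aestronglyMeasurable hκ

/-- Multiplication by a function in `L^a` with `a < ∞` is compact on `H¹`. -/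
theorem tendsto_eLpNorm_mul_of_weakTendsto (hN : 3 ≤ N) {κ : RN N → ℝ} {a m : ENNReal}
    (hκ : MemLp κ a volume) (haT : a ≠ ⊤) [hT : ENNReal.HolderTriple a (critExp N) m]
    (hm1 : 1 ≤ m) (hm : m < critExp N) {v : ℕ → H1 N} {M : ℝ} (hM : ∀ n, ‖v n‖ ≤ M)
    (hv : WeakTendsto v 0) :
    Tendsto (fun n => eLpNorm (fun x => κ x * (v n).fn x) m volume) atTop (𝓝 0) := by
  obtain ⟨C, hC, hCb⟩ := exists_eLpNorm_critExp_le hN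
  rw [ENNReal.tendsto_nhds_zero]
  intro ε hε
  obtain ⟨δ, hδ, hδε⟩ := exists_ofReal_rpow_mul_le one_pos (ENNReal.ofReal_ne_top (r := C * M))
    (ENNReal.half_pos hε.ne').ne'
  rw [ENNReal.rpow_one] at hδε
  obtain ⟨g, hgc, hgδ, hg, hgm⟩ := hκ.exists_hasCompactSupport_eLpNorm_sub_le haT
    (ENNReal.ofReal_pos.2 hδ).ne'
  obtain ⟨R, hR⟩ := hgc.isBounded.subset_ball 0
  obtain ⟨D, hD⟩ := hg.bounded_above_of_compact_support hgc
  have h1 : ∀ n, eLpNorm (fun x => g x * (v n).fn x) m volume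
      ≤ ENNReal.ofReal D * eLpNorm (v n).fn m (volume.restrict (Metric.ball 0 R)) := by
    intro n
    rw [← eLpNorm_indicator_eq_eLpNorm_restrict measurableSet_ball]
    refine eLpNorm_le_mul_eLpNorm_of_ae_le_mul (ae_of_all _ fun x => ?_) m
    by_cases hx : x ∈ Metric.ball (0 : RN N) R
    · rw [Set.indicator_of_mem hx, norm_mul]
      gcongr
      exact hD x
    · have : g x = 0 := image_eq_zero_of_notMem_tsupport fun h => hx (hR h)
      simp [this, Set.indicator_of_notMem hx]
  have h2 : Tendsto (fun n => ENNReal.ofReal D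
      * eLpNorm (v n).fn m (volume.restrict (Metric.ball 0 R))) atTop (𝓝 0) := by
    simpa using ENNReal.Tendsto.const_mul (tendsto_eLpNorm_restrict_ball hN hm1 hm hM hv R)
      (Or.inr (ENNReal.ofReal_ne_top (r := D)))
  filter_upwards [ENNReal.tendsto_nhds_zero.1 h2 (ε / 2) (ENNReal.half_pos hε.ne')] with n hn
  have e : (fun x => κ x * (v n).fn x)
      = (fun x => (κ - g) x * (v n).fn x) + fun x => g x * (v n).fn x := by
    ext x
    simp only [Pi.add_apply, Pi.sub_apply]
    ring
  have hvm := (v n).stronglyMeasurable_fn.aestronglyMeasurable (μ := volume)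
  rw [e]
  refine (eLpNorm_add_le ((hκ.1.sub hg.aestronglyMeasurable).mul hvm)
    (hg.aestronglyMeasurable.mul hvm) hm1).trans ?_
  rw [← ENNReal.add_halves ε]
  refine add_le_add ?_ ((h1 n).trans hn)
  refine (eLpNorm_mul_le_of_critExp (a := a) (hκ.1.sub hg.aestronglyMeasurable) (v n)).trans
    (le_trans ?_ hδε)
  gcongr
  refine (hCb _).trans (ENNReal.ofReal_le_ofReal ?_)
  gcongr
  exact hM n

end LocalCompactness

section Nonvanishing

variable {N : ℕ}

/-- A bounded sequence of functions in `H¹` with large `L^m` norms has large local averages. -/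
theorem exists_abs_mollify_ge (hN : 3 ≤ N) {m : ENNReal} (hm2 : 2 < m) (hm : m < critExp N)
    (M : ℝ) {η : ENNReal} (hη : η ≠ 0) : ∃ (ρ : ContDiffBump (0 : RN N)) (δ : ℝ), 0 < δ ∧
      ∀ v : H1 N, ‖v‖ ≤ M → η ≤ eLpNorm v.fn m volume → ∃ x, δ ≤ |mollify ρ v.fn x| := by
  rcases eq_or_ne η ⊤ with hηT | hηT
  · refine ⟨(exists_contDiffBump_rOut one_pos).choose, 1, one_pos, fun v hv h => ?_⟩
    exfalso
    obtain ⟨θ, hθ0, hθ1, hθ⟩ := exists_eLpNorm_le_rpow_mul_rpow (Ω := RN N) (by simp) hm2 hm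
    obtain ⟨C, hC, hCb⟩ := exists_eLpNorm_critExp_le hN
    rw [hηT, top_le_iff] at h
    have h1 := hθ volume v.fn v.stronglyMeasurable_fn.aestronglyMeasurable
    rw [h, top_le_iff] at h1
    refine ENNReal.mul_ne_top ?_ ?_ h1
    · exact ENNReal.rpow_ne_top_of_nonneg hθ0.le v.memLp_fn.2.ne
    · exact ENNReal.rpow_ne_top_of_nonneg (by linarith)
        ((hCb v).trans_lt ENNReal.ofReal_lt_top).ne
  have hη4 : η / 4 ≠ 0 := (ENNReal.div_pos hη (by simp)).ne'
  obtain ⟨θ, hθ0, hθ1, hθ⟩ := exists_eLpNorm_le_rpow_mul_rpow (Ω := RN N) (by simp) hm2 hm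
  obtain ⟨τ, hτ0, hτ1, hτ⟩ := exists_eLpNorm_le_rpow_mul_rpow (Ω := RN N) (b := ⊤) (by simp) hm2
    hm.ne_top.lt_top
  obtain ⟨C, hC, hCb⟩ := exists_eLpNorm_critExp_le hN
  have hθ' : 0 < 1 - θ := by linarith
  have hτ' : 0 < 1 - τ := by linarith
  obtain ⟨r, hr, hrε⟩ := exists_ofReal_rpow_mul_le hθ0 (B := ENNReal.ofReal |M| ^ θ
    * ENNReal.ofReal (2 * (C * |M|)) ^ (1 - θ)) (ENNReal.mul_ne_top
      (ENNReal.rpow_ne_top_of_nonneg hθ0.le ENNReal.ofReal_ne_top)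
      (ENNReal.rpow_ne_top_of_nonneg hθ'.le ENNReal.ofReal_ne_top)) hη4
  obtain ⟨δ, hδ, hδε⟩ := exists_ofReal_rpow_mul_le hτ' (B := ENNReal.ofReal |M| ^ τ)
    (ENNReal.rpow_ne_top_of_nonneg hτ0.le ENNReal.ofReal_ne_top) hη4
  obtain ⟨ρ, hρ⟩ := exists_contDiffBump_rOut (N := N) hr
  refine ⟨ρ, δ, hδ, fun v hv h => ?_⟩
  by_contra! hlt
  have hvM : ‖v‖ ≤ |M| := hv.trans (le_abs_self M)
  have hvm := v.stronglyMeasurable_fn.aestronglyMeasurable (μ := (volume : Measure (RN N)))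
  have hmm := (contDiff_mollify ρ v.locallyIntegrable_fn).continuous.aestronglyMeasurable
    (μ := (volume : Measure (RN N)))
  have hdm : AEStronglyMeasurable (fun x => mollify ρ v.fn x - v.fn x) volume := hmm.sub hvm
  have hcrit1 : 1 ≤ critExp N := one_le_two.trans (two_lt_critExp hN).le
  have a1 : eLpNorm (fun x => mollify ρ v.fn x - v.fn x) m volume ≤ η / 4 := by
    refine (hθ _ _ hdm).trans (le_trans ?_ hrε)
    rw [← mul_assoc, ← ENNReal.mul_rpow_of_nonneg _ _ hθ0.le, ← ENNReal.ofReal_mul hr.le]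
    gcongr
    · refine (v.eLpNorm_mollify_sub_le ρ).trans (ENNReal.ofReal_le_ofReal ?_)
      rw [hρ]
      gcongr
    · refine (eLpNorm_sub_le hmm hvm hcrit1).trans ?_
      rw [two_mul, ENNReal.ofReal_add (by positivity) (by positivity)]
      have b1 : eLpNorm v.fn (critExp N) volume ≤ ENNReal.ofReal (C * |M|) :=
        (hCb v).trans (ENNReal.ofReal_le_ofReal (by gcongr))
      exact add_le_add ((eLpNorm_mollify_le ρ v.stronglyMeasurable_fn hcrit1
        ENNReal.ofReal_ne_top).trans b1) b1
  have a2 : eLpNorm (mollify ρ v.fn) m volume ≤ η / 4 := by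
    refine (hτ _ _ hmm).trans (le_trans ?_ hδε)
    rw [mul_comm]
    gcongr
    · rw [eLpNorm_exponent_top]
      refine eLpNormEssSup_le_of_ae_bound (ae_of_all _ fun x => (hlt x).le)
    · refine (eLpNorm_mollify_le ρ v.stronglyMeasurable_fn (by norm_num) (by simp)).trans
        (v.eLpNorm_fn_le.trans (ENNReal.ofReal_le_ofReal hvM))
  have e : v.fn = mollify ρ v.fn - fun x => mollify ρ v.fn x - v.fn x := by
    ext x
    simp
  have h3 : eLpNorm v.fn m volume ≤ η / 4 + η / 4 := by
    conv_lhs => rw [e]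
    exact (eLpNorm_sub_le hmm hdm (one_le_two.trans hm2.le)).trans (add_le_add a2 a1)
  have h4 : η / 4 + η / 4 = η / 2 := by
    rw [← two_mul, div_eq_mul_inv, div_eq_mul_inv, mul_left_comm]
    congr 1
    rw [show (4 : ENNReal) = 2 * 2 by norm_num, ENNReal.mul_inv (by simp) (by simp), ← mul_assoc,
      ENNReal.mul_inv_cancel (by simp) (by simp), one_mul]
  exact absurd ((h.trans h3).trans_eq h4) (not_le.2 (ENNReal.half_lt_self hη hηT))

/-- A bounded sequence in `H¹` which does not vanish in `L^m` has, up to translations and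
subsequences, a nonzero weak limit. -/
theorem exists_translate_weakTendsto (hN : 3 ≤ N) {m : ENNReal} (hm2 : 2 < m) (hm : m < critExp N)
    {v : ℕ → H1 N} {M : ℝ} (hM : ∀ n, ‖v n‖ ≤ M) {η : ENNReal} (hη : η ≠ 0)
    (hv : ∀ n, η ≤ eLpNorm (v n).fn m volume) :
    ∃ (w : H1 N) (x : ℕ → RN N) (σ : ℕ → ℕ), w ≠ 0 ∧ StrictMono σ ∧
      WeakTendsto (fun n => (v (σ n)).translate (x n)) w := by
  obtain ⟨ρ, δ, hδ, h⟩ := exists_abs_mollify_ge hN hm2 hm M hη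
  choose x hx using fun n => h (v n) (hM n) (hv n)
  obtain ⟨w, σ, hσ, hw⟩ := exists_weakTendsto_subseq (u := fun n => (v n).translate (x n)) (M := M)
    fun n => by rw [norm_translate]; exact hM n
  refine ⟨w, fun n => x (σ n), σ, ?_, hσ, hw⟩
  rintro rfl
  have h1 := (tendsto_mollify ρ hw 0).abs
  rw [mollify_zero, abs_zero] at h1
  have h2 : δ ≤ 0 := by
    refine ge_of_tendsto' h1 fun n => ?_
    rw [mollify_translate, zero_add]
    exact hx (σ n)
  linarith

end Nonvanishing

section MulEmbed

variable {N : ℕ}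

/-- Multiplication by `κ` maps `H¹` boundedly into `L^m`. -/
def IsMulBounded (κ : RN N → ℝ) (m : ENNReal) : Prop :=
  ∃ C : ℝ, ∀ u : H1 N, MemLp (fun x => κ x * u.fn x) m volume ∧
    eLpNorm (fun x => κ x * u.fn x) m volume ≤ ENNReal.ofReal (C * ‖u‖)

/-- Multiplication by `κ` as a continuous linear map from `H¹` to `L^m`. -/
noncomputable def mulEmbed {κ : RN N → ℝ} {m : ENNReal} [Fact (1 ≤ m)] (h : IsMulBounded κ m) :
    H1 N →L[ℝ] Lp ℝ m (volume : Measure (RN N)) :=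
  LinearMap.mkContinuousOfExistsBound
    { toFun := fun u => (h.choose_spec u).1.toLp _
      map_add' := fun u v => by
        rw [← MemLp.toLp_add]
        refine MemLp.toLp_congr _ _ ?_
        filter_upwards [H1.add_fn u v] with x hx
        rw [hx, Pi.add_apply, mul_add]
      map_smul' := fun c u => by
        rw [RingHom.id_apply, ← MemLp.toLp_const_smul]
        refine MemLp.toLp_congr _ _ ?_
        filter_upwards [H1.smul_fn c u] with x hx
        rw [hx, Pi.smul_apply, smul_eq_mul]
        ring }
    ⟨|h.choose|, fun u => by
      change ‖(h.choose_spec u).1.toLp _‖ ≤ _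
      rw [Lp.norm_toLp]
      refine ENNReal.toReal_le_of_le_ofReal (by positivity) ((h.choose_spec u).2.trans
        (ENNReal.ofReal_le_ofReal ?_))
      gcongr
      exact le_abs_self _⟩

theorem coeFn_mulEmbed {κ : RN N → ℝ} {m : ENNReal} [Fact (1 ≤ m)] (h : IsMulBounded κ m)
    (u : H1 N) : mulEmbed h u =ᵐ[volume] fun x => κ x * u.fn x :=
  (h.choose_spec u).1.coeFn_toLp

theorem norm_mulEmbed {κ : RN N → ℝ} {m : ENNReal} [Fact (1 ≤ m)] (h : IsMulBounded κ m)
    (u : H1 N) : ‖mulEmbed h u‖ = (eLpNorm (fun x => κ x * u.fn x) m volume).toReal := by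
  rw [Lp.norm_def, eLpNorm_congr_ae (coeFn_mulEmbed h u)]

theorem isMulBounded_one (hN : 3 ≤ N) {m : ENNReal} (hm2 : 2 < m) (hm : m < critExp N) :
    IsMulBounded (fun _ : RN N => 1) m := by
  obtain ⟨θ, hθ0, hθ1, hθ⟩ := exists_eLpNorm_le_rpow_mul_rpow (Ω := RN N) (by simp) hm2 hm
  obtain ⟨C, hC, hCb⟩ := exists_eLpNorm_critExp_le hN
  have hθ' : 0 ≤ 1 - θ := by linarith
  have hle : ∀ u : H1 N, eLpNorm u.fn m volume ≤ ENNReal.ofReal (max 1 C * ‖u‖) := by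
    intro u
    refine (hθ _ _ u.stronglyMeasurable_fn.aestronglyMeasurable).trans ?_
    calc eLpNorm u.fn 2 volume ^ θ * eLpNorm u.fn (critExp N) volume ^ (1 - θ)
        ≤ ENNReal.ofReal (max 1 C * ‖u‖) ^ θ * ENNReal.ofReal (max 1 C * ‖u‖) ^ (1 - θ) := by
          gcongr
          · refine u.eLpNorm_fn_le.trans (ENNReal.ofReal_le_ofReal ?_)
            exact le_mul_of_one_le_left (norm_nonneg _) (le_max_left _ _)
          · refine (hCb u).trans (ENNReal.ofReal_le_ofReal ?_)
            gcongr
            exact le_max_right _ _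
      _ = _ := by
          rw [← ENNReal.rpow_add_of_nonneg _ _ hθ0.le hθ', add_sub_cancel, ENNReal.rpow_one]
  refine ⟨max 1 C, fun u => ?_⟩
  simp only [one_mul]
  exact ⟨⟨u.stronglyMeasurable_fn.aestronglyMeasurable, (hle u).trans_lt ENNReal.ofReal_lt_top⟩,
    hle u⟩

theorem isMulBounded_of_memLp (hN : 3 ≤ N) {κ : RN N → ℝ} {a m : ENNReal}
    (hκ : MemLp κ a volume) [ENNReal.HolderTriple a (critExp N) m] : IsMulBounded κ m := by
  obtain ⟨C, hC, hCb⟩ := exists_eLpNorm_critExp_le hN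
  have hle : ∀ u : H1 N, eLpNorm (fun x => κ x * u.fn x) m volume
      ≤ ENNReal.ofReal ((eLpNorm κ a volume).toReal * C * ‖u‖) := by
    intro u
    refine (eLpNorm_mul_le_of_critExp (a := a) hκ.1 u).trans ?_
    rw [mul_assoc, ENNReal.ofReal_mul ENNReal.toReal_nonneg, ENNReal.ofReal_toReal hκ.2.ne]
    gcongr
    exact hCb u
  exact ⟨_, fun u => ⟨⟨hκ.1.mul u.stronglyMeasurable_fn.aestronglyMeasurable,
    (hle u).trans_lt ENNReal.ofReal_lt_top⟩, hle u⟩⟩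

theorem tendsto_ballCut_mulEmbed_one (hN : 3 ≤ N) {m : ENNReal} [hm1 : Fact (1 ≤ m)]
    (hm : m < critExp N) (h : IsMulBounded (fun _ : RN N => 1) m) {v : ℕ → H1 N} {M : ℝ}
    (hM : ∀ n, ‖v n‖ ≤ M) (hv : WeakTendsto v 0) (R : ℝ) :
    Tendsto (fun n => ballCut R (mulEmbed h (v n))) atTop (𝓝 0) := by
  rw [tendsto_zero_iff_norm_tendsto_zero]
  have h1 := (ENNReal.tendsto_toReal ENNReal.zero_ne_top).comp
    (tendsto_eLpNorm_restrict_ball hN hm1.out hm hM hv R)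
  rw [ENNReal.toReal_zero] at h1
  refine h1.congr fun n => ?_
  rw [Function.comp_apply, ← eLpNorm_indicator_eq_eLpNorm_restrict measurableSet_ball, Lp.norm_def]
  congr 1
  refine eLpNorm_congr_ae ?_
  filter_upwards [coeFn_ballCut R (mulEmbed h (v n)), coeFn_mulEmbed h (v n)] with x h2 h3
  rw [h2]
  by_cases hx : x ∈ Metric.ball (0 : RN N) R
  · rw [Set.indicator_of_mem hx, Set.indicator_of_mem hx, h3, one_mul]
  · rw [Set.indicator_of_notMem hx, Set.indicator_of_notMem hx]

theorem tendsto_mulEmbed_of_weakTendsto (hN : 3 ≤ N) {κ : RN N → ℝ} {a m : ENNReal}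
    [hm1 : Fact (1 ≤ m)] (hκ : MemLp κ a volume) (haT : a ≠ ⊤)
    [ENNReal.HolderTriple a (critExp N) m] (hm : m < critExp N) (h : IsMulBounded κ m)
    {v : ℕ → H1 N} {v₀ : H1 N} {M : ℝ} (hM : ∀ n, ‖v n‖ ≤ M) (hv : WeakTendsto v v₀) :
    Tendsto (fun n => mulEmbed h (v n)) atTop (𝓝 (mulEmbed h v₀)) := by
  rw [tendsto_iff_norm_sub_tendsto_zero]
  have hw : WeakTendsto (fun n => v n - v₀) 0 := by
    simpa using hv.sub (weakTendsto_of_tendsto (tendsto_const_nhds (x := v₀)))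
  have hw' : ∀ n, ‖v n - v₀‖ ≤ M + ‖v₀‖ := fun n =>
    (norm_sub_le _ _).trans (by gcongr; exact hM n)
  have h1 := (ENNReal.tendsto_toReal ENNReal.zero_ne_top).comp
    (tendsto_eLpNorm_mul_of_weakTendsto hN hκ haT hm1.out hm hw' hw)
  rw [ENNReal.toReal_zero] at h1
  refine h1.congr fun n => ?_
  rw [Function.comp_apply, ← map_sub, norm_mulEmbed]

end MulEmbed

section Dual

variable {E : Type*} [NormedAddCommGroup E] [NormedSpace ℝ E] {A B : ℕ → E →L[ℝ] ℝ}

theorem tendsto_norm_dual_sub (hA : Tendsto (fun n => ‖A n‖) atTop (𝓝 0))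
    (hB : Tendsto (fun n => ‖B n‖) atTop (𝓝 0)) :
    Tendsto (fun n => ‖A n - B n‖) atTop (𝓝 0) :=
  squeeze_zero (fun _ => norm_nonneg _) (fun _ => norm_sub_le _ _) (by simpa using hA.add hB)

theorem tendsto_norm_dual_of_le (hB : Tendsto (fun n => ‖B n‖) atTop (𝓝 0))
    (h : ∀ n, ‖A n‖ ≤ ‖B n‖) : Tendsto (fun n => ‖A n‖) atTop (𝓝 0) :=
  squeeze_zero (fun _ => norm_nonneg _) h hB

theorem tendsto_dual_apply_zero (hA : Tendsto (fun n => ‖A n‖) atTop (𝓝 0)) {v : ℕ → E} {M : ℝ}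
    (hv : ∀ n, ‖v n‖ ≤ M) : Tendsto (fun n => A n (v n)) atTop (𝓝 0) := by
  have h3 : Tendsto (fun n => ‖A n‖ * M) atTop (𝓝 0) := by simpa using hA.mul_const M
  refine squeeze_zero_norm (fun n => (ContinuousLinearMap.le_opNorm _ _).trans ?_) h3
  gcongr
  exact hv n

theorem tendsto_norm_comp_zero {F : Type*} [NormedAddCommGroup F] [NormedSpace ℝ F]
    {A : ℕ → F →L[ℝ] ℝ} (hA : Tendsto A atTop (𝓝 0)) (ι : E →L[ℝ] F) :
    Tendsto (fun n => ‖(A n).comp ι‖) atTop (𝓝 0) := by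
  have h1 := tendsto_zero_iff_norm_tendsto_zero.1 hA
  exact squeeze_zero (fun n => norm_nonneg _) (fun n => ContinuousLinearMap.opNorm_comp_le _ _)
    (by simpa using h1.mul_const ‖ι‖)

end Dual

section WeakTranslation

variable {N : ℕ}

/-- If translating a bounded weakly null sequence produces a nonzero weak limit, then the
translations go to infinity. -/
theorem tendsto_norm_atTop_of_weakTendsto_translate {f : ℕ → H1 N} {M : ℝ} (hM : ∀ n, ‖f n‖ ≤ M)
    (hf : WeakTendsto f 0) {z : ℕ → RN N} {w : H1 N} (hw : w ≠ 0)
    (h : WeakTendsto (fun n => (f n).translate (z n)) w) :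
    Tendsto (fun n => ‖z n‖) atTop atTop := by
  by_contra hcon
  rw [tendsto_atTop] at hcon
  push Not at hcon
  obtain ⟨R, hR⟩ := hcon
  obtain ⟨σ, hσ, hσR⟩ := extraction_of_frequently_atTop hR
  obtain ⟨z₀, -, τ, hτ, hlim⟩ := (isCompact_closedBall (0 : RN N) R).tendsto_subseq
    (x := fun n => z (σ n)) fun n => by simpa using (hσR n).le
  have hστ : Tendsto (fun n => σ (τ n)) atTop atTop := hσ.tendsto_atTop.comp hτ.tendsto_atTop
  refine hw ((h.comp hστ).unique ?_)
  rw [weakTendsto_iff]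
  intro v
  rw [inner_zero_left]
  simp only [inner_translate]
  have hv : Tendsto (fun n => v.translate (-z (σ (τ n)))) atTop (𝓝 (v.translate (-z₀))) :=
    tendsto_translate hlim.neg v
  have h1 : Tendsto (fun n => ⟪f (σ (τ n)), v.translate (-z₀)⟫) atTop (𝓝 0) := by
    simpa using weakTendsto_iff.1 (hf.comp hστ) (v.translate (-z₀))
  have h2 : Tendsto (fun n => ⟪f (σ (τ n)), v.translate (-z (σ (τ n))) - v.translate (-z₀)⟫)
      atTop (𝓝 0) := by
    have h3 : Tendsto (fun n => M * ‖v.translate (-z (σ (τ n))) - v.translate (-z₀)‖) atTop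
        (𝓝 0) := by
      simpa using (tendsto_iff_norm_sub_tendsto_zero.1 hv).const_mul M
    refine squeeze_zero_norm (fun n => (norm_inner_le_norm _ _).trans ?_) h3
    gcongr
    exact hM _
  have h3 := h1.add h2
  simp only [← inner_add_right, add_sub_cancel, add_zero] at h3
  exact h3

end WeakTranslation

section Choquard

variable {N : ℕ} {α p : ℝ} [hα : Fact (0 < α ∧ α < (N : ℝ))] [hp : Fact (1 < p)]

/-- The derivative of the energy of the Choquard equation, in terms of the embedding `ι` of `H¹`
into the space on which the nonlocal term is defined. -/
noncomputable def choquardDeriv (ι : H1 N →L[ℝ] NonlocalSpace N α p) (u : H1 N) :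
    H1 N →L[ℝ] ℝ :=
  innerSL ℝ u - (nonlocalDeriv (ι u)).comp ι

variable {ι : H1 N →L[ℝ] NonlocalSpace N α p}

theorem choquardDeriv_apply (u v : H1 N) :
    choquardDeriv ι u v = ⟪u, v⟫ - nonlocalDeriv (ι u) (ι v) := rfl

theorem choquardDeriv_self (u : H1 N) : choquardDeriv ι u u = ‖u‖ ^ 2 - nonlocal (ι u) := by
  rw [choquardDeriv_apply, nonlocalDeriv_self, real_inner_self_eq_norm_sq]

/-- The properties of the embedding of `H¹` into a subcritical Lebesgue space used in
concentration-compactness arguments. -/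
structure IsLocalEmbedding (ι : H1 N →L[ℝ] NonlocalSpace N α p) : Prop where
  nonlocalDeriv_translate (y : RN N) (u v : H1 N) :
    nonlocalDeriv (ι (u.translate y)) (ι (v.translate y)) = nonlocalDeriv (ι u) (ι v)
  tendsto_ballCut {v : ℕ → H1 N} {M : ℝ} (hM : ∀ n, ‖v n‖ ≤ M) (hv : WeakTendsto v 0) (R : ℝ) :
    Tendsto (fun n => ballCut R (ι (v n))) atTop (𝓝 0)
  exists_translate {v : ℕ → H1 N} {M : ℝ} (hM : ∀ n, ‖v n‖ ≤ M) {η : ℝ} (hη : 0 < η)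
    (hv : ∀ n, η ≤ ‖ι (v n)‖) : ∃ (w : H1 N) (x : ℕ → RN N) (σ : ℕ → ℕ), w ≠ 0 ∧ StrictMono σ ∧
      WeakTendsto (fun n => (v (σ n)).translate (x n)) w

theorem norm_choquardDeriv_translate_le (hι : IsLocalEmbedding ι) (y : RN N) (u : H1 N) :
    ‖choquardDeriv ι (u.translate y)‖ ≤ ‖choquardDeriv ι u‖ := by
  refine ContinuousLinearMap.opNorm_le_bound _ (norm_nonneg (choquardDeriv ι u)) fun v => ?_
  have h1 : choquardDeriv ι (u.translate y) v = choquardDeriv ι u (v.translate (-y)) := by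
    rw [choquardDeriv_apply, choquardDeriv_apply, inner_translate]
    conv_lhs => rw [← translate_translate_neg y v, hι.nonlocalDeriv_translate]
    rw [translate_translate_neg]
  rw [h1]
  refine (ContinuousLinearMap.le_opNorm _ _).trans_eq ?_
  rw [norm_translate]

/-- The nonlocal term splits along weakly convergent sequences. -/
theorem tendsto_nonlocalDeriv_comp_splitting (hι : IsLocalEmbedding ι) {z : ℕ → H1 N} {M : ℝ}
    (hM : ∀ n, ‖z n‖ ≤ M) (hz : WeakTendsto z 0) (u : H1 N) :
    Tendsto (fun n => ‖(nonlocalDeriv (ι (z n + u))).comp ι - (nonlocalDeriv (ι (z n))).comp ι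
      - (nonlocalDeriv (ι u)).comp ι‖) atTop (𝓝 0) := by
  have h1 := tendsto_nonlocalDeriv_add_sub (Z := fun n => ι (z n)) (M := ‖ι‖ * M)
    (fun n => (ι.le_opNorm _).trans (by gcongr; exact hM n)) (hι.tendsto_ballCut hM hz) (ι u)
  refine (tendsto_norm_comp_zero h1 ι).congr fun n => ?_
  rw [map_add, ContinuousLinearMap.sub_comp, ContinuousLinearMap.sub_comp]

theorem tendsto_choquardDeriv_splitting (hι : IsLocalEmbedding ι) {z : ℕ → H1 N} {M : ℝ}
    (hM : ∀ n, ‖z n‖ ≤ M) (hz : WeakTendsto z 0) (u : H1 N) :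
    Tendsto (fun n => ‖choquardDeriv ι (z n + u) - choquardDeriv ι (z n) - choquardDeriv ι u‖) atTop
      (𝓝 0) := by
  refine tendsto_norm_dual_of_le (tendsto_nonlocalDeriv_comp_splitting hι hM hz u) fun n => ?_
  refine ContinuousLinearMap.opNorm_le_bound _ (norm_nonneg ((nonlocalDeriv (ι (z n + u))).comp ι
    - (nonlocalDeriv (ι (z n))).comp ι - (nonlocalDeriv (ι u)).comp ι)) fun v => ?_
  refine le_of_eq_of_le ?_ (ContinuousLinearMap.le_opNorm ((nonlocalDeriv (ι (z n + u))).comp ι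
    - (nonlocalDeriv (ι (z n))).comp ι - (nonlocalDeriv (ι u)).comp ι) v)
  have e : (choquardDeriv ι (z n + u) - choquardDeriv ι (z n) - choquardDeriv ι u) v
      = -(((nonlocalDeriv (ι (z n + u))).comp ι
        - (nonlocalDeriv (ι (z n))).comp ι - (nonlocalDeriv (ι u)).comp ι) v) := by
    change (⟪z n + u, v⟫ - nonlocalDeriv (ι (z n + u)) (ι v))
      - (⟪z n, v⟫ - nonlocalDeriv (ι (z n)) (ι v)) - (⟪u, v⟫ - nonlocalDeriv (ι u) (ι v))
      = -(nonlocalDeriv (ι (z n + u)) (ι v) - nonlocalDeriv (ι (z n)) (ι v)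
        - nonlocalDeriv (ι u) (ι v))
    rw [inner_add_left]
    ring
  rw [e, norm_neg]

theorem tendsto_choquardDeriv_apply (hι : IsLocalEmbedding ι) {z : ℕ → H1 N} {M : ℝ}
    (hM : ∀ n, ‖z n‖ ≤ M) (hz : WeakTendsto z 0) (v : H1 N) :
    Tendsto (fun n => choquardDeriv ι (z n) v) atTop (𝓝 0) := by
  have h1 := tendsto_nonlocalDeriv_apply_of_ballCut (Z := fun n => ι (z n)) (M := ‖ι‖ * M)
    (fun n => (ι.le_opNorm _).trans (by gcongr; exact hM n)) (hι.tendsto_ballCut hM hz) (ι v)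
  have h2 := weakTendsto_iff.1 hz v
  simpa [choquardDeriv_apply] using h2.sub h1

theorem tendsto_choquardDeriv_of_splitting (hι : IsLocalEmbedding ι) {z : ℕ → H1 N} {M : ℝ}
    (hM : ∀ n, ‖z n‖ ≤ M) (hz : WeakTendsto z 0) {L : H1 N →L[ℝ] ℝ}
    (h : Tendsto (fun n => ‖choquardDeriv ι (z n) + L‖) atTop (𝓝 0)) :
    L = 0 ∧ Tendsto (fun n => ‖choquardDeriv ι (z n)‖) atTop (𝓝 0) := by
  have hL : L = 0 := by
    ext v
    have h1 : Tendsto (fun n => (choquardDeriv ι (z n) + L) v) atTop (𝓝 0) :=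
      tendsto_dual_apply_zero h fun n => le_refl ‖v‖
    have h2 : Tendsto (fun n => (choquardDeriv ι (z n) + L) v) atTop (𝓝 (0 + L v)) :=
      (tendsto_choquardDeriv_apply hι hM hz v).add tendsto_const_nhds
    rw [zero_add] at h2
    exact tendsto_nhds_unique h2 h1
  refine ⟨hL, h.congr fun n => ?_⟩
  rw [hL, add_zero]

theorem exists_pos_le_norm_sq_of_le_nonlocal {H : Type*} [NormedAddCommGroup H] [NormedSpace ℝ H]
    (ι : H →L[ℝ] NonlocalSpace N α p) : ∃ c : ℝ, 0 < c ∧ ∀ w : H, w ≠ 0 → ‖w‖ ^ 2 ≤ nonlocal (ι w) → c ≤ ‖w‖ ^ 2 := by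
  have hp' := hp.out
  obtain ⟨C, hC, hCle⟩ : ∃ C : ℝ, 0 ≤ C ∧ ∀ w, ‖ι w‖ ≤ C * ‖w‖ :=
    ⟨‖ι‖, norm_nonneg ι, ι.le_opNorm⟩
  set A := ‖rieszForm N α‖ * (C ^ p * C ^ p) + 1 with hA
  have hA0 : 0 < A := by positivity
  have hp1 : 0 < p - 1 := by linarith
  refine ⟨A⁻¹ ^ (1 / (p - 1)), by positivity, fun w hw h => ?_⟩
  have hw0 : 0 < ‖w‖ := norm_pos_iff.2 hw
  have h1 : ‖w‖ ^ 2 ≤ A * (‖w‖ ^ 2) ^ p := by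
    calc ‖w‖ ^ 2 ≤ ‖rieszForm N α‖ * (‖ι w‖ ^ p * ‖ι w‖ ^ p) := h.trans (nonlocal_le _)
      _ ≤ ‖rieszForm N α‖ * ((C * ‖w‖) ^ p * (C * ‖w‖) ^ p) := by
          gcongr <;> exact hCle w
      _ = ‖rieszForm N α‖ * (C ^ p * C ^ p) * (‖w‖ ^ 2) ^ p := by
          rw [Real.mul_rpow hC (norm_nonneg _), pow_two,
            Real.mul_rpow (norm_nonneg _) (norm_nonneg _)]
          ring
      _ ≤ A * (‖w‖ ^ 2) ^ p := by
          gcongr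
          rw [hA]
          linarith
  have h2 : (‖w‖ ^ 2) ^ p = ‖w‖ ^ 2 * (‖w‖ ^ 2) ^ (p - 1) := by
    rw [← Real.rpow_one_add' (by positivity) (by linarith)]
    ring_nf
  have h3 : A⁻¹ ≤ (‖w‖ ^ 2) ^ (p - 1) := by
    rw [inv_le_iff_one_le_mul₀ hA0]
    have hpos : 0 < ‖w‖ ^ 2 := by positivity
    rw [h2] at h1
    by_contra! hlt
    nlinarith
  calc A⁻¹ ^ (1 / (p - 1)) ≤ ((‖w‖ ^ 2) ^ (p - 1)) ^ (1 / (p - 1)) := by gcongr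
    _ = ‖w‖ ^ 2 := by
      rw [← Real.rpow_mul (by positivity), mul_one_div_cancel hp1.ne', Real.rpow_one]

theorem continuous_nonlocal : Continuous (nonlocal : NonlocalSpace N α p → ℝ) :=
  continuous_iff_continuousAt.2 fun U => (hasFDerivAt_nonlocal U).continuousAt

theorem tendsto_nonlocal_zero {V : ℕ → NonlocalSpace N α p} (h : Tendsto V atTop (𝓝 0)) :
    Tendsto (fun n => nonlocal (V n)) atTop (𝓝 0) := by
  have h1 := tendsto_zero_iff_norm_tendsto_zero.1 h
  have hp' := hp.out
  have h2 : Tendsto (fun n => ‖V n‖ ^ p) atTop (𝓝 0) := by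
    have := h1.rpow_const (p := p) (Or.inr (by linarith))
    rwa [Real.zero_rpow (by linarith)] at this
  exact squeeze_zero (fun n => nonlocal_nonneg _) (fun n => nonlocal_le _) (by
    simpa using (h2.mul h2).const_mul ‖rieszForm N α‖)

theorem tendsto_zero_of_choquardDeriv {v : ℕ → H1 N} {M : ℝ} (hM : ∀ n, ‖v n‖ ≤ M)
    (hd : Tendsto (fun n => ‖choquardDeriv ι (v n)‖) atTop (𝓝 0))
    (h : Tendsto (fun n => ι (v n)) atTop (𝓝 0)) : Tendsto v atTop (𝓝 0) := by
  have h1 : Tendsto (fun n => choquardDeriv ι (v n) (v n)) atTop (𝓝 0) :=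
    tendsto_dual_apply_zero hd hM
  have h2 := h1.add (tendsto_nonlocal_zero h)
  simp only [choquardDeriv_self, sub_add_cancel, add_zero] at h2
  rw [tendsto_zero_iff_norm_tendsto_zero]
  have h3 := (Real.continuous_sqrt.tendsto 0).comp h2
  rw [Real.sqrt_zero] at h3
  exact h3.congr fun n => Real.sqrt_sq (norm_nonneg _)

/-- The sequence `v` decomposes, along the subsequence `σ`, into translates of the solutions `w j`
along mutually diverging sequences `y j`. -/
structure IsBubbleDecomposition (ι : H1 N →L[ℝ] NonlocalSpace N α p) (v : ℕ → H1 N) (σ : ℕ → ℕ)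
    {k : ℕ} (w : Fin k → H1 N) (y : Fin k → ℕ → RN N) : Prop where
  strictMono : StrictMono σ
  ne_zero (j : Fin k) : w j ≠ 0
  choquardDeriv_eq_zero (j : Fin k) : choquardDeriv ι (w j) = 0
  tendsto_norm (j : Fin k) : Tendsto (fun n => ‖y j n‖) atTop atTop
  tendsto_norm_sub (i j : Fin k) (hij : i ≠ j) :
    Tendsto (fun n => ‖y j n - y i n‖) atTop atTop
  tendsto_sub : Tendsto (fun n => v (σ n) - ∑ j, (w j).translate (y j n)) atTop (𝓝 0)
  tendsto_norm_sq : Tendsto (fun n => ‖v (σ n)‖ ^ 2) atTop (𝓝 (∑ j, ‖w j‖ ^ 2))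

theorem isBubbleDecomposition_of_tendsto_zero {v : ℕ → H1 N} (h : Tendsto v atTop (𝓝 0)) :
    IsBubbleDecomposition ι v id (k := 0) Fin.elim0 Fin.elim0 where
  strictMono := strictMono_id
  ne_zero j := j.elim0
  choquardDeriv_eq_zero j := j.elim0
  tendsto_norm j := j.elim0
  tendsto_norm_sub i := i.elim0
  tendsto_sub := by simpa using h
  tendsto_norm_sq := by simpa using h.norm.pow 2

theorem weakTendsto_zero_of_translate_sum {k : ℕ} (w : Fin k → H1 N) {y : Fin k → ℕ → RN N}
    {s : Finset (Fin k)} (hy : ∀ j ∈ s, Tendsto (fun n => ‖y j n‖) atTop atTop) :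
    WeakTendsto (fun n => ∑ j ∈ s, (w j).translate (y j n)) 0 := by
  intro f
  have h1 := tendsto_finsetSum s fun j hj => weakTendsto_translate_zero (hy j hj) (w j) f
  simpa using h1

theorem IsBubbleDecomposition.weakTendsto_translate {v : ℕ → H1 N} {σ : ℕ → ℕ} {k : ℕ}
    {w : Fin k → H1 N} {y : Fin k → ℕ → RN N} (h : IsBubbleDecomposition ι v σ w y) (j : Fin k) :
    WeakTendsto (fun n => (v (σ n)).translate (-y j n)) (w j) := by
  have h1 : Tendsto (fun n => (v (σ n) - ∑ i, (w i).translate (y i n)).translate (-y j n)) atTop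
      (𝓝 0) := by
    rw [tendsto_zero_iff_norm_tendsto_zero]
    simp only [norm_translate]
    exact tendsto_zero_iff_norm_tendsto_zero.1 h.tendsto_sub
  have h2 : WeakTendsto (fun n => ∑ i ∈ Finset.univ.erase j, (w i).translate (-y j n + y i n)) 0 :=
    weakTendsto_zero_of_translate_sum w fun i hi => by
      refine (h.tendsto_norm_sub j i (Finset.ne_of_mem_erase hi).symm).congr fun n => ?_
      rw [neg_add_eq_sub]
  have h3 := ((weakTendsto_of_tendsto h1).add h2).add
    (weakTendsto_of_tendsto (tendsto_const_nhds (x := w j)))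
  rw [add_zero, zero_add] at h3
  refine fun f => (h3 f).congr fun n => congrArg f ?_
  have e : (∑ i, (w i).translate (y i n)).translate (-y j n)
      = ∑ i ∈ Finset.univ.erase j, (w i).translate (-y j n + y i n) + w j := by
    rw [← translateₗᵢ_apply, map_sum, ← Finset.sum_erase_add _ _ (Finset.mem_univ j)]
    simp only [translateₗᵢ_apply, translate_translate, neg_add_cancel, translate_zero]
  rw [translate_sub, e]
  abel

/-- One step of the extraction of bubbles: splitting off the profile `w₀`. -/
theorem IsBubbleDecomposition.cons {v : ℕ → H1 N} {M : ℝ}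
    (hM : ∀ n, ‖v n‖ ≤ M) (hv : WeakTendsto v 0) {σ₀ : ℕ → ℕ} (hσ₀ : StrictMono σ₀) {w₀ : H1 N}
    (hw₀ : w₀ ≠ 0) (hcrit : choquardDeriv ι w₀ = 0) {x : ℕ → RN N}
    (hx : WeakTendsto (fun n => (v (σ₀ n)).translate (x n)) w₀) {σ : ℕ → ℕ} {k : ℕ}
    {w : Fin k → H1 N} {y : Fin k → ℕ → RN N}
    (h : IsBubbleDecomposition ι (fun n => v (σ₀ n) - w₀.translate (-x n)) σ w y)
    (hnorm : Tendsto (fun n => ‖v (σ₀ n)‖ ^ 2 - ‖v (σ₀ n) - w₀.translate (-x n)‖ ^ 2) atTop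
      (𝓝 (‖w₀‖ ^ 2))) :
    IsBubbleDecomposition ι v (fun n => σ₀ (σ n)) (Fin.cons w₀ w : Fin (k + 1) → H1 N)
      (Fin.cons (fun n => -x (σ n)) y : Fin (k + 1) → ℕ → RN N) := by
  have hσ := h.strictMono.tendsto_atTop
  have hxinf : Tendsto (fun n => ‖x n‖) atTop atTop :=
    tendsto_norm_atTop_of_weakTendsto_translate (fun n => hM _) (hv.comp hσ₀.tendsto_atTop) hw₀ hx
  have hz : WeakTendsto (fun n => (v (σ₀ n)).translate (x n) - w₀) 0 := by
    simpa using hx.sub (weakTendsto_of_tendsto (tendsto_const_nhds (x := w₀)))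
  have hdist : ∀ j, Tendsto (fun n => ‖y j n + x (σ n)‖) atTop atTop := by
    intro j
    have h1 := tendsto_norm_atTop_of_weakTendsto_translate
      (f := fun n => (v (σ₀ (σ n))).translate (x (σ n)) - w₀) (M := M + ‖w₀‖)
      (fun n => (norm_sub_le _ _).trans (by rw [norm_translate]; gcongr; exact hM _))
      (hz.comp hσ) (z := fun n => -(y j n + x (σ n))) (h.ne_zero j) ?_
    · refine h1.congr fun n => ?_
      rw [norm_neg]
    refine fun f => (h.weakTendsto_translate j f).congr fun n => congrArg f ?_
    have e1 : -(y j n + x (σ n)) + x (σ n) = -y j n := by abel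
    have e2 : -y j n + -x (σ n) = -(y j n + x (σ n)) := by abel
    beta_reduce
    rw [translate_sub, translate_sub, translate_translate, translate_translate, e1, e2]
  constructor
  · exact hσ₀.comp h.strictMono
  · intro j
    refine Fin.cases ?_ (fun j => ?_) j
    · exact hw₀
    · exact h.ne_zero j
  · intro j
    refine Fin.cases ?_ (fun j => ?_) j
    · exact hcrit
    · exact h.choquardDeriv_eq_zero j
  · intro j
    refine Fin.cases ?_ (fun j => ?_) j
    · simp only [Fin.cons_zero, norm_neg]
      exact hxinf.comp hσ
    · exact h.tendsto_norm j
  · intro i j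
    refine Fin.cases ?_ (fun i => ?_) i <;> refine Fin.cases ?_ (fun j => ?_) j
    · intro hij
      exact absurd rfl hij
    · intro _
      simpa using hdist j
    · intro _
      simp only [Fin.cons_zero, Fin.cons_succ]
      refine (hdist i).congr fun n => ?_
      rw [← norm_neg]
      congr 1
      abel
    · intro hij
      simpa using h.tendsto_norm_sub i j fun e => hij (by rw [e])
  · refine h.tendsto_sub.congr fun n => ?_
    rw [Fin.sum_univ_succ]
    simp only [Fin.cons_zero, Fin.cons_succ]
    abel
  · rw [Fin.sum_univ_succ]
    simp only [Fin.cons_zero, Fin.cons_succ]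
    refine ((hnorm.comp hσ).add h.tendsto_norm_sq).congr fun n => ?_
    simp only [Function.comp_apply]
    ring

theorem exists_isBubbleDecomposition_of_norm_sq_le (hι : IsLocalEmbedding ι) {c : ℝ} (hc0 : 0 < c)
    (hc : ∀ w : H1 N, w ≠ 0 → ‖w‖ ^ 2 ≤ nonlocal (ι w) → c ≤ ‖w‖ ^ 2) (m : ℕ) :
    ∀ (v : ℕ → H1 N) (M : ℝ), (∀ n, ‖v n‖ ≤ M) → WeakTendsto v 0 →
      Tendsto (fun n => ‖choquardDeriv ι (v n)‖) atTop (𝓝 0) →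
      (∀ᶠ n in atTop, ‖v n‖ ^ 2 ≤ m * (c / 2)) →
      ∃ (σ : ℕ → ℕ) (k : ℕ) (w : Fin k → H1 N) (y : Fin k → ℕ → RN N),
        IsBubbleDecomposition ι v σ w y := by
  induction m with
  | zero =>
    intro v M _ _ _ hle
    refine ⟨id, 0, _, _, isBubbleDecomposition_of_tendsto_zero
      (tendsto_const_nhds.congr' ?_)⟩
    filter_upwards [hle] with n hn
    have h1 : ‖v n‖ ^ 2 ≤ 0 := by simpa using hn
    have h2 : ‖v n‖ = 0 := pow_eq_zero_iff two_ne_zero |>.1 (le_antisymm h1 (sq_nonneg _))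
    exact (norm_eq_zero.1 h2).symm
  | succ m ih =>
    intro v M hM hv hd hle
    by_cases hvan : Tendsto (fun n => ι (v n)) atTop (𝓝 0)
    · exact ⟨id, 0, _, _, isBubbleDecomposition_of_tendsto_zero
        (tendsto_zero_of_choquardDeriv hM hd hvan)⟩
    rw [tendsto_zero_iff_norm_tendsto_zero, Metric.tendsto_atTop] at hvan
    push Not at hvan
    obtain ⟨η, hη, hfreq⟩ := hvan
    obtain ⟨σ₁, hσ₁, hσ₁η⟩ := extraction_of_frequently_atTop
      (P := fun n => η ≤ dist ‖ι (v n)‖ 0) (frequently_atTop.2 hfreq)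
    obtain ⟨w₀, x, σ₂, hw₀, hσ₂, hx⟩ := hι.exists_translate (v := fun n => v (σ₁ n))
      (fun n => hM _) hη fun n => by simpa using hσ₁η n
    set σ₀ : ℕ → ℕ := fun n => σ₁ (σ₂ n)
    have hσ₀ : StrictMono σ₀ := hσ₁.comp hσ₂
    have hx' : WeakTendsto (fun n => (v (σ₀ n)).translate (x n)) w₀ := hx
    have hxinf : Tendsto (fun n => ‖x n‖) atTop atTop :=
      tendsto_norm_atTop_of_weakTendsto_translate (fun n => hM _) (hv.comp hσ₀.tendsto_atTop)
        hw₀ hx'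
    have hz : WeakTendsto (fun n => (v (σ₀ n)).translate (x n) - w₀) 0 := by
      simpa using hx'.sub (weakTendsto_of_tendsto (tendsto_const_nhds (x := w₀)))
    have hzM : ∀ n, ‖(v (σ₀ n)).translate (x n) - w₀‖ ≤ M + ‖w₀‖ := fun n =>
      (norm_sub_le _ _).trans (by rw [norm_translate]; gcongr; exact hM _)
    have hd0 : Tendsto (fun n => ‖choquardDeriv ι ((v (σ₀ n)).translate (x n))‖) atTop (𝓝 0) :=
      tendsto_norm_dual_of_le (hd.comp hσ₀.tendsto_atTop)
        fun n => norm_choquardDeriv_translate_le hι (x n) (v (σ₀ n))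
    obtain ⟨hcrit, hdz⟩ := tendsto_choquardDeriv_of_splitting hι hzM hz (L := choquardDeriv ι w₀)
      (by
        have h1 := tendsto_norm_dual_sub hd0 (tendsto_choquardDeriv_splitting hι hzM hz w₀)
        refine h1.congr fun n => congrArg norm ?_
        rw [sub_add_cancel]
        abel)
    have hzv : ∀ n, v (σ₀ n) - w₀.translate (-x n)
        = ((v (σ₀ n)).translate (x n) - w₀).translate (-x n) := by
      intro n
      rw [translate_sub, translate_neg_translate]
    have hd' : Tendsto (fun n => ‖choquardDeriv ι (v (σ₀ n) - w₀.translate (-x n))‖) atTop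
        (𝓝 0) := by
      refine tendsto_norm_dual_of_le hdz fun n => ?_
      rw [hzv]
      exact norm_choquardDeriv_translate_le hι _ _
    have hv' : WeakTendsto (fun n => v (σ₀ n) - w₀.translate (-x n)) 0 := by
      have h1 : WeakTendsto (fun n => w₀.translate (-x n)) 0 :=
        weakTendsto_translate_zero (by simpa using hxinf) w₀
      simpa using (hv.comp hσ₀.tendsto_atTop).sub h1
    have hnorm : Tendsto (fun n => ‖v (σ₀ n)‖ ^ 2 - ‖v (σ₀ n) - w₀.translate (-x n)‖ ^ 2) atTop
        (𝓝 (‖w₀‖ ^ 2)) := by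
      have h1 := ((weakTendsto_iff.1 hx' w₀).const_mul 2).sub_const (‖w₀‖ ^ 2)
      rw [real_inner_self_eq_norm_sq, two_mul, add_sub_cancel_right] at h1
      refine h1.congr fun n => ?_
      rw [hzv, norm_translate, norm_sub_sq_real, norm_translate]
      ring
    have hcw : c ≤ ‖w₀‖ ^ 2 := by
      refine hc w₀ hw₀ ?_
      have h1 := choquardDeriv_self (ι := ι) w₀
      have h2 : choquardDeriv ι w₀ w₀ = 0 := by rw [hcrit]; rfl
      linarith
    obtain ⟨σ, k, w, y, hdec⟩ := ih _ (M + ‖w₀‖) (fun n => by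
        rw [hzv, norm_translate]
        exact hzM n) hv' hd' (by
      filter_upwards [hσ₀.tendsto_atTop.eventually hle,
        hnorm.eventually (lt_mem_nhds (show ‖w₀‖ ^ 2 - c / 2 < ‖w₀‖ ^ 2 by linarith))] with n h1 h2
      push_cast at h1
      linarith)
    exact ⟨_, _, _, _, hdec.cons hM hv hσ₀ hw₀ hcrit hx' hnorm⟩

/-- Bounded weakly null almost critical sequences of the energy of the Choquard equation decompose
into bubbles. -/
theorem exists_isBubbleDecomposition (hι : IsLocalEmbedding ι) {v : ℕ → H1 N} {M : ℝ}
    (hM : ∀ n, ‖v n‖ ≤ M) (hv : WeakTendsto v 0)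
    (hd : Tendsto (fun n => ‖choquardDeriv ι (v n)‖) atTop (𝓝 0)) :
    ∃ (σ : ℕ → ℕ) (k : ℕ) (w : Fin k → H1 N) (y : Fin k → ℕ → RN N),
      IsBubbleDecomposition ι v σ w y := by
  obtain ⟨c, hc0, hc⟩ := exists_pos_le_norm_sq_of_le_nonlocal ι
  obtain ⟨m, hm⟩ := exists_nat_ge (M ^ 2 / (c / 2))
  rw [div_le_iff₀ (half_pos hc0)] at hm
  refine exists_isBubbleDecomposition_of_norm_sq_le hι hc0 hc m v M hM hv hd
    (Eventually.of_forall fun n => le_trans ?_ hm)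
  gcongr
  exact hM n

end Choquard

section Nehari

variable {H : Type*} [NormedAddCommGroup H] [InnerProductSpace ℝ H]

/-- The norm of a functional vanishing at `u` is controlled by its restriction to a hyperplane not
containing `u`. -/
theorem norm_le_norm_comp_ker {L G : H →L[ℝ] ℝ} {u : H} (hL : L u = 0) (hG : G u ≠ 0) :
    ‖L‖ ≤ ‖L.comp G.ker.subtypeL‖ * (1 + ‖G‖ * ‖u‖ / |G u|) := by
  have h0 : 0 < |G u| := abs_pos.2 hG
  refine ContinuousLinearMap.opNorm_le_bound _ (by positivity) fun v => ?_
  have hmem : v - (G v / G u) • u ∈ G.ker := by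
    rw [LinearMap.mem_ker]
    change G (v - (G v / G u) • u) = 0
    rw [map_sub, map_smul, smul_eq_mul, div_mul_cancel₀ _ hG, sub_self]
  have h1 : L v = (L.comp G.ker.subtypeL) ⟨v - (G v / G u) • u, hmem⟩ := by
    change L v = L (v - (G v / G u) • u)
    rw [map_sub, map_smul, hL, smul_zero, sub_zero]
  have h2 : ‖v - (G v / G u) • u‖ ≤ (1 + ‖G‖ * ‖u‖ / |G u|) * ‖v‖ := by
    calc ‖v - (G v / G u) • u‖ ≤ ‖v‖ + ‖(G v / G u) • u‖ := norm_sub_le _ _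
      _ = ‖v‖ + |G v| / |G u| * ‖u‖ := by rw [norm_smul, Real.norm_eq_abs, abs_div]
      _ ≤ ‖v‖ + ‖G‖ * ‖v‖ / |G u| * ‖u‖ := by
          gcongr
          exact G.le_opNorm v
      _ = _ := by ring
  calc ‖L v‖ ≤ ‖L.comp G.ker.subtypeL‖ * ‖v - (G v / G u) • u‖ := by
        rw [h1]
        exact ContinuousLinearMap.le_opNorm _ _
    _ ≤ ‖L.comp G.ker.subtypeL‖ * ((1 + ‖G‖ * ‖u‖ / |G u|) * ‖v‖) := by gcongr
    _ = _ := by ring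

variable {N : ℕ} {α β p q : ℝ} [hα : Fact (0 < α ∧ α < (N : ℝ))] [hβ : Fact (0 < β ∧ β < (N : ℝ))]
  [hp : Fact (1 < p)] [hq : Fact (1 < q)]

theorem exists_norm_nonlocalDeriv_comp_le (ι : H →L[ℝ] NonlocalSpace N α p) (M : ℝ) :
    ∃ C : ℝ, ∀ u : H, ‖u‖ ≤ M → ‖(nonlocalDeriv (ι u)).comp ι‖ ≤ C := by
  have hp' := hp.out
  refine ⟨‖rieszForm N α‖ * ((‖ι‖ * M) ^ p * (‖ι‖ * M) ^ (p - 1)) * ‖ι‖, fun u hu => ?_⟩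
  have h1 : ‖ι u‖ ≤ ‖ι‖ * M := (ι.le_opNorm u).trans (by gcongr)
  have h2 : 0 ≤ ‖ι‖ * M := (norm_nonneg _).trans h1
  generalize ‖ι‖ * M = m at h1 h2 ⊢
  calc _ ≤ ‖nonlocalDeriv (ι u)‖ * ‖ι‖ := ContinuousLinearMap.opNorm_comp_le _ _
    _ ≤ ‖rieszForm N α‖ * (‖ι u‖ ^ p * ‖ι u‖ ^ (p - 1)) * ‖ι‖ := by
        gcongr
        exact norm_nonlocalDeriv_le _
    _ ≤ _ := by gcongr

theorem hasFDerivAt_nonlocal_comp (ι : H →L[ℝ] NonlocalSpace N α p) (u : H) :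
    HasFDerivAt (fun u => nonlocal (ι u)) ((2 * p) • (nonlocalDeriv (ι u)).comp ι) u :=
  (hasFDerivAt_nonlocal (ι u)).comp u ι.hasFDerivAt

/-- The energy of the reduced equation, in terms of embeddings of `H¹` into the spaces on which the
nonlocal terms are defined. -/
noncomputable def reducedEnergy (ι : H →L[ℝ] NonlocalSpace N α p)
    (κ : H →L[ℝ] NonlocalSpace N β q) (u : H) : ℝ :=
  1 / 2 * ‖u‖ ^ 2 + 1 / (2 * q) * nonlocal (κ u) - 1 / (2 * p) * nonlocal (ι u)

/-- The derivative of `reducedEnergy`. -/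
noncomputable def reducedDeriv (ι : H →L[ℝ] NonlocalSpace N α p)
    (κ : H →L[ℝ] NonlocalSpace N β q) (u : H) : H →L[ℝ] ℝ :=
  innerSL ℝ u + (nonlocalDeriv (κ u)).comp κ - (nonlocalDeriv (ι u)).comp ι

/-- The derivative of `u ↦ ⟨J'(u), u⟩`, where `J` is `reducedEnergy`. -/
noncomputable def reducedNehariDeriv (ι : H →L[ℝ] NonlocalSpace N α p)
    (κ : H →L[ℝ] NonlocalSpace N β q) (u : H) : H →L[ℝ] ℝ :=
  (2 : ℝ) • innerSL ℝ u + (2 * q) • (nonlocalDeriv (κ u)).comp κ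
    - (2 * p) • (nonlocalDeriv (ι u)).comp ι

variable {ι : H →L[ℝ] NonlocalSpace N α p} {κ : H →L[ℝ] NonlocalSpace N β q}

theorem reducedDeriv_apply (u v : H) : reducedDeriv ι κ u v
    = ⟪u, v⟫ + nonlocalDeriv (κ u) (κ v) - nonlocalDeriv (ι u) (ι v) := rfl

theorem reducedDeriv_self (u : H) : reducedDeriv ι κ u u
    = ‖u‖ ^ 2 + nonlocal (κ u) - nonlocal (ι u) := by
  rw [reducedDeriv_apply, nonlocalDeriv_self, nonlocalDeriv_self, real_inner_self_eq_norm_sq]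

theorem reducedNehariDeriv_self (u : H) : reducedNehariDeriv ι κ u u
    = 2 * ‖u‖ ^ 2 + 2 * q * nonlocal (κ u) - 2 * p * nonlocal (ι u) := by
  change 2 * ⟪u, u⟫ + 2 * q * nonlocalDeriv (κ u) (κ u) - 2 * p * nonlocalDeriv (ι u) (ι u) = _
  rw [nonlocalDeriv_self, nonlocalDeriv_self, real_inner_self_eq_norm_sq]

theorem hasFDerivAt_reducedEnergy (u : H) :
    HasFDerivAt (reducedEnergy ι κ) (reducedDeriv ι κ u) u := by
  have hp' : p ≠ 0 := by linarith [hp.out]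
  have hq' : q ≠ 0 := by linarith [hq.out]
  have h := (((hasStrictFDerivAt_norm_sq u).hasFDerivAt.const_mul (1 / 2)).add
    ((hasFDerivAt_nonlocal_comp κ u).const_mul (1 / (2 * q)))).sub
    ((hasFDerivAt_nonlocal_comp ι u).const_mul (1 / (2 * p)))
  refine h.congr_fderiv (ContinuousLinearMap.ext fun v => ?_)
  change 1 / 2 * (2 • innerSL ℝ u) v + 1 / (2 * q) * (2 * q * nonlocalDeriv (κ u) (κ v))
    - 1 / (2 * p) * (2 * p * nonlocalDeriv (ι u) (ι v)) = _
  have e : (2 • innerSL ℝ u) v = 2 * ⟪u, v⟫ := by simp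
  rw [reducedDeriv_apply, e]
  field_simp

theorem hasFDerivAt_reducedDeriv_self (u : H) :
    HasFDerivAt (fun u => reducedDeriv ι κ u u) (reducedNehariDeriv ι κ u) u := by
  have h := ((hasStrictFDerivAt_norm_sq u).hasFDerivAt.add
    (hasFDerivAt_nonlocal_comp κ u)).sub (hasFDerivAt_nonlocal_comp ι u)
  have e : (fun u => reducedDeriv ι κ u u)
      = fun u => ‖u‖ ^ 2 + nonlocal (κ u) - nonlocal (ι u) := funext reducedDeriv_self
  rw [e]
  refine h.congr_fderiv (ContinuousLinearMap.ext fun v => ?_)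
  change (2 • innerSL ℝ u) v + (2 * q * nonlocalDeriv (κ u) (κ v))
    - (2 * p * nonlocalDeriv (ι u) (ι v)) = 2 * ⟪u, v⟫ + 2 * q * nonlocalDeriv (κ u) (κ v)
    - 2 * p * nonlocalDeriv (ι u) (ι v)
  have e : (2 • innerSL ℝ u) v = 2 * ⟪u, v⟫ := by simp
  rw [e]

theorem reducedEnergy_eq_of_reducedDeriv_self {u : H} (h : reducedDeriv ι κ u u = 0) :
    reducedEnergy ι κ u = (1 / 2 - 1 / (2 * p)) * ‖u‖ ^ 2
      + (1 / (2 * q) - 1 / (2 * p)) * nonlocal (κ u) := by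
  rw [reducedDeriv_self] at h
  rw [reducedEnergy, show nonlocal (ι u) = ‖u‖ ^ 2 + nonlocal (κ u) by linarith]
  ring

/-- Palais-Smale sequences on the Nehari manifold are bounded Palais-Smale sequences of the
unconstrained functional. -/
theorem exists_bound_and_tendsto_norm_reducedDeriv (hqp : q ≤ p) {u : ℕ → H} (hu0 : ∀ n, u n ≠ 0)
    (hu : ∀ n, reducedDeriv ι κ (u n) (u n) = 0) {C : ℝ}
    (hC : ∀ n, |reducedEnergy ι κ (u n)| ≤ C)
    (hlim : Tendsto (fun n => ‖(reducedDeriv ι κ (u n)).comp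
      (reducedNehariDeriv ι κ (u n)).ker.subtypeL‖) atTop (𝓝 0)) :
    (∃ M : ℝ, ∀ n, ‖u n‖ ≤ M) ∧ Tendsto (fun n => ‖reducedDeriv ι κ (u n)‖) atTop (𝓝 0) := by
  have hp' := hp.out
  have hq' := hq.out
  have ha : 0 < 1 / 2 - 1 / (2 * p) := by
    rw [sub_pos, one_div_lt_one_div (by linarith) (by linarith)]
    linarith
  have hb : 0 ≤ 1 / (2 * q) - 1 / (2 * p) := by
    rw [sub_nonneg, one_div_le_one_div (by linarith) (by linarith)]
    linarith
  have hM : ∀ n, ‖u n‖ ≤ √(C / (1 / 2 - 1 / (2 * p))) := by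
    intro n
    refine Real.le_sqrt_of_sq_le ?_
    rw [le_div_iff₀ ha]
    have h1 := (le_abs_self _).trans (hC n)
    rw [reducedEnergy_eq_of_reducedDeriv_self (hu n)] at h1
    nlinarith [mul_nonneg hb (nonlocal_nonneg (κ (u n)))]
  set M := √(C / (1 / 2 - 1 / (2 * p)))
  refine ⟨⟨M, hM⟩, ?_⟩
  obtain ⟨c, hc0, hc⟩ := exists_pos_le_norm_sq_of_le_nonlocal ι
  obtain ⟨A, hA⟩ := exists_norm_nonlocalDeriv_comp_le ι M
  obtain ⟨B, hB⟩ := exists_norm_nonlocalDeriv_comp_le κ M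
  have hM0 : 0 ≤ M := (norm_nonneg _).trans (hM 0)
  have hG : ∀ n, ‖reducedNehariDeriv ι κ (u n)‖ ≤ 2 * M + 2 * q * B + 2 * p * A := by
    intro n
    refine (norm_sub_le _ _).trans (add_le_add ((norm_add_le _ _).trans (add_le_add ?_ ?_)) ?_)
    · rw [norm_smul, innerSL_apply_norm, Real.norm_eq_abs, abs_two]
      linarith [hM n]
    · rw [norm_smul, Real.norm_eq_abs, abs_of_nonneg (by linarith)]
      gcongr
      exact hB _ (hM n)
    · rw [norm_smul, Real.norm_eq_abs, abs_of_nonneg (by linarith)]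
      gcongr
      exact hA _ (hM n)
  have hGu : ∀ n, (2 * p - 2) * c ≤ |reducedNehariDeriv ι κ (u n) (u n)| := by
    intro n
    have h1 := hu n
    rw [reducedDeriv_self] at h1
    have hBn := nonlocal_nonneg (κ (u n))
    have h2 : c ≤ ‖u n‖ ^ 2 := hc _ (hu0 n) (by linarith)
    rw [← abs_neg]
    refine le_trans ?_ (le_abs_self _)
    rw [reducedNehariDeriv_self, show nonlocal (ι (u n)) = ‖u n‖ ^ 2 + nonlocal (κ (u n)) by linarith]
    nlinarith [mul_nonneg (sub_nonneg.2 hqp) hBn,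
      mul_nonneg (sub_nonneg.2 h2) (by linarith : (0 : ℝ) ≤ 2 * p - 2)]
  have hpc : 0 < (2 * p - 2) * c := mul_pos (by linarith) hc0
  set D := 1 + (2 * M + 2 * q * B + 2 * p * A) * M / ((2 * p - 2) * c)
  refine squeeze_zero (fun n => norm_nonneg _) (fun n => ?_) (by simpa using hlim.mul_const D)
  refine (norm_le_norm_comp_ker (hu n) (G := reducedNehariDeriv ι κ (u n)) ?_).trans ?_
  · exact abs_pos.1 (hpc.trans_le (hGu n))
  · have h3 := hG n
    have h4 : 0 ≤ 2 * M + 2 * q * B + 2 * p * A := (norm_nonneg _).trans h3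
    refine mul_le_mul_of_nonneg_left (add_le_add_right (div_le_div₀ (by positivity) ?_ hpc (hGu n))
      1) (norm_nonneg ((reducedDeriv ι κ (u n)).comp (reducedNehariDeriv ι κ (u n)).ker.subtypeL))
    exact mul_le_mul h3 (hM n) (norm_nonneg _) h4

end Nehari

section PalaisSmale

variable {N : ℕ} {α β p q : ℝ} [hα : Fact (0 < α ∧ α < (N : ℝ))] [hβ : Fact (0 < β ∧ β < (N : ℝ))]
  [hp : Fact (1 < p)] [hq : Fact (1 < q)] {ι : H1 N →L[ℝ] NonlocalSpace N α p}
  {κ : H1 N →L[ℝ] NonlocalSpace N β q}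

theorem reducedDeriv_eq_choquardDeriv_add (u : H1 N) :
    reducedDeriv ι κ u = choquardDeriv ι u + (nonlocalDeriv (κ u)).comp κ := by
  refine ContinuousLinearMap.ext fun v => ?_
  change ⟪u, v⟫ + nonlocalDeriv (κ u) (κ v) - nonlocalDeriv (ι u) (ι v)
    = ⟪u, v⟫ - nonlocalDeriv (ι u) (ι v) + nonlocalDeriv (κ u) (κ v)
  ring

theorem fderiv_reducedEnergy (u : H1 N) :
    fderiv ℝ (reducedEnergy ι κ) u = reducedDeriv ι κ u := (hasFDerivAt_reducedEnergy u).fderiv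

theorem nehariFunctional_reducedEnergy :
    nehariFunctional (reducedEnergy ι κ) = fun u => reducedDeriv ι κ u u := by
  ext u
  rw [nehariFunctional, fderiv_reducedEnergy]

theorem fderiv_nehariFunctional_reducedEnergy (u : H1 N) :
    fderiv ℝ (nehariFunctional (reducedEnergy ι κ)) u = reducedNehariDeriv ι κ u := by
  rw [nehariFunctional_reducedEnergy]
  exact (hasFDerivAt_reducedDeriv_self u).fderiv

theorem IsNehariPalaisSmale.exists_bound_and_tendsto (hqp : q ≤ p) {u : ℕ → H1 N}
    (hu : IsNehariPalaisSmale (reducedEnergy ι κ) u) :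
    (∃ M : ℝ, ∀ n, ‖u n‖ ≤ M) ∧ Tendsto (fun n => ‖reducedDeriv ι κ (u n)‖) atTop (𝓝 0) := by
  obtain ⟨hmem, ⟨C, hC⟩, hlim⟩ := hu
  refine exists_bound_and_tendsto_norm_reducedDeriv hqp (fun n => (hmem n).1) (fun n => ?_) hC ?_
  · have h1 := (hmem n).2
    rwa [nehariFunctional_reducedEnergy] at h1
  · refine hlim.congr fun n => ?_
    rw [nehariDeriv, fderiv_reducedEnergy, fderiv_nehariFunctional_reducedEnergy]
    rfl

/-- Global compactness for bounded Palais-Smale sequences of the reduced energy. -/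
theorem exists_critical_isBubbleDecomposition (hι : IsLocalEmbedding ι)
    (hκ : ∀ (v : ℕ → H1 N) (v₀ : H1 N) (M : ℝ), (∀ n, ‖v n‖ ≤ M) → WeakTendsto v v₀ →
      Tendsto (fun n => κ (v n)) atTop (𝓝 (κ v₀)))
    {u : ℕ → H1 N} {M : ℝ} (hM : ∀ n, ‖u n‖ ≤ M)
    (hu : Tendsto (fun n => ‖reducedDeriv ι κ (u n)‖) atTop (𝓝 0)) :
    ∃ (u₀ : H1 N) (σ₁ : ℕ → ℕ) (σ : ℕ → ℕ) (k : ℕ) (w : Fin k → H1 N) (y : Fin k → ℕ → RN N),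
      reducedDeriv ι κ u₀ = 0 ∧ StrictMono σ₁ ∧ WeakTendsto (fun n => u (σ₁ n)) u₀ ∧
        IsBubbleDecomposition ι (fun n => u (σ₁ n) - u₀) σ w y := by
  obtain ⟨u₀, σ₁, hσ₁, hweak⟩ := exists_weakTendsto_subseq hM
  have hz : WeakTendsto (fun n => u (σ₁ n) - u₀) 0 := by
    simpa using hweak.sub (weakTendsto_of_tendsto (tendsto_const_nhds (x := u₀)))
  have hzM : ∀ n, ‖u (σ₁ n) - u₀‖ ≤ M + ‖u₀‖ := fun n =>
    (norm_sub_le _ _).trans (by gcongr; exact hM _)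
  have hB : Tendsto (fun n => nonlocalDeriv (κ (u (σ₁ n))) - nonlocalDeriv (κ u₀)) atTop (𝓝 0) := by
    have h1 := (continuous_nonlocalDeriv.tendsto (κ u₀)).comp (hκ _ _ M (fun n => hM _) hweak)
    have h2 := h1.sub_const (nonlocalDeriv (κ u₀))
    rwa [sub_self] at h2
  have h1 := tendsto_norm_dual_sub (tendsto_norm_dual_sub (hu.comp hσ₁.tendsto_atTop)
    (tendsto_choquardDeriv_splitting hι hzM hz u₀)) (tendsto_norm_comp_zero hB κ)
  obtain ⟨hcrit, hd⟩ := tendsto_choquardDeriv_of_splitting hι hzM hz (L := reducedDeriv ι κ u₀) (by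
    refine h1.congr fun n => congrArg norm ?_
    rw [sub_add_cancel (u (σ₁ n)) u₀]
    refine ContinuousLinearMap.ext fun v => ?_
    rw [reducedDeriv_eq_choquardDeriv_add, reducedDeriv_eq_choquardDeriv_add]
    change choquardDeriv ι (u (σ₁ n)) v + nonlocalDeriv (κ (u (σ₁ n))) (κ v)
      - (choquardDeriv ι (u (σ₁ n)) v - choquardDeriv ι (u (σ₁ n) - u₀) v - choquardDeriv ι u₀ v)
      - (nonlocalDeriv (κ (u (σ₁ n))) (κ v) - nonlocalDeriv (κ u₀) (κ v))
      = choquardDeriv ι (u (σ₁ n) - u₀) v + (choquardDeriv ι u₀ v + nonlocalDeriv (κ u₀) (κ v))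
    ring)
  obtain ⟨σ, k, w, y, hdec⟩ := exists_isBubbleDecomposition hι hzM hz hd
  exact ⟨u₀, σ₁, σ, k, w, y, hcrit, hσ₁, hweak, hdec⟩

theorem IsBubbleDecomposition.tendsto_norm_sq_add {v : ℕ → H1 N} {σ : ℕ → ℕ} {k : ℕ}
    {w : Fin k → H1 N} {y : Fin k → ℕ → RN N} (h : IsBubbleDecomposition ι v σ w y)
    (hv : WeakTendsto v 0) (u : H1 N) :
    Tendsto (fun n => ‖v (σ n) + u‖ ^ 2) atTop (𝓝 (‖u‖ ^ 2 + ∑ j, ‖w j‖ ^ 2)) := by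
  have h1 := weakTendsto_iff.1 (hv.comp h.strictMono.tendsto_atTop) u
  rw [inner_zero_left] at h1
  have h2 := (h.tendsto_norm_sq.add (h1.const_mul 2)).add_const (‖u‖ ^ 2)
  rw [mul_zero, add_zero, add_comm] at h2
  refine h2.congr fun n => ?_
  rw [norm_add_sq_real]

theorem IsBubbleDecomposition.tendsto_reducedEnergy
    (hκ : ∀ (v : ℕ → H1 N) (v₀ : H1 N) (M : ℝ), (∀ n, ‖v n‖ ≤ M) → WeakTendsto v v₀ →
      Tendsto (fun n => κ (v n)) atTop (𝓝 (κ v₀)))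
    {u : ℕ → H1 N} {M : ℝ} (hM : ∀ n, ‖u n‖ ≤ M) (hu : ∀ n, reducedDeriv ι κ (u n) (u n) = 0)
    {u₀ : H1 N} (hu₀ : reducedDeriv ι κ u₀ = 0) (hweak : WeakTendsto u u₀) {σ : ℕ → ℕ} {k : ℕ}
    {w : Fin k → H1 N} {y : Fin k → ℕ → RN N}
    (h : IsBubbleDecomposition ι (fun n => u n - u₀) σ w y) :
    Tendsto (fun n => reducedEnergy ι κ (u (σ n))) atTop
      (𝓝 (reducedEnergy ι κ u₀ + ∑ j, (1 / 2 - 1 / (2 * p)) * ‖w j‖ ^ 2)) := by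
  have hz : WeakTendsto (fun n => u n - u₀) 0 := by
    simpa using hweak.sub (weakTendsto_of_tendsto (tendsto_const_nhds (x := u₀)))
  have h1 := h.tendsto_norm_sq_add hz u₀
  simp only [sub_add_cancel] at h1
  have h2 : Tendsto (fun n => nonlocal (κ (u (σ n)))) atTop (𝓝 (nonlocal (κ u₀))) :=
    (continuous_nonlocal.tendsto (κ u₀)).comp
      (hκ _ _ M (fun n => hM _) (hweak.comp h.strictMono.tendsto_atTop))
  have h3 := (h1.const_mul (1 / 2 - 1 / (2 * p))).add (h2.const_mul (1 / (2 * q) - 1 / (2 * p)))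
  have h0 : reducedDeriv ι κ u₀ u₀ = 0 := by
    rw [hu₀]
    rfl
  have e : (1 / 2 - 1 / (2 * p)) * (‖u₀‖ ^ 2 + ∑ j, ‖w j‖ ^ 2)
      + (1 / (2 * q) - 1 / (2 * p)) * nonlocal (κ u₀)
      = reducedEnergy ι κ u₀ + ∑ j, (1 / 2 - 1 / (2 * p)) * ‖w j‖ ^ 2 := by
    rw [reducedEnergy_eq_of_reducedDeriv_self h0, ← Finset.mul_sum]
    ring
  rw [e] at h3
  exact h3.congr fun n => (reducedEnergy_eq_of_reducedDeriv_self (hu _)).symm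

theorem IsBubbleDecomposition.not_tendsto_zero {v : ℕ → H1 N} {σ : ℕ → ℕ} {k : ℕ}
    {w : Fin k → H1 N} {y : Fin k → ℕ → RN N} (h : IsBubbleDecomposition ι v σ w y) (hk : 1 ≤ k) :
    ¬ Tendsto (fun n => v (σ n)) atTop (𝓝 0) := by
  intro hlim
  have h1 : Tendsto (fun n => ‖v (σ n)‖ ^ 2) atTop (𝓝 0) := by
    simpa using hlim.norm.pow 2
  have h2 := tendsto_nhds_unique h.tendsto_norm_sq h1
  rw [Finset.sum_eq_zero_iff_of_nonneg fun j _ => sq_nonneg _] at h2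
  have h3 := h2 ⟨0, hk⟩ (Finset.mem_univ _)
  exact h.ne_zero ⟨0, hk⟩ (norm_eq_zero.1 (pow_eq_zero_iff two_ne_zero |>.1 h3))

end PalaisSmale

section Concrete

variable {N : ℕ} {α t : ℝ} [hα : Fact (0 < α ∧ α < (N : ℝ))] [ht : Fact (1 < t)]

theorem nonlocalDeriv_eq_integral {U V : NonlocalSpace N α t} {f g : RN N → ℝ}
    (hf : (fun x => |U x| ^ t) =ᵐ[volume] f)
    (hg : (fun x => |U x| ^ (t - 2) * U x * V x) =ᵐ[volume] g) :
    Integrable (fun x => rieszPotential α f x * g x) ∧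
      nonlocalDeriv U V = ∫ x, rieszPotential α f x * g x := by
  have h1 : (fun x => rieszPotential α (nem U) x * dnem U V x)
      =ᵐ[volume] fun x => rieszPotential α f x * g x := by
    filter_upwards [(coeFn_dnem U V).trans hg] with x hx
    rw [hx, rieszPotential_congr ((coeFn_nem U).trans hf)]
  refine ⟨(integrable_rieszPotential_mul (nem U) (dnem U V)).congr h1, ?_⟩
  rw [nonlocalDeriv_apply, rieszForm_eq_integral]
  exact integral_congr_ae h1

theorem nonlocal_eq_integral {U : NonlocalSpace N α t} {f : RN N → ℝ}
    (hf : (fun x => |U x| ^ t) =ᵐ[volume] f) :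
    nonlocal U = ∫ x, rieszPotential α f x * f x := by
  rw [nonlocal, rieszForm_eq_integral]
  refine integral_congr_ae ?_
  filter_upwards [(coeFn_nem U).trans hf] with x hx
  rw [hx, rieszPotential_congr ((coeFn_nem U).trans hf)]

omit hα in
theorem rieszPotential_shift (f : RN N → ℝ) (y x : RN N) :
    rieszPotential α (fun z => f (z + y)) x = rieszPotential α f (x + y) := by
  rw [rieszPotential, rieszPotential,
    ← integral_add_right_eq_self (fun z => rieszKernel α (x + y - z) * f z) y]
  simp only [add_sub_add_right_eq_sub]

variable (h1 : IsMulBounded (fun _ : RN N => 1) (nemExp (hlsExp N α) t))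

theorem coeFn_mulEmbed_one (u : H1 N) : mulEmbed h1 u =ᵐ[volume] u.fn := by
  filter_upwards [coeFn_mulEmbed h1 u] with x hx
  rw [hx, one_mul]

theorem nonlocalDeriv_mulEmbed_one (u v : H1 N) :
    Integrable (fun x => rieszPotential α (fun y => |u.fn y| ^ t) x
      * (|u.fn x| ^ (t - 2) * u.fn x * v.fn x)) ∧
    nonlocalDeriv (mulEmbed h1 u) (mulEmbed h1 v)
      = ∫ x, rieszPotential α (fun y => |u.fn y| ^ t) x
        * (|u.fn x| ^ (t - 2) * u.fn x * v.fn x) := by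
  refine nonlocalDeriv_eq_integral ?_ ?_
  · filter_upwards [coeFn_mulEmbed_one h1 u] with x hx
    rw [hx]
  · filter_upwards [coeFn_mulEmbed_one h1 u, coeFn_mulEmbed_one h1 v] with x hx hx'
    rw [hx, hx']

theorem nonlocalDeriv_mulEmbed_one_translate (y : RN N) (u v : H1 N) :
    nonlocalDeriv (mulEmbed h1 (u.translate y)) (mulEmbed h1 (v.translate y))
      = nonlocalDeriv (mulEmbed h1 u) (mulEmbed h1 v) := by
  rw [(nonlocalDeriv_mulEmbed_one h1 u v).2, (nonlocalDeriv_eq_integral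
    (f := fun x => |u.fn (x + y)| ^ t)
    (g := fun x => |u.fn (x + y)| ^ (t - 2) * u.fn (x + y) * v.fn (x + y)) ?_ ?_).2,
    ← integral_add_right_eq_self (fun x => rieszPotential α (fun y => |u.fn y| ^ t) x
        * (|u.fn x| ^ (t - 2) * u.fn x * v.fn x)) y]
  · refine integral_congr_ae (ae_of_all _ fun x => ?_)
    beta_reduce
    rw [rieszPotential_shift (fun z => |u.fn z| ^ t)]
  · filter_upwards [coeFn_mulEmbed_one h1 (u.translate y), u.translate_fn y] with x e1 e2
    rw [e1, e2]
  · filter_upwards [coeFn_mulEmbed_one h1 (u.translate y), u.translate_fn y,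
      coeFn_mulEmbed_one h1 (v.translate y), v.translate_fn y] with x e1 e2 e3 e4
    rw [e1, e2, e3, e4]

theorem isLocalEmbedding_mulEmbed_one (hN : 3 ≤ N) (hm2 : 2 < nemExp (hlsExp N α) t)
    (hm : nemExp (hlsExp N α) t < critExp N) : IsLocalEmbedding (mulEmbed h1) where
  nonlocalDeriv_translate := nonlocalDeriv_mulEmbed_one_translate h1
  tendsto_ballCut hM hv R := tendsto_ballCut_mulEmbed_one hN hm h1 hM hv R
  exists_translate := by
    intro v M hM η hη hv
    refine exists_translate_weakTendsto hN hm2 hm hM (ENNReal.ofReal_pos.2 hη).ne' fun n => ?_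
    have h2 := hv n
    simp only [norm_mulEmbed, one_mul] at h2
    exact ENNReal.ofReal_le_of_le_toReal h2

end Concrete

section Weight

variable {N : ℕ} {q : ℝ}

/-- The weight `K^{1/q}`, for which `K |u|^q = |K^{1/q} u|^q`. -/
noncomputable def weight (q : ℝ) (K : RN N → ℝ) (x : RN N) : ℝ := ‖K x‖ ^ (1 / q)

theorem weight_nonneg (K : RN N → ℝ) (x : RN N) : 0 ≤ weight q K x := by
  rw [weight]
  positivity

theorem memLp_weight {r : ℝ} (hq : 0 < q) (hr : 0 ≤ r) {K : RN N → ℝ}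
    (hK : MemLp K (ENNReal.ofReal r) volume) :
    MemLp (weight q K) (ENNReal.ofReal (r * q)) volume := by
  refine ⟨(hK.1.norm.aemeasurable.pow_const _).aestronglyMeasurable, ?_⟩
  have h := eLpNorm_norm_rpow (p := ENNReal.ofReal (r * q)) (μ := (volume : Measure (RN N))) K
    (one_div_pos.2 hq)
  rw [← ENNReal.ofReal_mul (by positivity), mul_assoc, mul_one_div_cancel hq.ne', mul_one] at h
  change eLpNorm (fun x => ‖K x‖ ^ (1 / q)) _ _ < ⊤
  rw [h]
  exact ENNReal.rpow_lt_top_of_nonneg (by positivity) hK.2.ne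

theorem abs_weight_mul_rpow (hq : 0 < q) {K : RN N → ℝ} {x : RN N} (hx : 0 ≤ K x) (s : ℝ) :
    |weight q K x * s| ^ q = K x * |s| ^ q := by
  rw [abs_mul, abs_of_nonneg (weight_nonneg K x), Real.mul_rpow (weight_nonneg K x) (abs_nonneg _),
    weight, ← Real.rpow_mul (norm_nonneg _), one_div_mul_cancel hq.ne', Real.rpow_one,
    Real.norm_of_nonneg hx]

theorem abs_weight_mul_rpow_sub_two (hq : 0 < q) {K : RN N → ℝ} {x : RN N} (hx : 0 ≤ K x)
    (s τ : ℝ) : |weight q K x * s| ^ (q - 2) * (weight q K x * s) * (weight q K x * τ)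
      = K x * (|s| ^ (q - 2) * s * τ) := by
  have hw := weight_nonneg (q := q) K x
  have h1 : weight q K x ^ (q - 2) * weight q K x * weight q K x = K x := by
    have h2 : weight q K x ^ q = K x := by
      simpa [abs_of_nonneg hw] using abs_weight_mul_rpow hq hx 1
    rcases hw.eq_or_lt with h | h
    · rw [← h, mul_zero]
      rw [← h, Real.zero_rpow hq.ne'] at h2
      exact h2
    · rw [mul_assoc, ← pow_two, ← Real.rpow_natCast, ← Real.rpow_add h]
      simpa using h2
  rw [abs_mul, abs_of_nonneg hw, Real.mul_rpow hw (abs_nonneg _), ← h1]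
  ring

variable {K : RN N → ℝ} {β : ℝ} [hβ : Fact (0 < β ∧ β < (N : ℝ))] [hq : Fact (1 < q)]
  (hw : IsMulBounded (weight q K) (nemExp (hlsExp N β) q)) (hK0 : ∀ᵐ x, 0 ≤ K x)

include hK0

theorem abs_mulEmbed_weight_rpow (u : H1 N) : (fun x => |mulEmbed hw u x| ^ q)
    =ᵐ[volume] fun x => K x * |u.fn x| ^ q := by
  filter_upwards [coeFn_mulEmbed hw u, hK0] with x hx h0
  rw [hx, abs_weight_mul_rpow (by linarith [hq.out]) h0]

theorem nonlocalDeriv_mulEmbed_weight (u v : H1 N) :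
    Integrable (fun x => rieszPotential β (fun y => K y * |u.fn y| ^ q) x
      * (K x * (|u.fn x| ^ (q - 2) * u.fn x * v.fn x))) ∧
    nonlocalDeriv (mulEmbed hw u) (mulEmbed hw v)
      = ∫ x, rieszPotential β (fun y => K y * |u.fn y| ^ q) x
        * (K x * (|u.fn x| ^ (q - 2) * u.fn x * v.fn x)) := by
  refine nonlocalDeriv_eq_integral (abs_mulEmbed_weight_rpow hw hK0 u) ?_
  filter_upwards [coeFn_mulEmbed hw u, coeFn_mulEmbed hw v, hK0] with x hx hx' h0
  rw [hx, hx', abs_weight_mul_rpow_sub_two (by linarith [hq.out]) h0]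

end Weight

section Identification

variable {N : ℕ} {α p q : ℝ} [hα : Fact (0 < α ∧ α < (N : ℝ))] [hβ : Fact (0 < (2 : ℝ) ∧ 2 < (N : ℝ))]
  [hp : Fact (1 < p)] [hq : Fact (1 < q)] {K : RN N → ℝ}
  (h1 : IsMulBounded (fun _ : RN N => 1) (nemExp (hlsExp N α) p))
  (hw : IsMulBounded (weight q K) (nemExp (hlsExp N 2) q))

omit hβ in
theorem nonlocal_mulEmbed_one (u : H1 N) : nonlocal (mulEmbed h1 u)
    = ∫ x, rieszPotential α (fun y => |u.fn y| ^ p) x * |u.fn x| ^ p := by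
  refine nonlocal_eq_integral ?_
  filter_upwards [coeFn_mulEmbed_one h1 u] with x hx
  rw [hx]

theorem energyJ_eq_reducedEnergy (hK0 : ∀ᵐ x, 0 ≤ K x) :
    energyJ α p q K = reducedEnergy (mulEmbed h1) (mulEmbed hw) := by
  ext u
  rw [energyJ, reducedEnergy, H1.norm_sq_eq, nonlocal_mulEmbed_one,
    nonlocal_eq_integral (abs_mulEmbed_weight_rpow hw hK0 u)]
  congr 3
  refine integral_congr_ae (ae_of_all _ fun x => ?_)
  simp only [phi]
  ring

omit hβ in
theorem energyE_eq_of_choquardDeriv_eq_zero {w : H1 N} (h : choquardDeriv (mulEmbed h1) w = 0) :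
    energyE α p w = (1 / 2 - 1 / (2 * p)) * ‖w‖ ^ 2 := by
  have h2 : choquardDeriv (mulEmbed h1) w w = 0 := by
    rw [h]
    rfl
  rw [choquardDeriv_self, sub_eq_zero] at h2
  rw [energyE, ← H1.norm_sq_eq, ← nonlocal_mulEmbed_one h1, ← h2]
  ring

omit hβ in
theorem isChoquardSolution_of_choquardDeriv_eq_zero {w : H1 N}
    (h : choquardDeriv (mulEmbed h1) w = 0) : IsChoquardSolution α p w := by
  intro v
  obtain ⟨h2, h3⟩ := nonlocalDeriv_mulEmbed_one h1 w v
  simp only [mul_assoc] at h2 h3 ⊢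
  refine ⟨h2, ?_⟩
  have h4 : choquardDeriv (mulEmbed h1) w v = 0 := by
    rw [h]
    rfl
  rw [choquardDeriv_apply, sub_eq_zero, H1.inner_eq, h3] at h4
  exact h4

theorem isReducedSolution_of_reducedDeriv_eq_zero (hK0 : ∀ᵐ x, 0 ≤ K x) {u : H1 N}
    (h : reducedDeriv (mulEmbed h1) (mulEmbed hw) u = 0) : IsReducedSolution α p q K u := by
  intro v
  obtain ⟨h2, h3⟩ := nonlocalDeriv_mulEmbed_one h1 u v
  obtain ⟨h4, h5⟩ := nonlocalDeriv_mulEmbed_weight hw hK0 u v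
  have e : (fun x => K x * phi q K u x * (|u.fn x| ^ (q - 2) * u.fn x) * v.fn x)
      = fun x => rieszPotential 2 (fun y => K y * |u.fn y| ^ q) x
        * (K x * (|u.fn x| ^ (q - 2) * u.fn x * v.fn x)) := by
    ext x
    rw [phi]
    ring
  have e' : (fun x => rieszPotential α (fun y => |u.fn y| ^ p) x
        * (|u.fn x| ^ (p - 2) * u.fn x) * v.fn x)
      = fun x => rieszPotential α (fun y => |u.fn y| ^ p) x
        * (|u.fn x| ^ (p - 2) * u.fn x * v.fn x) := by
    ext x
    ring
  rw [e, e']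
  refine ⟨h4, h2, ?_⟩
  have h6 : reducedDeriv (mulEmbed h1) (mulEmbed hw) u v = 0 := by
    rw [h]
    rfl
  rw [reducedDeriv_apply, sub_eq_zero, H1.inner_eq, h3, h5] at h6
  exact h6

end Identification

section Exponents

variable {N : ℕ} {α p : ℝ}

theorem nemExp_hlsExp (hαN : 0 < N + α) :
    nemExp (hlsExp N α) p = ENNReal.ofReal (2 * N / (N + α) * p) := by
  rw [nemExp, hlsExp, ENNReal.ofReal_mul (by positivity)]

theorem two_lt_nemExp_hlsExp (hN : 3 ≤ N) (hα : 0 < α) (hp : (N + α) / N < p) :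
    2 < nemExp (hlsExp N α) p := by
  have hN' : (3 : ℝ) ≤ N := by exact_mod_cast hN
  have hNα : 0 < N + α := by linarith
  rw [div_lt_iff₀ (by linarith)] at hp
  rw [nemExp_hlsExp hNα, show (2 : ENNReal) = ENNReal.ofReal 2 by simp,
    ENNReal.ofReal_lt_ofReal_iff_of_nonneg zero_le_two, div_mul_eq_mul_div, lt_div_iff₀ hNα]
  linarith

theorem nemExp_hlsExp_lt_critExp (hN : 3 ≤ N) (hα : 0 < α) (hp : p < (N + α) / (N - 2)) :
    nemExp (hlsExp N α) p < critExp N := by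
  have hN' : (3 : ℝ) ≤ N := by exact_mod_cast hN
  have hNα : 0 < N + α := by linarith
  rw [lt_div_iff₀ (by linarith)] at hp
  rw [nemExp_hlsExp hNα, critExp, ENNReal.ofReal_lt_ofReal_iff
    (div_pos (by linarith) (by linarith)), div_mul_eq_mul_div, div_lt_div_iff₀ hNα (by linarith)]
  nlinarith

theorem holderTriple_weight {q r : ℝ} (hN : 3 ≤ N) (hr0 : 0 < r) (hq : 0 < q)
    (hr : 1 / r + (q + 1) / (2 * (N : ℝ) / (N - 2)) = 1) :
    ENNReal.HolderTriple (ENNReal.ofReal (r * q)) (critExp N) (nemExp (hlsExp N 2) q) := by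
  have hN' : (3 : ℝ) ≤ N := by exact_mod_cast hN
  have hN2 : (0 : ℝ) < N - 2 := by linarith
  have hN0 : (0 : ℝ) < N := by linarith
  constructor
  rw [nemExp_hlsExp (by linarith), critExp, ← ENNReal.ofReal_inv_of_pos (by positivity),
    ← ENNReal.ofReal_inv_of_pos (by positivity), ← ENNReal.ofReal_inv_of_pos (by positivity),
    ← ENNReal.ofReal_add (by positivity) (by positivity)]
  congr 1
  have h1 : r⁻¹ = 1 - (q + 1) / (2 * (N : ℝ) / (N - 2)) := by
    rw [← one_div]
    linarith
  rw [mul_inv, h1]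
  field_simp
  ring

end Exponents

end Choquard

theorem proposition5p2 (N : ℕ) (hN : 3 ≤ N) (α p q r : ℝ)
    (hα0 : 0 < α) (hαN : α < N)
    (hp1 : (N + α) / N < p) (hp2 : p < (N + α) / (N - 2))
    (hq1 : 1 < q) (hq2 : q < ((N : ℝ) + 2) / (N - 2)) (hqp : q < p)
    (hr : 1 / r + (q + 1) / (2 * (N : ℝ) / (N - 2)) = 1)
    (K : Choquard.RN N → ℝ) (hK0 : ∀ᵐ x, 0 ≤ K x)
    (hK : MemLp K (ENNReal.ofReal r) volume)
    (u : ℕ → Choquard.H1 N)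
    (hu : Choquard.IsNehariPalaisSmale (Choquard.energyJ α p q K) u) :
    ∃ u₀ : Choquard.H1 N, Choquard.IsReducedSolution α p q K u₀ ∧
      ∃ σ : ℕ → ℕ, StrictMono σ ∧
        (Tendsto (fun n => u (σ n)) atTop (𝓝 u₀) ∨
          (Choquard.WeakTendsto (fun n => u (σ n)) u₀ ∧
            ¬ Tendsto (fun n => u (σ n)) atTop (𝓝 u₀) ∧
            ∃ (k : ℕ) (w : Fin k → Choquard.H1 N) (y : Fin k → ℕ → Choquard.RN N),
              1 ≤ k ∧
              (∀ j, w j ≠ 0 ∧ Choquard.IsChoquardSolution α p (w j)) ∧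
              (∀ j, Tendsto (fun n => ‖y j n‖) atTop atTop) ∧
              (∀ i j, i ≠ j → Tendsto (fun n => ‖y j n - y i n‖) atTop atTop) ∧
              Tendsto (fun n => u (σ n) - ∑ j, (w j).translate (y j n)) atTop (𝓝 u₀) ∧
              Tendsto (fun n => Choquard.energyJ α p q K (u (σ n))) atTop
                (𝓝 (Choquard.energyJ α p q K u₀ + ∑ j, Choquard.energyE α p (w j))))) := by
  open Choquard in
  have hN' : (3 : ℝ) ≤ N := by exact_mod_cast hN
  have hN2 : (0 : ℝ) < N - 2 := by linarith
  have : Fact (0 < α ∧ α < (N : ℝ)) := ⟨hα0, hαN⟩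
  have : Fact (0 < (2 : ℝ) ∧ 2 < (N : ℝ)) := ⟨two_pos, by linarith⟩
  have : Fact (1 < q) := ⟨hq1⟩
  have hp : Fact (1 < p) := ⟨hq1.trans hqp⟩
  have hr0 : 0 < r := by
    rw [← one_div_pos, eq_sub_of_add_eq hr, sub_pos, div_lt_one (by positivity),
      lt_div_iff₀ hN2]
    rw [lt_div_iff₀ hN2] at hq2
    linarith
  have hm2 := two_lt_nemExp_hlsExp hN hα0 hp1
  have hm := nemExp_hlsExp_lt_critExp hN hα0 hp2
  have hmq := nemExp_hlsExp_lt_critExp hN two_pos hq2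
  have := holderTriple_weight hN hr0 (zero_lt_one.trans hq1) hr
  have hκ := memLp_weight (zero_lt_one.trans hq1) hr0.le hK
  have h1 := isMulBounded_one hN hm2 hm
  have hw : IsMulBounded (weight q K) (nemExp (hlsExp N 2) q) := isMulBounded_of_memLp hN hκ
  have hι := isLocalEmbedding_mulEmbed_one h1 hN hm2 hm
  have hcomp : ∀ (v : ℕ → H1 N) (v₀ : H1 N) (M : ℝ), (∀ n, ‖v n‖ ≤ M) → WeakTendsto v v₀ →
      Tendsto (fun n => mulEmbed hw (v n)) atTop (𝓝 (mulEmbed hw v₀)) := fun v v₀ M hM hv =>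
    tendsto_mulEmbed_of_weakTendsto hN hκ ENNReal.ofReal_ne_top hmq hw hM hv
  rw [energyJ_eq_reducedEnergy h1 hw hK0] at hu ⊢
  obtain ⟨⟨M, hM⟩, hlim⟩ := hu.exists_bound_and_tendsto hqp.le
  obtain ⟨u₀, σ₁, σ, k, w, y, hcrit, hσ₁, hweak, hdec⟩ :=
    exists_critical_isBubbleDecomposition hι hcomp hM hlim
  refine ⟨u₀, isReducedSolution_of_reducedDeriv_eq_zero h1 hw hK0 hcrit, fun n => σ₁ (σ n),
    hσ₁.comp hdec.strictMono, ?_⟩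
  have hsub : Tendsto (fun n => u (σ₁ (σ n)) - ∑ j, (w j).translate (y j n)) atTop (𝓝 u₀) := by
    have h2 := hdec.tendsto_sub.add_const u₀
    rw [zero_add] at h2
    refine h2.congr fun n => ?_
    abel
  rcases Nat.eq_zero_or_pos k with rfl | hk
  · left
    simpa using hsub
  refine Or.inr ⟨hweak.comp hdec.strictMono.tendsto_atTop, fun hcon => ?_, k, w, y, hk,
    fun j => ⟨hdec.ne_zero j, isChoquardSolution_of_choquardDeriv_eq_zero h1
      (hdec.choquardDeriv_eq_zero j)⟩, hdec.tendsto_norm, hdec.tendsto_norm_sub, hsub, ?_⟩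
  · refine hdec.not_tendsto_zero hk ?_
    simpa using hcon.sub_const u₀
  · simp only [energyE_eq_of_choquardDeriv_eq_zero h1 (hdec.choquardDeriv_eq_zero _)]
    refine hdec.tendsto_reducedEnergy hcomp (fun n => hM _) (fun n => ?_) hcrit hweak
    have h2 := (hu.1 (σ₁ n)).2
    rwa [nehariFunctional_reducedEnergy] at h2
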